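/- Let $n\ge 2$, let $(M,\omega)$ be a symplectic manifold of dimension $2n$ and $J$ an $\omega$-compatible almost complex structure. Let $\iota$ be a symplectic embedding of the open ball of radius $r$ of $(\mathbb{C}^n,\omega_0)$ into $(M,\omega)$ with $\iota^*J=J_0$, the standard complex structure, and let $x_0=\iota(0)$. Let $\pi:\widetilde M\to M$ be the blow-up of $M$ at $x_0$, i.e. the manifold obtained by gluing $M\setminus\{x_0\}$ and $L(r)=\{(z,\ell)\in\mathbb{C}^n\times\mathbb{C}P^{n-1}: z\in\ell,\ |z|<r\}$ along $(z,\ell)\mapsto\iota(z)$, $z\ne0$, and let $E=\pi^{-1}(x_0)\cong\mathbb{C}P^{n-1}$ be the exceptional divisor. Let $\widetilde J$ be the almost complex structure on $\widetilde M$ for which $\pi$ is $(\widetilde J,J)$-holomorphic. Let $0<\rho<r$, $\delta>0$, and let $\beta:[0,r]\to[\rho,r]$ be smooth with $\beta(s)=\sqrt{\rho^2+s^2}$ for $0\le s\le\delta$, $\beta(s)=s$ for $r-\delta\le s\le r$, and $0<\beta'(s)\le1$ for $0<s\le r-\delta$. Let $\widetilde\omega_\rho$ be the symplectic form of weight $\rho$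 on $\widetilde M$, i.e. the symplectic form which is the pullback of $\omega_0$ under $z\mapsto\beta(|z|)z/|z|$ on $L(r)\setminus E\cong\{0<|z|<r\}$ and is $\pi^*\omega$ outside $L(r)$. Let $L\subset(M,\omega)$ be an (embedded) Lagrangian submanifold disjoint from $\iota(\{|z|\le r-\delta\})$, so that $\widetilde L=\pi^{-1}(L)$ is a Lagrangian submanifold of $(\widetilde M,\widetilde\omega_\rho)$. Let $\widetilde u:(D,\partial D)\to(\widetilde M,\widetilde L)$ be a $\widetilde J$-holomorphic disk (smooth up to the boundary). Then $\widetilde u$ meets $E$ in finitely many points, all in the interior of $D$; the intersection number $\ell=\widetilde u\cdot E$, the sum of the local intersection indices at these points, satisfies $\ell\ge0$; the Maslov indices $\mu_{\widetilde L}[\widetilde u]$ and $\mu_L[\pi\circ\widetilde u]$ are well defined; and $$\mu_{\widetilde L}[\widetilde u]=\mu_L[\pi\circ\widetilde u]-2(n-1)\,\ell .$$ Here the Maslov index of a disk $u:(D,\partial D)\to(M,L)$ is the winding number of $t\mapsto\det(U_t)^2$, where in a symplectic trivialization of $u^*TM$ over $D$ the space $T_{u(e^{it})}L$ becomes $U_t\mathbb{R}^n$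 with $U_t\in U(n)$. -/

import Mathlib

open Set Filter Topology
open scoped Manifold ContDiff LinearAlgebra.Projectivization

noncomputable section

namespace LagBlowUp

/-- `ℂⁿ` with its Euclidean norm.  It is used as a real normed space of dimension `2 n`, so that a
manifold of real dimension `2 n` is a manifold modelled on `Cn n` over `ℝ`. -/
abbrev Cn (n : ℕ) : Type := EuclideanSpace ℂ (Fin n)

/-- The model with corners of `2 n`-dimensional real manifolds without boundary. -/
abbrev mdl (n : ℕ) : ModelWithCorners ℝ (Cn n) (Cn n) := modelWithCornersSelf ℝ (Cn n)

/-- The standard symplectic form `∑ᵢ dxᵢ ∧ dyᵢ` on `ℂⁿ`. -/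
def stdForm {n : ℕ} (v w : Cn n) : ℝ :=
  ∑ i, ((v i).re * (w i).im - (v i).im * (w i).re)

/-! ### Linear algebra of the blow-up of `ℂⁿ` at the origin -/

/-- The vector `y` with its `j`-th coordinate replaced by `1`. -/
def fill {n : ℕ} (j : Fin n) (y : Cn n) : Cn n := WithLp.toLp 2 (Function.update y.ofLp j 1)

/-- The blow-down map of `ℂⁿ` in the `j`-th standard chart: `y ↦ y_j • (y with y_j := 1)`. -/
def blowDown {n : ℕ} (j : Fin n) (y : Cn n) : Cn n := y j • fill j y

/-- The `j`-th standard chart of the blow-up, at points off the exceptional divisor: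
`z ↦ (z_j in position j, z_i / z_j in position i ≠ j)`. -/
def blowCoord {n : ℕ} (j : Fin n) (z : Cn n) : Cn n :=
  WithLp.toLp 2 (fun i => if i = j then z j else z i / z j)

/-- The `j`-th standard chart of the blow-up, at the point `(0, [w])` of the exceptional divisor:
`0` in position `j`, and `w_i / w_j` in position `i ≠ j`. -/
def excCoord {n : ℕ} (j : Fin n) (w : Cn n) : Cn n :=
  WithLp.toLp 2 (fun i => if i = j then 0 else w i / w j)

section aux
variable {n : ℕ} (j : Fin n)

theorem fill_self (y : Cn n) : fill j y j = 1 := by simp [fill]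

theorem fill_ne {i : Fin n} (h : i ≠ j) (y : Cn n) : fill j y i = y i := by simp [fill, h]

theorem fill_ne_zero (y : Cn n) : fill j y ≠ 0 := by
  intro h
  have := fill_self j y
  rw [h] at this
  simp at this

theorem blowDown_self (y : Cn n) : blowDown j y j = y j := by simp [blowDown, fill_self]

theorem blowDown_apply (i : Fin n) (y : Cn n) : blowDown j y i = y j * fill j y i := by
  simp [blowDown]

theorem blowDown_eq_zero {y : Cn n} : blowDown j y = 0 ↔ y j = 0 := by
  simp [blowDown, fill_ne_zero]

theorem blowDown_blowCoord {z : Cn n} (h : z j ≠ 0) : blowDown j (blowCoord j z) = z := by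
  ext i
  rw [blowDown_apply]
  by_cases hi : i = j
  · subst hi; simp [fill_self, blowCoord]
  · rw [fill_ne j hi]; simp [blowCoord, hi]; field_simp

theorem blowCoord_blowDown {y : Cn n} (h : y j ≠ 0) : blowCoord j (blowDown j y) = y := by
  ext i
  by_cases hi : i = j
  · subst hi; simp [blowCoord, blowDown_self]
  · simp only [blowCoord, hi, if_false, blowDown_self]
    rw [blowDown_apply, fill_ne j hi]; field_simp

theorem excCoord_smul {c : ℂ} (hc : c ≠ 0) (w : Cn n) : excCoord j (c • w) = excCoord j w := by
  ext i
  by_cases hi : i = j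
  · simp [excCoord, hi]
  · simp only [excCoord, hi, if_false, PiLp.smul_apply, smul_eq_mul]
    rw [mul_div_mul_left _ _ hc]

theorem excCoord_fill {y : Cn n} (h : y j = 0) : excCoord j (fill j y) = y := by
  ext i
  by_cases hi : i = j
  · subst hi; simp [excCoord, h]
  · simp [excCoord, hi, fill_self, fill_ne j hi]

theorem fill_excCoord {w : Cn n} (h : w j ≠ 0) : fill j (excCoord j w) = (w j)⁻¹ • w := by
  ext i
  by_cases hi : i = j
  · subst hi; simp [fill_self, h]
  · rw [fill_ne j hi]; simp [excCoord, hi, div_eq_inv_mul]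

theorem contDiff_coord (i : Fin n) : ContDiff ℝ ∞ (fun y : Cn n => y i) :=
  (contDiff_piLp_apply (𝕜 := ℝ) (p := 2) (E := fun _ : Fin n => ℂ) (i := i))

theorem contDiff_fill_apply (i : Fin n) : ContDiff ℝ ∞ (fun y : Cn n => fill j y i) := by
  by_cases hi : i = j
  · subst hi; simp only [fill_self]; exact contDiff_const
  · simp only [fill_ne j hi]; exact contDiff_coord i

theorem contDiff_blowDown : ContDiff ℝ ∞ (blowDown j) := by
  rw [contDiff_piLp]
  intro i
  simp only [blowDown_apply]
  exact (contDiff_coord j).mul (contDiff_fill_apply j i)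

theorem contDiffOn_blowCoord : ContDiffOn ℝ ∞ (blowCoord j) {z : Cn n | z j ≠ 0} := by
  rw [contDiffOn_piLp]
  intro i
  by_cases hi : i = j
  · simp only [blowCoord, hi, if_true]; exact (contDiff_coord j).contDiffOn
  · simp only [blowCoord, hi, if_false]
    simp only [div_eq_mul_inv]
    exact (contDiff_coord i).contDiffOn.mul ((contDiff_coord j).contDiffOn.inv
      (by intro z hz; exact hz))

theorem exists_rep_ne_zero (l : ℙ ℂ (Cn n)) : ∃ j, l.rep j ≠ 0 := by
  by_contra h
  push Not at h
  exact l.rep_nonzero (by ext i; simpa using h i)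

theorem mk_rep_eq (v : Cn n) (hv : v ≠ 0) :
    ∃ c : ℂ, c ≠ 0 ∧ (Projectivization.mk ℂ v hv).rep = c • v := by
  obtain ⟨a, ha⟩ := (Projectivization.mk_eq_mk_iff ℂ _ _
    (Projectivization.mk ℂ v hv).rep_nonzero hv).1 (Projectivization.mk_rep _)
  exact ⟨a, a.ne_zero, ha.symm⟩

end aux

/-! ### Embedded balls and the one-point blow-up -/

section manifold
variable {n : ℕ} {M : Type*} [TopologicalSpace M] [ChartedSpace (Cn n) M]

variable (n M) in
/-- A smooth embedding `ι` of the open ball of radius `r` of `ℂⁿ` onto an open subset of the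
`2 n`-dimensional manifold `M`, given as `ι = chart.symm` for a chart of the smooth structure whose
target is that ball. -/
structure BallEmbedding where
  /-- The inverse of the embedding. -/
  chart : OpenPartialHomeomorph M (Cn n)
  chart_mem : chart ∈ IsManifold.maximalAtlas (mdl n) ∞ M
  /-- The radius of the ball. -/
  r : ℝ
  r_pos : 0 < r
  target_eq : chart.target = Metric.ball 0 r

namespace BallEmbedding

/-- The embedding of the ball. -/
def emb (b : BallEmbedding n M) : Cn n → M := b.chart.symm

/-- The centre `x₀ = ι 0` of the embedded ball. -/
def center (b : BallEmbedding n M) : M := b.emb 0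

end BallEmbedding

/-- The underlying set of the blow-up of `M` at the centre `x₀` of the embedded ball: the gluing of
`M ∖ {x₀}` and `L(r) = {(z, ℓ) | z ∈ ℓ, |z| < r} ⊆ ℂⁿ × ℂPⁿ⁻¹` along
`L(r) ∖ E ≃ ι(ball) ∖ {x₀}`, `(z, ℓ) ↦ ι z`, is the disjoint union of `M ∖ {x₀}` and of the
exceptional divisor `E = ℂPⁿ⁻¹` of the points `(0, ℓ)` of `L(r)`. -/
inductive BlowUp (b : BallEmbedding n M) : Type _
  /-- A point of `M ∖ {x₀}`. -/
  | off (x : M) (hx : x ≠ b.center) : BlowUp b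
  /-- The point `(0, ℓ)` of the exceptional divisor. -/
  | exc (l : ℙ ℂ (Cn n)) : BlowUp b

namespace BlowUp
variable (b : BallEmbedding n M)

/-- The blow-up map `π : M̃ → M`. -/
def proj : BlowUp b → M
  | off x _ => x
  | exc _ => b.center

/-- The exceptional divisor `E = π⁻¹(x₀)`. -/
def excDivisor : Set (BlowUp b) := proj b ⁻¹' {b.center}

variable {b}

open Classical in
/-- The point of the blow-up over `x ≠ x₀`; the default value `p` is used when `x = x₀`. -/
def pointOver (p : BlowUp b) (x : M) : BlowUp b := if h : x ≠ b.center then off x h else p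

theorem pointOver_of_ne (p : BlowUp b) {x : M} (h : x ≠ b.center) : pointOver p x = off x h := by
  simp [pointOver, h]

theorem center_mem : (0 : Cn n) ∈ b.chart.target := by
  rw [b.target_eq]; exact Metric.mem_ball_self b.r_pos

theorem chart_center : b.chart b.center = 0 := b.chart.right_inv center_mem

theorem center_mem_source : b.center ∈ b.chart.source := b.chart.map_target center_mem

theorem symm_ne_center {z : Cn n} (hz : z ∈ b.chart.target) : b.chart.symm z ≠ b.center ↔ z ≠ 0 := by
  constructor
  · rintro h rfl; exact h rfl
  · intro h h'
    apply h
    rw [← b.chart.right_inv hz, h', chart_center]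

theorem chart_ne_zero {x : M} (hx : x ∈ b.chart.source) : b.chart x ≠ 0 ↔ x ≠ b.center := by
  rw [← symm_ne_center (b.chart.map_source hx), b.chart.left_inv hx]

variable (b)

/-- The chart of the blow-up induced by the preferred chart of `M` at `x ≠ x₀`, restricted to the
complement of `x₀`. -/
def offChart (x : M) (hx : x ≠ b.center) : PartialEquiv (BlowUp b) (Cn n) where
  toFun p := chartAt (Cn n) x (proj b p)
  invFun y := pointOver (off x hx) ((chartAt (Cn n) x).symm y)
  source := {p | p ∉ excDivisor b ∧ proj b p ∈ (chartAt (Cn n) x).source}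
  target := {y | y ∈ (chartAt (Cn n) x).target ∧ (chartAt (Cn n) x).symm y ≠ b.center}
  map_source' := by
    rintro p ⟨hp, hps⟩
    refine ⟨(chartAt (Cn n) x).map_source hps, ?_⟩
    rw [(chartAt (Cn n) x).left_inv hps]; exact hp
  map_target' := by
    rintro y ⟨hy, hyc⟩
    rw [pointOver_of_ne _ hyc]
    exact ⟨hyc, (chartAt (Cn n) x).map_target hy⟩
  left_inv' := by
    rintro p ⟨hp, hps⟩
    rw [(chartAt (Cn n) x).left_inv hps, pointOver_of_ne _ hp]
    cases p with
    | off x' h => rfl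
    | exc l => exact absurd rfl hp
  right_inv' := by
    rintro y ⟨hy, hyc⟩
    rw [pointOver_of_ne _ hyc]
    exact (chartAt (Cn n) x).right_inv hy

/-- The coordinates of the `j`-th standard chart of `L(r) ⊆ M̃`. -/
def excFun (j : Fin n) : BlowUp b → Cn n
  | off x _ => blowCoord j (b.chart x)
  | exc l => excCoord j l.rep

/-- The domain of the `j`-th standard chart of `L(r) ⊆ M̃`: the points of `L(r)` whose line has
non-vanishing `j`-th homogeneous coordinate. -/
def excSource (j : Fin n) : BlowUp b → Prop
  | off x _ => x ∈ b.chart.source ∧ b.chart x j ≠ 0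
  | exc l => l.rep j ≠ 0

open Classical in
/-- The inverse of the `j`-th standard chart of `L(r) ⊆ M̃`. -/
def excInv (j : Fin n) (y : Cn n) : BlowUp b :=
  if y j = 0 then exc (Projectivization.mk ℂ (fill j y) (fill_ne_zero j y))
  else pointOver (exc (Projectivization.mk ℂ (fill j y) (fill_ne_zero j y))) (b.emb (blowDown j y))

theorem emb_blowDown_ne (j : Fin n) {y : Cn n} (hy : blowDown j y ∈ Metric.ball 0 b.r)
    (h : y j ≠ 0) : b.emb (blowDown j y) ≠ b.center := by
  rw [← b.target_eq] at hy
  exact (symm_ne_center hy).2 (mt (blowDown_eq_zero j).1 h)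

theorem excInv_of_eq (j : Fin n) {y : Cn n} (h : y j = 0) :
    excInv b j y = exc (Projectivization.mk ℂ (fill j y) (fill_ne_zero j y)) := by
  rw [excInv, if_pos h]

theorem excInv_of_ne (j : Fin n) {y : Cn n} (hy : blowDown j y ∈ Metric.ball 0 b.r)
    (h : y j ≠ 0) : excInv b j y = off (b.emb (blowDown j y)) (emb_blowDown_ne b j hy h) := by
  rw [excInv, if_neg h, pointOver_of_ne]

/-- The `j`-th standard chart of `L(r) ⊆ M̃`.  Its `j`-th component is a local equation of the
exceptional divisor. -/
def excChart (j : Fin n) : PartialEquiv (BlowUp b) (Cn n) where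
  toFun := excFun b j
  invFun := excInv b j
  source := {p | excSource b j p}
  target := {y | blowDown j y ∈ Metric.ball 0 b.r}
  map_source' := by
    rintro (⟨x, hx⟩ | l) hp
    · rw [mem_ofPred_eq, excFun]
      rw [blowDown_blowCoord j hp.2, ← b.target_eq]
      exact b.chart.map_source hp.1
    · rw [mem_ofPred_eq, excFun]
      rw [(blowDown_eq_zero j).2 (by simp [excCoord])]
      exact Metric.mem_ball_self b.r_pos
  map_target' := by
    intro y hy
    rw [mem_ofPred_eq] at hy
    by_cases h : y j = 0
    · rw [excInv_of_eq b j h]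
      obtain ⟨c, hc, hrep⟩ := mk_rep_eq (fill j y) (fill_ne_zero j y)
      change (Projectivization.mk ℂ (fill j y) _).rep j ≠ 0
      rw [hrep]
      simp [fill_self, hc]
    · have hy' : blowDown j y ∈ b.chart.target := by rw [b.target_eq]; exact hy
      rw [excInv_of_ne b j hy h]
      refine ⟨b.chart.map_target hy', ?_⟩
      rw [BallEmbedding.emb, b.chart.right_inv hy', blowDown_self]
      exact h
  left_inv' := by
    rintro (⟨x, hx⟩ | l) hp
    · have h0 : blowCoord j (b.chart x) j ≠ 0 := by simpa [blowCoord] using hp.2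
      change excInv b j (blowCoord j (b.chart x)) = _
      rw [excInv, if_neg h0]
      simp only [blowDown_blowCoord j hp.2, BallEmbedding.emb,
        b.chart.left_inv hp.1, pointOver_of_ne _ hx]
    · have hl : l.rep j ≠ 0 := hp
      have h0 : excCoord j l.rep j = 0 := by simp [excCoord]
      change excInv b j (excCoord j l.rep) = _
      rw [excInv_of_eq b j h0]
      congr 1
      conv_rhs => rw [← l.mk_rep]
      rw [Projectivization.mk_eq_mk_iff']
      exact ⟨(l.rep j)⁻¹, (fill_excCoord j hl).symm⟩
  right_inv' := by
    intro y hy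
    rw [mem_ofPred_eq] at hy
    by_cases h : y j = 0
    · rw [excInv_of_eq b j h]
      obtain ⟨c, hc, hrep⟩ := mk_rep_eq (fill j y) (fill_ne_zero j y)
      change excCoord j (Projectivization.mk ℂ (fill j y) _).rep = _
      rw [hrep, excCoord_smul j hc, excCoord_fill j h]
    · have hy' : blowDown j y ∈ b.chart.target := by rw [b.target_eq]; exact hy
      rw [excInv_of_ne b j hy h]
      change blowCoord j (b.chart (b.chart.symm (blowDown j y))) = _
      rw [b.chart.right_inv hy', blowCoord_blowDown j h]

/-- The charts of the blow-up. -/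
inductive IsChart : PartialEquiv (BlowUp b) (Cn n) → Prop
  | off (x : M) (hx : x ≠ b.center) : IsChart (offChart b x hx)
  | exc (j : Fin n) : IsChart (excChart b j)

/-- The preferred chart at a point of the blow-up. -/
def chartAtPoint : BlowUp b → PartialEquiv (BlowUp b) (Cn n)
  | off x hx => offChart b x hx
  | exc l => excChart b (exists_rep_ne_zero l).choose


theorem exists_mem_source (p : BlowUp b) : p ∈ (chartAtPoint b p).source := by
  cases p with
  | off x hx => exact ⟨hx, mem_chart_source (Cn n) x⟩
  | exc l => exact (exists_rep_ne_zero l).choose_spec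

theorem isChart_chartAtPoint (p : BlowUp b) : IsChart b (chartAtPoint b p) := by
  cases p with
  | off x hx => exact .off x hx
  | exc l => exact .exc _

theorem contDiffOn_transition {e e' : OpenPartialHomeomorph M (Cn n)}
    (he : e ∈ IsManifold.maximalAtlas (mdl n) ∞ M)
    (he' : e' ∈ IsManifold.maximalAtlas (mdl n) ∞ M) :
    ContDiffOn ℝ ∞ (fun y => e' (e.symm y)) (e.target ∩ e.symm ⁻¹' e'.source) := by
  have h := IsManifold.compatible_of_mem_maximalAtlas he he'
  rw [contDiffGroupoid, mem_groupoid_of_pregroupoid] at h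
  simpa [contDiffPregroupoid, Function.comp_def] using h.1

/-- Admissible pairs of charts: the change of charts has open domain and is smooth. -/
def Compat (c c' : PartialEquiv (BlowUp b) (Cn n)) : Prop :=
  IsOpen (c.symm.trans c').source ∧
    ContDiffOn ℝ ∞ (c.symm.trans c') (c.symm.trans c').source

variable {b} in
theorem compat_of_eq {c c' : PartialEquiv (BlowUp b) (Cn n)} {s : Set (Cn n)} {f : Cn n → Cn n}
    (hs : IsOpen s) (hf : ContDiffOn ℝ ∞ f s) (h1 : (c.symm.trans c').source = s)
    (h2 : ∀ y ∈ s, c' (c.symm y) = f y) : Compat b c c' := by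
  refine ⟨h1 ▸ hs, ?_⟩
  rw [h1]
  exact hf.congr h2

variable [T1Space M]

theorem isOpen_off (e e' : OpenPartialHomeomorph M (Cn n)) :
    IsOpen ((e.target ∩ e.symm ⁻¹' e'.source) ∩ (e.target ∩ e.symm ⁻¹' {b.center}ᶜ)) :=
  (e.isOpen_inter_preimage_symm e'.open_source).inter
    (e.isOpen_inter_preimage_symm isOpen_compl_singleton)

variable [IsManifold (mdl n) ∞ M]

theorem compat_isChart {c c' : PartialEquiv (BlowUp b) (Cn n)} (hc : IsChart b c)
    (hc' : IsChart b c') : Compat b c c' := by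
  cases hc with
  | off x hx =>
    have hx1 : chartAt (Cn n) x ∈ IsManifold.maximalAtlas (mdl n) ∞ M :=
      IsManifold.chart_mem_maximalAtlas x
    cases hc' with
    | off x' hx' =>
      have hx2 : chartAt (Cn n) x' ∈ IsManifold.maximalAtlas (mdl n) ∞ M :=
        IsManifold.chart_mem_maximalAtlas x'
      refine compat_of_eq (isOpen_off b (chartAt (Cn n) x) (chartAt (Cn n) x'))
        ((contDiffOn_transition hx1 hx2).mono inter_subset_left) ?_ ?_
      · ext y
        constructor
        · rintro ⟨⟨h1, h2⟩, h3⟩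
          change pointOver (off x hx) ((chartAt (Cn n) x).symm y) ∈ (offChart b x' hx').source at h3
          rw [pointOver_of_ne _ h2] at h3
          exact ⟨⟨h1, h3.2⟩, h1, h2⟩
        · rintro ⟨⟨h1, h3⟩, -, h2⟩
          refine ⟨⟨h1, h2⟩, ?_⟩
          change pointOver (off x hx) ((chartAt (Cn n) x).symm y) ∈ (offChart b x' hx').source
          rw [pointOver_of_ne _ h2]
          exact ⟨h2, h3⟩
      · rintro y ⟨⟨h1, h3⟩, -, h2⟩
        change chartAt (Cn n) x' (proj b (pointOver (off x hx) ((chartAt (Cn n) x).symm y))) = _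
        rw [pointOver_of_ne _ h2]
        rfl
    | exc j =>
      have ho : IsOpen (((chartAt (Cn n) x).target ∩ (chartAt (Cn n) x).symm ⁻¹' b.chart.source) ∩
          (fun y => b.chart ((chartAt (Cn n) x).symm y)) ⁻¹' {z : Cn n | z j ≠ 0}) :=
        (contDiffOn_transition hx1 b.chart_mem).continuousOn.isOpen_inter_preimage
          ((chartAt (Cn n) x).isOpen_inter_preimage_symm b.chart.open_source)
          (isOpen_ne_fun (contDiff_coord j).continuous continuous_const)
      have key : ∀ z : M, z ∈ b.chart.source → b.chart z j ≠ 0 → z ≠ b.center := by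
        rintro z - hz rfl
        rw [chart_center] at hz
        exact hz rfl
      refine compat_of_eq ho ((contDiffOn_blowCoord j).comp
        ((contDiffOn_transition hx1 b.chart_mem).mono inter_subset_left)
        (fun y hy => hy.2)) ?_ ?_
      · ext y
        constructor
        · rintro ⟨⟨h1, h2⟩, h3⟩
          change pointOver (off x hx) ((chartAt (Cn n) x).symm y) ∈ (excChart b j).source at h3
          rw [pointOver_of_ne _ h2] at h3
          exact ⟨⟨h1, h3.1⟩, h3.2⟩
        · rintro ⟨⟨h1, h3⟩, h4⟩
          have h2 := key _ h3 h4
          refine ⟨⟨h1, h2⟩, ?_⟩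
          change pointOver (off x hx) ((chartAt (Cn n) x).symm y) ∈ (excChart b j).source
          rw [pointOver_of_ne _ h2]
          exact ⟨h3, h4⟩
      · rintro y ⟨⟨h1, h3⟩, h4⟩
        have h2 := key _ h3 h4
        change excFun b j (pointOver (off x hx) ((chartAt (Cn n) x).symm y)) = _
        rw [pointOver_of_ne _ h2]
        rfl
  | exc j =>
    cases hc' with
    | off x hx =>
      have hx1 : chartAt (Cn n) x ∈ IsManifold.maximalAtlas (mdl n) ∞ M :=
        IsManifold.chart_mem_maximalAtlas x
      have ho : IsOpen (blowDown j ⁻¹' (b.chart.target ∩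
          b.chart.symm ⁻¹' (chartAt (Cn n) x).source) ∩ {y : Cn n | y j ≠ 0}) :=
        ((b.chart.isOpen_inter_preimage_symm (chartAt (Cn n) x).open_source).preimage
          (contDiff_blowDown j).continuous).inter
          (isOpen_ne_fun (contDiff_coord j).continuous continuous_const)
      refine compat_of_eq ho ((contDiffOn_transition b.chart_mem hx1).comp
        (contDiff_blowDown j).contDiffOn (fun y hy => hy.1)) ?_ ?_
      · ext y
        constructor
        · rintro ⟨h1, h3⟩
          change excInv b j y ∈ (offChart b x hx).source at h3
          have h1' : blowDown j y ∈ Metric.ball 0 b.r := h1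
          by_cases h : y j = 0
          · rw [excInv_of_eq b j h] at h3
            exact absurd rfl h3.1
          · rw [excInv_of_ne b j h1 h] at h3
            rw [← b.target_eq] at h1'
            exact ⟨⟨h1', h3.2⟩, h⟩
        · rintro ⟨⟨h1, h3⟩, h⟩
          rw [b.target_eq] at h1
          refine ⟨h1, ?_⟩
          change excInv b j y ∈ (offChart b x hx).source
          rw [excInv_of_ne b j h1 h]
          exact ⟨emb_blowDown_ne b j h1 h, h3⟩
      · rintro y ⟨⟨h1, h3⟩, h⟩
        rw [b.target_eq] at h1
        change (chartAt (Cn n) x) (proj b (excInv b j y)) = _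
        rw [excInv_of_ne b j h1 h]
        rfl
    | exc k =>
      have ho : IsOpen (blowDown j ⁻¹' Metric.ball 0 b.r ∩ {y : Cn n | fill j y k ≠ 0}) :=
        (Metric.isOpen_ball.preimage (contDiff_blowDown j).continuous).inter
          (isOpen_ne_fun (contDiff_fill_apply j k).continuous continuous_const)
      refine compat_of_eq (f := fun y => WithLp.toLp 2
        (fun i => if i = k then y j * fill j y k else fill j y i / fill j y k)) ho ?_ ?_ ?_
      · rw [contDiffOn_piLp]
        intro i
        by_cases hi : i = k
        · simp only [hi, if_true]
          exact ((contDiff_coord j).mul (contDiff_fill_apply j k)).contDiffOn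
        · simp only [hi, if_false]
          simp only [div_eq_mul_inv]
          exact (contDiff_fill_apply j i).contDiffOn.mul ((contDiff_fill_apply j k).contDiffOn.inv
            (by intro y hy; exact hy.2))
      · ext y
        constructor
        · rintro ⟨h1, h3⟩
          change excInv b j y ∈ (excChart b k).source at h3
          refine ⟨h1, ?_⟩
          by_cases h : y j = 0
          · rw [excInv_of_eq b j h] at h3
            obtain ⟨c, hc, hrep⟩ := mk_rep_eq (fill j y) (fill_ne_zero j y)
            change (Projectivization.mk ℂ (fill j y) _).rep k ≠ 0 at h3
            rw [hrep] at h3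
            exact right_ne_zero_of_mul (a := c) (by simpa using h3)
          · have h1' : blowDown j y ∈ b.chart.target := by rw [b.target_eq]; exact h1
            rw [excInv_of_ne b j h1 h] at h3
            have h4 := h3.2
            rw [BallEmbedding.emb, b.chart.right_inv h1', blowDown_apply] at h4
            exact right_ne_zero_of_mul h4
        · rintro ⟨h1, h2⟩
          refine ⟨h1, ?_⟩
          change excInv b j y ∈ (excChart b k).source
          by_cases h : y j = 0
          · rw [excInv_of_eq b j h]
            obtain ⟨c, hc, hrep⟩ := mk_rep_eq (fill j y) (fill_ne_zero j y)
            change (Projectivization.mk ℂ (fill j y) _).rep k ≠ 0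
            rw [hrep]
            exact mul_ne_zero hc h2
          · have h1' : blowDown j y ∈ b.chart.target := by rw [b.target_eq]; exact h1
            rw [excInv_of_ne b j h1 h]
            refine ⟨b.chart.map_target h1', ?_⟩
            rw [BallEmbedding.emb, b.chart.right_inv h1', blowDown_apply]
            exact mul_ne_zero h h2
      · rintro y ⟨h1, h2⟩
        have h2' : fill j y k ≠ 0 := h2
        by_cases h : y j = 0
        · change excFun b k (excInv b j y) = _
          rw [excInv_of_eq b j h]
          obtain ⟨c, hc, hrep⟩ := mk_rep_eq (fill j y) (fill_ne_zero j y)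
          change excCoord k (Projectivization.mk ℂ (fill j y) _).rep = _
          rw [hrep, excCoord_smul k hc]
          ext i
          by_cases hi : i = k
          · simp [excCoord, hi, h]
          · simp [excCoord, hi]
        · have h1' : blowDown j y ∈ b.chart.target := by rw [b.target_eq]; exact h1
          change excFun b k (excInv b j y) = _
          rw [excInv_of_ne b j h1 h]
          change blowCoord k (b.chart (b.chart.symm (blowDown j y))) = _
          rw [b.chart.right_inv h1']
          ext i
          by_cases hi : i = k
          · simp [blowCoord, hi, blowDown_apply]
          · simp only [blowCoord, hi, if_false, blowDown_apply]
            rw [mul_div_mul_left _ _ h]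

/-- The charts of the blow-up, as a charted space structure. -/
def core : ChartedSpaceCore (Cn n) (BlowUp b) where
  atlas := {c | IsChart b c}
  chartAt := chartAtPoint b
  mem_chart_source := exists_mem_source b
  chart_mem_atlas := isChart_chartAtPoint b
  open_source _ _ hc hc' := (compat_isChart b hc hc').1
  continuousOn_toFun _ _ hc hc' := (compat_isChart b hc hc').2.continuousOn

instance : TopologicalSpace (BlowUp b) := (core b).toTopologicalSpace

instance : ChartedSpace (Cn n) (BlowUp b) := (core b).toChartedSpace

/-- The blow-up is a smooth manifold of real dimension `2 n`. -/
instance : IsManifold (mdl n) ∞ (BlowUp b) := by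
  refine isManifold_of_contDiffOn (mdl n) ∞ (BlowUp b) ?_
  rintro e e' he he'
  obtain ⟨c, hc, he⟩ := mem_iUnion₂.1 he
  obtain ⟨c', hc', he'⟩ := mem_iUnion₂.1 he'
  rw [mem_singleton_iff] at he he'
  subst he he'
  have := (compat_isChart b hc hc').2
  have hs : ∀ s : Set (Cn n), (mdl n).symm ⁻¹' s ∩ range (mdl n) = s := by intro s; simp
  rw [hs]
  exact this

end BlowUp

/-! ### Symplectic forms and almost complex structures -/

variable (n M) in
/-- A symplectic form on a `2 n`-dimensional manifold: a smooth, alternating, nondegenerate, closed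
`2`-form.  Closedness is `(dΩ)(a, b, c) = 0` for coordinate vector fields `a, b, c` in every chart
of the atlas. -/
structure SymplecticForm [IsManifold (mdl n) ∞ M] where
  /-- The bilinear form on the tangent space at `x`. -/
  form (x : M) : TangentSpace (mdl n) x →L[ℝ] TangentSpace (mdl n) x →L[ℝ] ℝ
  smooth : ContMDiff (mdl n) ((mdl n).prod 𝓘(ℝ, Cn n →L[ℝ] Cn n →L[ℝ] ℝ)) ∞
    (fun x : M => Bundle.TotalSpace.mk' (Cn n →L[ℝ] Cn n →L[ℝ] ℝ)
      (E := fun x : M => TangentSpace (mdl n) x →L[ℝ] TangentSpace (mdl n) x →L[ℝ] ℝ) x (form x))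
  alt (x : M) (v : TangentSpace (mdl n) x) : form x v v = 0
  nondegenerate (x : M) (v : TangentSpace (mdl n) x) : (∀ w, form x v w = 0) → v = 0
  closed (e : OpenPartialHomeomorph M (Cn n)) (he : e ∈ atlas (Cn n) M) (y : Cn n)
    (hy : y ∈ e.target) (v₁ v₂ v₃ : Cn n) :
    let coord (v w : Cn n) (y' : Cn n) : ℝ :=
      form (e.symm y') (mfderiv (mdl n) (mdl n) e.symm y' v) (mfderiv (mdl n) (mdl n) e.symm y' w)
    fderiv ℝ (coord v₂ v₃) y v₁ + fderiv ℝ (coord v₃ v₁) y v₂ + fderiv ℝ (coord v₁ v₂) y v₃ = 0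

variable (n M) in
/-- A smooth almost complex structure. -/
structure AlmostComplex [IsManifold (mdl n) ∞ M] where
  /-- The endomorphism of the tangent space at `x`. -/
  J (x : M) : TangentSpace (mdl n) x →L[ℝ] TangentSpace (mdl n) x
  smooth : ContMDiff (mdl n) ((mdl n).prod 𝓘(ℝ, Cn n →L[ℝ] Cn n)) ∞
    (fun x : M => Bundle.TotalSpace.mk' (Cn n →L[ℝ] Cn n)
      (E := fun x : M => TangentSpace (mdl n) x →L[ℝ] TangentSpace (mdl n) x) x (J x))
  sq (x : M) (v : TangentSpace (mdl n) x) : J x (J x v) = -v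

/-- `J` is `Ω`-compatible: `Ω(·, J ·)` is a Riemannian metric. -/
structure Compatible [IsManifold (mdl n) ∞ M] (Ω : SymplecticForm n M) (J : AlmostComplex n M) :
    Prop where
  invariant (x : M) (v w : TangentSpace (mdl n) x) : Ω.form x (J.J x v) (J.J x w) = Ω.form x v w
  pos (x : M) (v : TangentSpace (mdl n) x) : v ≠ 0 → 0 < Ω.form x v (J.J x v)

/-- The embedding `ι` of the ball is symplectic: `ι^* Ω = Ω₀`. -/
def BallEmbedding.IsSymplectic [IsManifold (mdl n) ∞ M] (b : BallEmbedding n M)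
    (Ω : SymplecticForm n M) : Prop :=
  ∀ z ∈ Metric.ball (0 : Cn n) b.r, ∀ v w : Cn n,
    Ω.form (b.emb z) (mfderiv (mdl n) (mdl n) b.emb z v) (mfderiv (mdl n) (mdl n) b.emb z w) =
      stdForm v w

/-- `ι^* J = J₀`, the standard complex structure of `ℂⁿ`. -/
def BallEmbedding.IsHolomorphic [IsManifold (mdl n) ∞ M] (b : BallEmbedding n M)
    (J : AlmostComplex n M) : Prop :=
  ∀ z ∈ Metric.ball (0 : Cn n) b.r, ∀ v : Cn n,
    mfderiv (mdl n) (mdl n) b.emb z (Complex.I • v : Cn n) =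
      J.J (b.emb z) (mfderiv (mdl n) (mdl n) b.emb z v)

/-! ### The symplectic form of weight `ρ` on the blow-up -/

/-- A function `β : [0, r] → [ρ, r]` used to define the symplectic blow-up of weight `ρ`. -/
structure IsProfile (r ρ δ : ℝ) (β : ℝ → ℝ) : Prop where
  smooth : ContDiffOn ℝ ∞ β (Icc 0 r)
  mapsTo : MapsTo β (Icc 0 r) (Icc ρ r)
  near (s : ℝ) : s ∈ Icc 0 δ → β s = √(ρ ^ 2 + s ^ 2)
  far (s : ℝ) : s ∈ Icc (r - δ) r → β s = s
  deriv_mem (s : ℝ) : s ∈ Ioc 0 (r - δ) → deriv β s ∈ Ioc (0 : ℝ) 1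

open Classical in
/-- The map `M ∖ {x₀} → M ∖ ι(B(ρ))` which is `ι z ↦ ι (β(|z|) z / |z|)` on the embedded ball and the
identity elsewhere. -/
def inflate (b : BallEmbedding n M) (β : ℝ → ℝ) (x : M) : M :=
  if x ∈ b.chart.source then b.emb ((β ‖b.chart x‖ / ‖b.chart x‖) • b.chart x) else x

/-- `Ω'` is the symplectic form of the blow-up: off the exceptional divisor it is the pullback of
`Ω` under `z ↦ β(|z|) z / |z|` on `L(r) ∖ E` and it is `π^* Ω` elsewhere.  As `E` has empty
interior this determines `Ω'`. -/
def IsBlowUpForm [T1Space M] [IsManifold (mdl n) ∞ M] (b : BallEmbedding n M) (β : ℝ → ℝ)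
    (Ω : SymplecticForm n M) (Ω' : SymplecticForm n (BlowUp b)) : Prop :=
  ∀ p : BlowUp b, p ∉ BlowUp.excDivisor b → ∀ v w : TangentSpace (mdl n) p,
    Ω'.form p v w = Ω.form (inflate b β (BlowUp.proj b p))
      (mfderiv (mdl n) (mdl n) (fun q => inflate b β (BlowUp.proj b q)) p v)
      (mfderiv (mdl n) (mdl n) (fun q => inflate b β (BlowUp.proj b q)) p w)

/-- `J'` is the almost complex structure of the blow-up: the one for which the blow-up map is
`(J', J)`-holomorphic. -/
def IsBlowUpComplex [T1Space M] [IsManifold (mdl n) ∞ M] (b : BallEmbedding n M)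
    (J : AlmostComplex n M) (J' : AlmostComplex n (BlowUp b)) : Prop :=
  ∀ (p : BlowUp b) (v : TangentSpace (mdl n) p),
    mfderiv (mdl n) (mdl n) (BlowUp.proj b) p (J'.J p v) =
      J.J (BlowUp.proj b p) (mfderiv (mdl n) (mdl n) (BlowUp.proj b) p v)

/-! ### Lagrangian submanifolds and holomorphic disks -/

variable (n) in
/-- The vectors tangent to a subset `S` of `M`: the velocities of smooth curves in `S`. -/
def tangentTo [IsManifold (mdl n) ∞ M] (S : Set M) : Set (TangentBundle (mdl n) M) :=
  {p | ∃ γ : ℝ → M, ContMDiff 𝓘(ℝ, ℝ) (mdl n) ∞ γ ∧ (∀ t, γ t ∈ S) ∧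
    p = ⟨γ 0, mfderiv 𝓘(ℝ, ℝ) (mdl n) γ 0 (1 : ℝ)⟩}

/-- `L` is a Lagrangian submanifold of `(M, Ω)`: an embedded `n`-dimensional submanifold (near each
of its points it is `ℝⁿ ⊆ ℂⁿ` in a suitable chart) on whose tangent spaces `Ω` vanishes. -/
structure IsLagrangian [IsManifold (mdl n) ∞ M] (Ω : SymplecticForm n M) (L : Set M) : Prop where
  slice (x : M) : x ∈ L → ∃ e ∈ IsManifold.maximalAtlas (mdl n) ∞ M, x ∈ e.source ∧
    ∀ y ∈ e.source, y ∈ L ↔ ∀ i, (e y i).im = 0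
  isotropic (x : M) (v w : TangentSpace (mdl n) x) :
    (⟨x, v⟩ : TangentBundle (mdl n) M) ∈ tangentTo n L →
    (⟨x, w⟩ : TangentBundle (mdl n) M) ∈ tangentTo n L → Ω.form x v w = 0

/-- The closed unit disk. -/
abbrev disk : Set ℂ := Metric.closedBall 0 1

/-- `u` restricted to the closed unit disk is a `J`-holomorphic disk with boundary on `L`: it is
smooth up to the boundary, `du ∘ i = J ∘ du`, and `u(∂D) ⊆ L`. -/
structure IsHolomorphicDisk [IsManifold (mdl n) ∞ M] (J : AlmostComplex n M) (L : Set M)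
    (u : ℂ → M) : Prop where
  smooth : ContMDiffOn 𝓘(ℝ, ℂ) (mdl n) ∞ u disk
  holomorphic (z : ℂ) : z ∈ disk → ∀ v : ℂ,
    mfderivWithin 𝓘(ℝ, ℂ) (mdl n) u disk z (Complex.I * v : ℂ) =
      J.J (u z) (mfderivWithin 𝓘(ℝ, ℂ) (mdl n) u disk z v)
  boundary (z : ℂ) : z ∈ Metric.sphere (0 : ℂ) 1 → u z ∈ L

/-! ### Winding numbers, Maslov index, intersection number -/

/-- The closed curve `c : [0, 2π] → ℂ ∖ {0}` has winding number `k` around `0`: its argument has a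
continuous determination `θ` with `θ(2π) - θ(0) = 2πk`. -/
def HasWindingNumber (c : ℝ → ℂ) (k : ℤ) : Prop :=
  ∃ θ : ℝ → ℝ, ContinuousOn θ (Icc 0 (2 * Real.pi)) ∧
    (∀ t ∈ Icc 0 (2 * Real.pi), c t ≠ 0 ∧ c t = ‖c t‖ * Complex.exp (θ t * Complex.I)) ∧
    θ (2 * Real.pi) = θ 0 + 2 * Real.pi * k

/-- `Φ` is a symplectic trivialization of `u^* TM` over the closed disk: a continuous family of
linear symplectic isomorphisms `(ℂⁿ, Ω₀) → (T_{u z} M, Ω)`. -/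
structure IsSymplecticTrivialization [IsManifold (mdl n) ∞ M] (Ω : SymplecticForm n M) (u : ℂ → M)
    (Φ : ∀ z : ℂ, Cn n →L[ℝ] TangentSpace (mdl n) (u z)) : Prop where
  continuous : ContinuousOn
    (fun q : ℂ × Cn n => (⟨u q.1, Φ q.1 q.2⟩ : TangentBundle (mdl n) M)) (disk ×ˢ univ)
  symplectic (z : ℂ) : z ∈ disk → ∀ v w : Cn n, Ω.form (u z) (Φ z v) (Φ z w) = stdForm v w

/-- The disk `u : (D, ∂D) → (M, L)` has Maslov index `m`: in a symplectic trivialization of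
`u^* TM` over `D`, the tangent spaces of `L` along `u(∂D)` form a loop of Lagrangian subspaces
`Λ_t = U_t ℝⁿ` of `ℂⁿ`, with `U_t` unitary, and the loop `t ↦ (det U_t)²` has winding number `m`. -/
def HasMaslovIndex [IsManifold (mdl n) ∞ M] (Ω : SymplecticForm n M) (L : Set M) (u : ℂ → M)
    (m : ℤ) : Prop :=
  ∃ Φ : ∀ z : ℂ, Cn n →L[ℝ] TangentSpace (mdl n) (u z), IsSymplecticTrivialization Ω u Φ ∧
    ∃ U : ℝ → Matrix (Fin n) (Fin n) ℂ,
      (∀ t, U t ∈ Matrix.unitaryGroup (Fin n) ℂ ∧ ∀ v : Cn n,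
        (⟨u (Complex.exp (t * Complex.I)), Φ (Complex.exp (t * Complex.I)) v⟩ :
            TangentBundle (mdl n) M) ∈ tangentTo n L ↔
          ∃ x : Fin n → ℝ, v.ofLp = (U t).mulVec (fun i => (x i : ℂ))) ∧
      HasWindingNumber (fun t => (U t).det ^ 2) m

/-- The Maslov index `μ_L[u]` of a disk `u : (D, ∂D) → (M, L)`. -/
def maslovIndex [IsManifold (mdl n) ∞ M] (Ω : SymplecticForm n M) (L : Set M) (u : ℂ → M) : ℤ :=
  Classical.epsilon (HasMaslovIndex Ω L u)

/-- The local intersection index at `z` of a map `u` from the disk with the exceptional divisor is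
`k`: composed with the local equation `y_j` of `E` in a standard chart, `u` has winding number `k`
around `0` along all small positively oriented circles around `z`. -/
def HasLocalIndex [T1Space M] [IsManifold (mdl n) ∞ M] (b : BallEmbedding n M) (u : ℂ → BlowUp b)
    (z : ℂ) (k : ℤ) : Prop :=
  ∃ j : Fin n, u z ∈ (BlowUp.excChart b j).source ∧ ∀ᶠ ε : ℝ in 𝓝[>] 0,
    HasWindingNumber
      (fun t => BlowUp.excChart b j (u (z + ε * Complex.exp (t * Complex.I))) j) k

/-- The intersection number `u · E` of a disk `u` with the exceptional divisor is `ℓ`: the disk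
meets `E` in finitely many points, all of them interior, and `ℓ` is the sum of the local
intersection indices. -/
def HasIntersectionNumber [T1Space M] [IsManifold (mdl n) ∞ M] (b : BallEmbedding n M)
    (u : ℂ → BlowUp b) (l : ℤ) : Prop :=
  ∃ (s : Finset ℂ) (k : ℂ → ℤ), (∀ z, z ∈ s ↔ z ∈ disk ∧ u z ∈ BlowUp.excDivisor b) ∧
    (∀ z ∈ s, z ∈ Metric.ball (0 : ℂ) 1 ∧ HasLocalIndex b u z (k z)) ∧ ∑ z ∈ s, k z = l

/-- The intersection number `u · E`. -/
def intersectionNumber [T1Space M] [IsManifold (mdl n) ∞ M] (b : BallEmbedding n M)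
    (u : ℂ → BlowUp b) : ℤ :=
  Classical.epsilon (HasIntersectionNumber b u)

end manifold
end LagBlowUp

end

noncomputable section

namespace LagBlowUp

/-! ### Winding numbers -/

/-! The two Maslov indices are compared through the differential of the blow-down map `π` along the
disk. Both `u^*TM̃` and `(π ∘ u)^*TM` have unitary trivializations over the disk
(`exists_unitaryTriv_disk`), the former because the structure `J'` is compatible with `Ω'`
(`BlowUp.compatible`). In these trivializations `dπ` is a continuous family of complex matrices `D
z`, since `π` is holomorphic.

On the boundary the Lagrangian stays where the form is just pulled back by `π`. Hence `D` is unitary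
there and carries the tangent spaces of the lifted Lagrangian to those of `L`. Taking `det²` of
frames gives the difference of the Maslov indices as twice the winding number of `det D`
(`BlowUp.maslovIndex_preimage`).

That winding number counts the zeros of `det D` in the disk (`hasWindingNumber_of_zeros`). Off `E`
the map `π` is a local diffeomorphism, so there are none. In a standard chart, `π` is `y ↦ y_j • (y
with y_j := 1)`, of complex Jacobian `y_j ^ (n - 1)` (`det_fderiv_blowDown`), and `y_j ∘ u` is
holomorphic with a zero of some order `m` at each point of `u⁻¹(E)`. This `m` is the local
intersection index, so it is nonnegative, and `det D` vanishes to order `m (n - 1)`. Summing gives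
`(n - 1) ℓ`. The trivializations are merely continuous, so `det D` is not holomorphic; the argument
principle is therefore proved for continuous functions asymptotic to `l (z - w) ^ k` at their zeros.

Finiteness of `u⁻¹(E)` is the identity theorem: a disk with a nonisolated intersection would lie in
`E` entirely, boundary included. The Maslov index is well defined because two symplectic
trivializations differ by a loop of symplectic maps that extends over the disk, which does not
affect the winding number of `det²` (`winding_det_sq_unique`). -/

/-- The exponential is a covering of the punctured plane, so maps from simply connected spaces lift.
It is used below with `A` equal to the line, the plane `ℝ × ℝ` and `ℂ`. -/
theorem exists_exp_eq {A : Type*} [TopologicalSpace A] [SimplyConnectedSpace A]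
    [LocallyPathConnectedSpace A] {f : A → ℂ} (hf : Continuous f) (h0 : ∀ a, f a ≠ 0) :
    ∃ g : A → ℂ, Continuous g ∧ ∀ a, Complex.exp (g a) = f a := by
  obtain ⟨a₀⟩ : Nonempty A := inferInstance
  let F : C(A, {z : ℂ // z ≠ 0}) := ⟨fun a => ⟨f a, h0 a⟩, hf.subtype_mk _⟩
  obtain ⟨g, ⟨-, hg⟩, -⟩ := Complex.isCoveringMap_exp.existsUnique_continuousMap_lifts F a₀
    (Complex.log (f a₀)) (Subtype.ext (Complex.exp_log (h0 a₀)))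
  exact ⟨g, g.continuous, fun a => congrArg Subtype.val (congrFun hg a)⟩

theorem two_pi_nonneg : (0 : ℝ) ≤ 2 * Real.pi := by positivity

theorem eq_norm_mul_exp_im {c w : ℂ} (h : Complex.exp w = c) :
    c ≠ 0 ∧ c = ‖c‖ * Complex.exp (w.im * Complex.I) := by
  subst h
  refine ⟨Complex.exp_ne_zero _, ?_⟩
  conv_lhs => rw [← Complex.re_add_im w, Complex.exp_add]
  rw [Complex.norm_exp, Complex.ofReal_exp]

theorem exists_int_of_exp_eq {a b : ℝ}
    (h : Complex.exp (a * Complex.I) = Complex.exp (b * Complex.I)) :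
    ∃ n : ℤ, a = b + n * (2 * Real.pi) := by
  obtain ⟨n, hn⟩ := Complex.exp_eq_exp_iff_exists_int.1 h
  refine ⟨n, ?_⟩
  have := congrArg Complex.im hn
  simpa using this

/-- A continuous real function on a preconnected set with values in `2πℤ` is constant. -/
theorem eq_of_forall_int {X : Type*} [TopologicalSpace X] {s : Set X} (hs : IsPreconnected s)
    {f : X → ℝ} (hf : ContinuousOn f s) (h : ∀ x ∈ s, ∃ n : ℤ, f x = n * (2 * Real.pi))
    {x y : X} (hx : x ∈ s) (hy : y ∈ s) : f x = f y := by
  have hpi := Real.pi_pos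
  have hd : IsPreconnected ((fun x => f x / (2 * Real.pi)) '' s) :=
    hs.image _ (hf.div_const _)
  have hsub : (fun x => f x / (2 * Real.pi)) '' s ⊆ range ((↑) : ℤ → ℝ) := by
    rintro _ ⟨x, hx, rfl⟩
    obtain ⟨n, hn⟩ := h x hx
    exact ⟨n, by simp only [hn]; field_simp⟩
  have hc : (range ((↑) : ℤ → ℝ)).Countable := countable_range _
  have := (hc.isTotallyDisconnected) _ hsub hd (mem_image_of_mem _ hx) (mem_image_of_mem _ hy)
  field_simp at this
  exact this

namespace HasWindingNumber
variable {c c' : ℝ → ℂ} {k k' : ℤ}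

/-- Two continuous arguments of the same curve differ by a continuous function with values in `2πℤ`,
hence by a constant. -/
theorem unique (h : HasWindingNumber c k) (h' : HasWindingNumber c k') : k = k' := by
  obtain ⟨θ, hθ, h1, h2⟩ := h
  obtain ⟨θ', hθ', h1', h2'⟩ := h'
  have hpi := Real.pi_pos
  have key : ∀ t ∈ Icc 0 (2 * Real.pi), ∃ n : ℤ, θ t - θ' t = n * (2 * Real.pi) := by
    intro t ht
    have hn : (‖c t‖ : ℂ) ≠ 0 := by simpa using (h1 t ht).1
    have := (h1 t ht).2.symm.trans (h1' t ht).2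
    obtain ⟨n, hn⟩ := exists_int_of_exp_eq (mul_left_cancel₀ hn this)
    exact ⟨n, by rw [hn]; ring⟩
  have := eq_of_forall_int isPreconnected_Icc (hθ.sub hθ') key (left_mem_Icc.2 two_pi_nonneg)
    (right_mem_Icc.2 two_pi_nonneg)
  simp only [Pi.sub_apply] at this
  rw [h2, h2'] at this
  have h3 : 2 * Real.pi * ((k : ℝ) - k') = 0 := by linarith
  have h4 : (k : ℝ) - k' = 0 := by
    rcases mul_eq_zero.1 h3 with h | h
    · linarith
    · exact h
  exact_mod_cast sub_eq_zero.1 h4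

theorem mul (h : HasWindingNumber c k) (h' : HasWindingNumber c' k') :
    HasWindingNumber (fun t => c t * c' t) (k + k') := by
  obtain ⟨θ, hθ, h1, h2⟩ := h
  obtain ⟨θ', hθ', h1', h2'⟩ := h'
  refine ⟨fun t => θ t + θ' t, hθ.add hθ', fun t ht => ⟨mul_ne_zero (h1 t ht).1 (h1' t ht).1, ?_⟩,
    ?_⟩
  · change c t * c' t = ‖c t * c' t‖ * _
    conv_lhs => rw [(h1 t ht).2, (h1' t ht).2]
    push_cast
    rw [norm_mul, add_mul, Complex.exp_add]
    push_cast
    ring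
  · simp only [h2, h2']; push_cast; ring

theorem one : HasWindingNumber (fun _ => 1) 0 :=
  ⟨fun _ => 0, continuousOn_const, fun t _ => by simp, by simp⟩

theorem pow (h : HasWindingNumber c k) (m : ℕ) :
    HasWindingNumber (fun t => c t ^ m) (m * k) := by
  induction m with
  | zero => simpa using one
  | succ m ih =>
    have := ih.mul h
    simp only [pow_succ]
    convert this using 1
    push_cast; ring

/-- The winding number depends only on the directions of the points of the curve. -/
theorem of_pos_mul {r : ℝ → ℝ} (hr : ∀ t ∈ Icc 0 (2 * Real.pi), 0 < r t)
    (h : HasWindingNumber c k) (he : ∀ t ∈ Icc 0 (2 * Real.pi), c' t = r t * c t) :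
    HasWindingNumber c' k := by
  obtain ⟨θ, hθ, h1, h2⟩ := h
  refine ⟨θ, hθ, fun t ht => ?_, h2⟩
  rw [he t ht]
  have h3 := hr t ht
  refine ⟨mul_ne_zero (by exact_mod_cast h3.ne') (h1 t ht).1, ?_⟩
  conv_lhs => rw [(h1 t ht).2]
  rw [norm_mul, Complex.norm_real, Real.norm_of_nonneg h3.le]
  push_cast; ring

theorem congr (h : HasWindingNumber c k) (he : ∀ t ∈ Icc 0 (2 * Real.pi), c' t = c t) :
    HasWindingNumber c' k :=
  h.of_pos_mul (r := fun _ => 1) (fun _ _ => one_pos) (fun t ht => by simp [he t ht])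

/-- A continuous closed curve off the origin has a winding number. -/
theorem _root_.LagBlowUp.exists_hasWindingNumber {c : ℝ → ℂ}
    (hc : ContinuousOn c (Icc 0 (2 * Real.pi))) (h0 : ∀ t ∈ Icc 0 (2 * Real.pi), c t ≠ 0)
    (hp : c (2 * Real.pi) = c 0) : ∃ k, HasWindingNumber c k := by
  -- The parameter is clamped to the interval so that the curve is continuous on the whole line,
  -- where the lifting theorem applies.
  let F : ℝ → ℂ := fun t => c (projIcc 0 (2 * Real.pi) two_pi_nonneg t)
  have hF : Continuous F :=
    (continuousOn_iff_continuous_domRestrict.1 hc).comp continuous_projIcc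
  obtain ⟨g, hg, hgF⟩ := exists_exp_eq hF (fun t => h0 _ (Subtype.coe_prop _))
  have hFc : ∀ t ∈ Icc 0 (2 * Real.pi), F t = c t := fun t ht => by
    simp only [F, projIcc_of_mem two_pi_nonneg ht]
  obtain ⟨n, hn⟩ := Complex.exp_eq_exp_iff_exists_int.1
    (show Complex.exp (g (2 * Real.pi)) = Complex.exp (g 0) by
      rw [hgF, hgF, hFc _ (right_mem_Icc.2 two_pi_nonneg), hFc _ (left_mem_Icc.2 two_pi_nonneg), hp])
  refine ⟨n, fun t => (g t).im, (Complex.continuous_im.comp hg).continuousOn, fun t ht => ?_, ?_⟩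
  · exact eq_norm_mul_exp_im ((hgF t).trans (hFc t ht))
  · have := congrArg Complex.im hn
    simp only [this]
    simp
    ring

/-- Homotopic closed curves off the origin have the same winding number. -/
theorem homotopy {H : ℝ → ℝ → ℂ}
    (hH : ContinuousOn (fun p : ℝ × ℝ => H p.1 p.2) (Icc 0 1 ×ˢ Icc 0 (2 * Real.pi)))
    (h0 : ∀ s ∈ Icc (0 : ℝ) 1, ∀ t ∈ Icc 0 (2 * Real.pi), H s t ≠ 0)
    (hp : ∀ s ∈ Icc (0 : ℝ) 1, H s (2 * Real.pi) = H s 0) (h : HasWindingNumber (H 0) k) :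
    HasWindingNumber (H 1) k := by
  let P : ℝ × ℝ → ℝ × ℝ := fun p =>
    (projIcc 0 1 zero_le_one p.1, projIcc 0 (2 * Real.pi) two_pi_nonneg p.2)
  have hP : Continuous P := by
    refine Continuous.prodMk ?_ ?_
    · exact continuous_subtype_val.comp (continuous_projIcc.comp continuous_fst)
    · exact continuous_subtype_val.comp (continuous_projIcc.comp continuous_snd)
  have hPm : ∀ p, P p ∈ Icc (0 : ℝ) 1 ×ˢ Icc 0 (2 * Real.pi) := fun p =>
    ⟨Subtype.coe_prop _, Subtype.coe_prop _⟩
  have hPe : ∀ s ∈ Icc (0 : ℝ) 1, ∀ t ∈ Icc 0 (2 * Real.pi), P (s, t) = (s, t) := by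
    intro s hs t ht
    simp only [P, projIcc_of_mem zero_le_one hs, projIcc_of_mem two_pi_nonneg ht]
  obtain ⟨g, hg, hgF⟩ := exists_exp_eq (f := fun p => H (P p).1 (P p).2)
    (hH.comp_continuous hP hPm) (fun p => h0 _ (hPm p).1 _ (hPm p).2)
  have hgH : ∀ s ∈ Icc (0 : ℝ) 1, ∀ t ∈ Icc 0 (2 * Real.pi), Complex.exp (g (s, t)) = H s t := by
    intro s hs t ht
    rw [hgF, hPe s hs t ht]
  have hl := left_mem_Icc.2 two_pi_nonneg
  have hr := right_mem_Icc.2 two_pi_nonneg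
  -- The lift over the rectangle gives all the arguments at once; the increment of the argument over
  -- the `s`-th curve is continuous in `s` and lies in `2πℤ`.
  have key : ∀ s ∈ Icc (0 : ℝ) 1, ∃ n : ℤ,
      (g (s, 2 * Real.pi)).im - (g (s, 0)).im = n * (2 * Real.pi) := by
    intro s hs
    obtain ⟨n, hn⟩ := Complex.exp_eq_exp_iff_exists_int.1
      (show Complex.exp (g (s, 2 * Real.pi)) = Complex.exp (g (s, 0)) by
        rw [hgH s hs _ hr, hgH s hs _ hl, hp s hs])
    refine ⟨n, ?_⟩
    rw [hn]; simp
  have hcont : ContinuousOn (fun s => (g (s, 2 * Real.pi)).im - (g (s, 0)).im) (Icc 0 1) := by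
    apply Continuous.continuousOn
    exact (Complex.continuous_im.comp (hg.comp (by fun_prop))).sub
      (Complex.continuous_im.comp (hg.comp (by fun_prop)))
  have h01 := eq_of_forall_int isPreconnected_Icc hcont key
    (left_mem_Icc.2 zero_le_one) (right_mem_Icc.2 zero_le_one)
  have hw : ∀ s ∈ Icc (0 : ℝ) 1, ∀ m : ℤ,
      (g (s, 2 * Real.pi)).im - (g (s, 0)).im = m * (2 * Real.pi) →
      HasWindingNumber (H s) m := by
    intro s hs m hm
    refine ⟨fun t => (g (s, t)).im, ?_, fun t ht => eq_norm_mul_exp_im (hgH s hs t ht), ?_⟩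
    · exact (Complex.continuous_im.comp (hg.comp (by fun_prop))).continuousOn
    · linarith
  obtain ⟨n, hn⟩ := key 0 (left_mem_Icc.2 zero_le_one)
  have := (hw 0 (left_mem_Icc.2 zero_le_one) n hn).unique h
  subst this
  exact hw 1 (right_mem_Icc.2 zero_le_one) n (by rw [← hn, ← h01])

end HasWindingNumber

/-- The radial retraction of the plane onto the closed unit disk. -/
def toDisk (z : ℂ) : ℂ := ((max 1 ‖z‖)⁻¹ : ℝ) • z

theorem continuous_toDisk : Continuous toDisk := by
  refine Continuous.smul (Continuous.inv₀ (f := fun z : ℂ => max 1 ‖z‖) (by fun_prop) ?_)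
    continuous_id
  intro z
  have := le_max_left 1 ‖z‖
  linarith

theorem toDisk_mem (z : ℂ) : toDisk z ∈ disk := by
  have h1 := le_max_left 1 ‖z‖
  have h2 := le_max_right 1 ‖z‖
  rw [mem_closedBall_zero_iff, toDisk, norm_smul, norm_inv, Real.norm_of_nonneg (by linarith)]
  rw [inv_mul_le_iff₀ (by linarith)]
  linarith

theorem toDisk_of_mem {z : ℂ} (hz : z ∈ disk) : toDisk z = z := by
  rw [mem_closedBall_zero_iff] at hz
  simp [toDisk, max_eq_left hz]

theorem exp_mul_I_mem_disk (t : ℝ) : Complex.exp (t * Complex.I) ∈ disk := by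
  rw [mem_closedBall_zero_iff, Complex.norm_exp_ofReal_mul_I]

theorem exp_mul_I_mem_sphere (t : ℝ) : Complex.exp (t * Complex.I) ∈ Metric.sphere (0 : ℂ) 1 := by
  rw [mem_sphere_zero_iff_norm, Complex.norm_exp_ofReal_mul_I]

theorem continuous_exp_mul_I : Continuous fun t : ℝ => Complex.exp (t * Complex.I) := by fun_prop

theorem exp_two_pi_mul_I : Complex.exp ((2 * Real.pi : ℝ) * Complex.I) =
    Complex.exp ((0 : ℝ) * Complex.I) := by
  simp [Complex.exp_two_pi_mul_I]

/-- A curve which extends to a continuous map of the disk off the origin has winding number `0`. -/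
theorem hasWindingNumber_of_disk {d : ℂ → ℂ} (hd : ContinuousOn d disk) (h0 : ∀ z ∈ disk, d z ≠ 0) :
    HasWindingNumber (fun t => d (Complex.exp (t * Complex.I))) 0 := by
  obtain ⟨g, hg, hgd⟩ := exists_exp_eq (hd.comp_continuous continuous_toDisk toDisk_mem)
    (fun z => h0 _ (toDisk_mem z))
  refine ⟨fun t => (g (Complex.exp (t * Complex.I))).im,
    (Complex.continuous_im.comp (hg.comp continuous_exp_mul_I)).continuousOn, fun t _ => ?_, ?_⟩
  · refine eq_norm_mul_exp_im ((hgd _).trans ?_)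
    rw [Function.comp, toDisk_of_mem (exp_mul_I_mem_disk t)]
  · simp only [exp_two_pi_mul_I]
    simp

/-- In the right half plane the principal argument is continuous. -/
theorem hasWindingNumber_of_re_pos {c : ℝ → ℂ} (hc : Continuous c) (h0 : ∀ t, 0 < (c t).re)
    (hp : c (2 * Real.pi) = c 0) : HasWindingNumber c 0 := by
  refine ⟨fun t => (c t).arg, ?_, fun t _ => ⟨?_, (Complex.norm_mul_exp_arg_mul_I _).symm⟩, ?_⟩
  · exact (continuous_iff_continuousAt.2 fun t =>
      (Complex.continuousAt_arg (.inl (h0 t))).comp hc.continuousAt).continuousOn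
  · intro h
    have := h0 t
    simp [h] at this
  · simp only [hp]; simp

theorem hasWindingNumber_circle (r : ℝ) (hr : 0 < r) :
    HasWindingNumber (fun t => r * Complex.exp (t * Complex.I)) 1 := by
  refine ⟨fun t => t, continuousOn_id, fun t _ => ⟨?_, ?_⟩, by simp⟩
  · exact mul_ne_zero (by exact_mod_cast hr.ne') (Complex.exp_ne_zero _)
  · rw [norm_mul, Complex.norm_exp_ofReal_mul_I, Complex.norm_real, Real.norm_of_nonneg hr.le]
    simp

/-- Factor `e^{it} - w = e^{it} (1 - w e^{-it})`; as `|w| < 1`, the second factor stays in the right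
half plane. -/
theorem hasWindingNumber_circle_sub {w : ℂ} (hw : w ∈ Metric.ball (0 : ℂ) 1) :
    HasWindingNumber (fun t => Complex.exp (t * Complex.I) - w) 1 := by
  have h1 := hasWindingNumber_circle 1 one_pos
  have h2 : HasWindingNumber (fun t : ℝ => 1 - w * Complex.exp (-(t * Complex.I))) 0 := by
    refine hasWindingNumber_of_re_pos (by fun_prop) (fun t => ?_) ?_
    · rw [mem_ball_zero_iff] at hw
      have h3 : ‖w * Complex.exp (-(t * Complex.I))‖ < 1 := by
        rw [norm_mul, ← neg_mul, ← Complex.ofReal_neg, Complex.norm_exp_ofReal_mul_I, mul_one]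
        exact hw
      have h4 := (Complex.abs_re_le_norm (w * Complex.exp (-(t * Complex.I)))).trans_lt h3
      rw [abs_lt] at h4
      rw [Complex.sub_re, Complex.one_re]
      linarith
    · simp [Complex.exp_neg, Complex.exp_two_pi_mul_I]
  refine (h1.mul h2).congr fun t _ => ?_
  have : Complex.exp (t * Complex.I) * Complex.exp (-(t * Complex.I)) = 1 := by
    rw [← Complex.exp_add]; simp
  push_cast
  linear_combination w * this

/-- The argument principle for continuous functions on the disk which are asymptotic to
`L (z - w) ^ k` at their zeros `w`. -/
theorem hasWindingNumber_of_zeros (s : Finset ℂ) (k : ℂ → ℕ) :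
    ∀ {d : ℂ → ℂ}, ContinuousOn d disk → (∀ w ∈ s, w ∈ Metric.ball (0 : ℂ) 1) →
      (∀ z ∈ disk, z ∉ s → d z ≠ 0) →
      (∀ w ∈ s, ∃ l : ℂ, l ≠ 0 ∧ Tendsto (fun z => d z / (z - w) ^ k w) (𝓝[≠] w) (𝓝 l)) →
      HasWindingNumber (fun t => d (Complex.exp (t * Complex.I))) (∑ w ∈ s, (k w : ℤ)) := by
  classical
  induction s using Finset.induction_on with
  | empty =>
    intro d hd _ h0 _
    simpa using hasWindingNumber_of_disk hd (fun z hz => h0 z hz (by simp))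
  | insert w s hws ih =>
    intro d hd hs h0 hlim
    obtain ⟨l, hl, hlw⟩ := hlim w (by simp)
    have hwb := hs w (by simp)
    -- The zero at `w` is divided out. Putting the limit `l` at `w` keeps the quotient continuous
    -- and makes it nonzero there, so it has only the remaining zeros.
    let d' : ℂ → ℂ := Function.update (fun z => d z / (z - w) ^ k w) w l
    have hd' : ∀ z, z ≠ w → d' z = d z / (z - w) ^ k w := fun z hz => by simp [d', hz]
    have hc : ContinuousOn d' disk := by
      rw [continuousOn_update_iff]
      refine ⟨?_, fun _ => hlw.mono_left (nhdsWithin_mono _ (by intro z hz; exact hz.2))⟩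
      refine (hd.mono sdiff_subset).div (by fun_prop) ?_
      rintro z ⟨_, hz⟩
      exact pow_ne_zero _ (sub_ne_zero.2 hz)
    have h1 := ih hc (fun v hv => hs v (by simp [hv])) ?_ ?_
    · have h2 := h1.mul ((hasWindingNumber_circle_sub hwb).pow (k w))
      rw [Finset.sum_insert hws]
      convert h2.congr (c' := fun t => d (Complex.exp (t * Complex.I))) ?_ using 1
      · ring
      · intro t _
        have hne : Complex.exp (t * Complex.I) ≠ w := by
          rintro rfl
          have := exp_mul_I_mem_sphere t
          rw [mem_ball_zero_iff] at hwb
          rw [mem_sphere_zero_iff_norm] at this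
          linarith
        simp only [hd' _ hne]
        rw [div_mul_cancel₀ _ (pow_ne_zero _ (sub_ne_zero.2 hne))]
    · intro z hz hzs
      by_cases hzw : z = w
      · subst hzw; simpa [d'] using hl
      · rw [hd' z hzw]
        exact div_ne_zero (h0 z hz (by simp [hzw, hzs])) (pow_ne_zero _ (sub_ne_zero.2 hzw))
    · intro v hv
      obtain ⟨l', hl', hlv⟩ := hlim v (by simp [hv])
      have hvw : v ≠ w := by rintro rfl; exact hws hv
      have hpw := pow_ne_zero (k w) (sub_ne_zero.2 hvw)
      refine ⟨l' / (v - w) ^ k w, div_ne_zero hl' hpw, ?_⟩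
      have h3 : Tendsto (fun z : ℂ => (z - w) ^ k w) (𝓝[≠] v) (𝓝 ((v - w) ^ k w)) :=
        (Continuous.tendsto (by fun_prop) v).mono_left nhdsWithin_le_nhds
      refine (hlv.div h3 hpw).congr' ?_
      have : ∀ᶠ z in 𝓝[≠] v, z ≠ w := nhdsWithin_le_nhds (isOpen_ne.mem_nhds hvw)
      filter_upwards [this] with z hz
      rw [hd' z hz]
      simp only [Pi.div_apply]
      rw [div_right_comm]

end LagBlowUp

namespace LagBlowUp

/-! ### Lagrangian frames and linear symplectic maps of `ℂⁿ` -/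

section linear
variable {n : ℕ}
open Matrix

/-- A real vector as a complex vector. -/
abbrev toC (x : Fin n → ℝ) : Fin n → ℂ := fun i => (x i : ℂ)

/-- The complex conjugate of a matrix. -/
abbrev cj (A : Matrix (Fin n) (Fin n) ℂ) : Matrix (Fin n) (Fin n) ℂ := A.map (starRingEnd ℂ)

/-- A real matrix as a complex matrix. -/
abbrev matC (A : Matrix (Fin n) (Fin n) ℝ) : Matrix (Fin n) (Fin n) ℂ := A.map Complex.ofReal

theorem stdForm_eq_im (v w : Cn n) : stdForm v w = (star v.ofLp ⬝ᵥ w.ofLp).im := by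
  simp [stdForm, dotProduct, sub_eq_add_neg]

theorem re_star_dotProduct_self (v : Fin n → ℂ) : (star v ⬝ᵥ v).re = ∑ i, ‖v i‖ ^ 2 := by
  simp only [dotProduct, Complex.re_sum]
  refine Finset.sum_congr rfl fun i _ => ?_
  rw [Complex.sq_norm, Complex.normSq_apply]
  simp

theorem eq_zero_of_re_star_dotProduct_self {v : Fin n → ℂ} (h : (star v ⬝ᵥ v).re ≤ 0) : v = 0 := by
  rw [re_star_dotProduct_self] at h
  have h0 := (Finset.sum_eq_zero_iff_of_nonneg (fun i _ => by positivity)).1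
    (le_antisymm h (Finset.sum_nonneg fun i _ => by positivity))
  ext i
  simpa using h0 i (Finset.mem_univ i)

theorem re_star_dotProduct_self_nonneg (v : Fin n → ℂ) : 0 ≤ (star v ⬝ᵥ v).re := by
  rw [re_star_dotProduct_self]; positivity

theorem star_mulVec_dotProduct (A : Matrix (Fin n) (Fin n) ℂ) (v w : Fin n → ℂ) :
    star (A *ᵥ v) ⬝ᵥ (A *ᵥ w) = star v ⬝ᵥ ((Aᴴ * A) *ᵥ w) := by
  rw [star_mulVec, ← mulVec_mulVec, dotProduct_mulVec, dotProduct_mulVec, dotProduct_mulVec]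

theorem conjTranspose_cj (Q : Matrix (Fin n) (Fin n) ℂ) : (cj Q)ᴴ = Qᵀ := by
  ext i j; simp

theorem conjTranspose_transpose_eq (Q : Matrix (Fin n) (Fin n) ℂ) : (Qᵀ)ᴴ = cj Q := by
  ext i j; simp

theorem cj_mul (A B : Matrix (Fin n) (Fin n) ℂ) : cj (A * B) = cj A * cj B := Matrix.map_mul

theorem cj_matC (R : Matrix (Fin n) (Fin n) ℝ) : cj (matC R) = matC R := by
  ext i j; simp

theorem det_matC (R : Matrix (Fin n) (Fin n) ℝ) : (matC R).det = (R.det : ℂ) :=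
  (RingHom.map_det Complex.ofRealHom R).symm

/-- If `v ↦ P v + Q v̄` is symplectic then `Pᴴ + τ Qᵀ K` is invertible for `K` unitary, `|τ| ≤ 1`. -/
theorem det_add_smul_ne_zero {P Q K : Matrix (Fin n) (Fin n) ℂ} (h : Pᴴ * P - Qᵀ * cj Q = 1)
    (hK : K ∈ unitaryGroup (Fin n) ℂ) {τ : ℝ} (hτ : |τ| ≤ 1) :
    (Pᴴ + (τ : ℂ) • (Qᵀ * K)).det ≠ 0 := by
  intro h0
  -- The adjoint has `P` on the left of vectors, which is where the relation `Pᴴ P = 1 + Qᵀ Q̄`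
  -- applies. A kernel vector `v` would satisfy both `|P v|² = |v|² + |Q̄ v|²` and `|P v|² = τ² |Q̄
  -- v|²`, which forces `v = 0`.
  have h1 : (P + (τ : ℂ) • (Kᴴ * cj Q)).det = 0 := by
    have : P + (τ : ℂ) • (Kᴴ * cj Q) = (Pᴴ + (τ : ℂ) • (Qᵀ * K))ᴴ := by
      rw [conjTranspose_add, conjTranspose_conjTranspose, conjTranspose_smul, conjTranspose_mul,
        conjTranspose_transpose_eq]
      simp
    rw [this, det_conjTranspose, h0, star_zero]
  obtain ⟨v, hv, hv0⟩ := exists_mulVec_eq_zero_iff.2 h1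
  apply hv
  apply eq_zero_of_re_star_dotProduct_self
  have h2 : P *ᵥ v = -((τ : ℂ) • (Kᴴ *ᵥ (cj Q *ᵥ v))) := by
    rw [add_mulVec, smul_mulVec, ← mulVec_mulVec] at hv0
    exact eq_neg_of_add_eq_zero_left hv0
  have h3 : star (P *ᵥ v) ⬝ᵥ (P *ᵥ v) =
      star v ⬝ᵥ v + star (cj Q *ᵥ v) ⬝ᵥ (cj Q *ᵥ v) := by
    rw [star_mulVec_dotProduct, star_mulVec_dotProduct, conjTranspose_cj, eq_add_of_sub_eq h,
      add_mulVec, one_mulVec, dotProduct_add]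
  have h4 : star (P *ᵥ v) ⬝ᵥ (P *ᵥ v) =
      ((τ ^ 2 : ℝ) : ℂ) * (star (cj Q *ᵥ v) ⬝ᵥ (cj Q *ᵥ v)) := by
    have hKK : Kᴴᴴ * Kᴴ = 1 := by
      rw [conjTranspose_conjTranspose]; exact mem_unitaryGroup_iff.1 hK
    rw [h2, star_neg, neg_dotProduct_neg, star_smul, smul_dotProduct, dotProduct_smul,
      star_mulVec_dotProduct, hKK, one_mulVec]
    simp only [smul_eq_mul, RCLike.star_def, Complex.conj_ofReal]
    push_cast; ring
  have h5 := congrArg Complex.re (h3.symm.trans h4)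
  rw [Complex.add_re, Complex.re_ofReal_mul] at h5
  have h6 := re_star_dotProduct_self_nonneg (cj Q *ᵥ v)
  have h7 : τ ^ 2 ≤ 1 := by rw [← sq_abs]; exact pow_le_one₀ (abs_nonneg _) hτ
  nlinarith

open scoped MatrixOrder in
/-- A real frame of a Lagrangian subspace becomes unitary after a real change of basis. -/
theorem exists_real_mul_mem_unitaryGroup {X : Matrix (Fin n) (Fin n) ℂ}
    (h1 : ∀ j k, ((Xᴴ * X) j k).im = 0) (h2 : ∀ x : Fin n → ℝ, X *ᵥ toC x = 0 → x = 0) :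
    ∃ R : Matrix (Fin n) (Fin n) ℝ, R.det ≠ 0 ∧ X * matC R ∈ unitaryGroup (Fin n) ℂ := by
  let G : Matrix (Fin n) (Fin n) ℝ := (Xᴴ * X).map Complex.re
  have hG : Xᴴ * X = matC G := by
    ext j k
    apply Complex.ext
    · simp [G]
    · rw [h1]; simp
  have hGH : G.IsHermitian := by
    ext j k
    have : (Xᴴ * X)ᴴ = Xᴴ * X := by simp
    have := congrFun (congrFun this j) k
    rw [conjTranspose_apply] at this
    simp only [conjTranspose_apply, G, map_apply, ← this]
    simp
  have hGx : ∀ x : Fin n → ℝ, ((star x ⬝ᵥ (G *ᵥ x) : ℝ) : ℂ) =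
      star (X *ᵥ toC x) ⬝ᵥ (X *ᵥ toC x) := by
    intro x
    rw [star_mulVec_dotProduct, hG]
    simp [dotProduct, mulVec]
  have hGP : G.PosDef := by
    refine PosDef.of_dotProduct_mulVec_pos hGH fun x hx => ?_
    have := congrArg Complex.re (hGx x)
    rw [Complex.ofReal_re] at this
    rw [this]
    by_contra hle
    exact hx (h2 x (eq_zero_of_re_star_dotProduct_self (not_lt.1 hle)))
  -- The Gram matrix of the frame is real, by isotropy, and positive definite. Writing it as `Bᴴ B`
  -- with `B` real, the change of basis `B⁻¹` makes the frame orthonormal for the Hermitian product.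
  obtain ⟨B, hB, hGB⟩ : ∃ B : Matrix (Fin n) (Fin n) ℝ, IsUnit B ∧ G = Bᴴ * B := by
    obtain ⟨B, hGB⟩ := CStarAlgebra.nonneg_iff_eq_star_mul_self.mp hGP.posSemidef.nonneg
    refine ⟨B, ?_, hGB⟩
    rw [isUnit_iff_isUnit_det]
    have := hGP.det_pos.ne'
    rw [hGB, det_mul] at this
    exact (right_ne_zero_of_mul this).isUnit
  have hBd : IsUnit B.det := (isUnit_iff_isUnit_det _).1 hB
  refine ⟨B⁻¹, ?_, ?_⟩
  · exact (isUnit_nonsing_inv_det _ hBd).ne_zero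
  · rw [mem_unitaryGroup_iff', star_eq_conjTranspose, conjTranspose_mul]
    have e1 : (matC B⁻¹)ᴴ = matC (B⁻¹)ᴴ := by ext; simp
    have e2 : ∀ A C : Matrix (Fin n) (Fin n) ℝ, matC A * matC C = matC (A * C) := fun A C =>
      (Matrix.map_mul (f := Complex.ofRealHom)).symm
    rw [e1, Matrix.mul_assoc, ← Matrix.mul_assoc Xᴴ, hG, e2, e2, hGB]
    have : (B⁻¹)ᴴ * (Bᴴ * B * B⁻¹) = 1 := by
      rw [mul_nonsing_inv_cancel_right _ _ hBd, ← conjTranspose_mul, mul_nonsing_inv _ hBd,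
        conjTranspose_one]
    rw [this]
    ext i j
    by_cases hij : i = j <;> simp [Matrix.one_apply, hij]

theorem det_ne_zero_of_mem_unitaryGroup {U : Matrix (Fin n) (Fin n) ℂ}
    (hU : U ∈ unitaryGroup (Fin n) ℂ) : U.det ≠ 0 := by
  intro h
  have := congrArg det (mem_unitaryGroup_iff.1 hU)
  rw [det_mul, h] at this
  simp at this

/-- The symmetric unitary matrix `U Uᵀ` of the Lagrangian subspace `U ℝⁿ`, from a real frame. -/
theorem mul_transpose_eq_of_frame {U X : Matrix (Fin n) (Fin n) ℂ}
    (hU : U ∈ unitaryGroup (Fin n) ℂ) (hX : X.det ≠ 0)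
    (h : ∀ j, ∃ y : Fin n → ℝ, Xᵀ j = U *ᵥ toC y) : U * Uᵀ = X * (cj X)⁻¹ := by
  choose y hy using h
  -- The two frames differ by a real matrix, which is its own conjugate and so cancels in `X X̄⁻¹`.
  have hXU : X = U * matC (of y)ᵀ := by
    ext i j
    have := congrFun (hy j) i
    rw [transpose_apply] at this
    rw [this]
    simp [mulVec, mul_apply, dotProduct]
  have hR : IsUnit (matC (of y)ᵀ).det := by
    rw [hXU, det_mul] at hX
    exact (right_ne_zero_of_mul hX).isUnit
  have hUU : Uᵀ * cj U = 1 := by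
    have := congrArg transpose (mem_unitaryGroup_iff'.1 hU)
    rw [star_eq_conjTranspose, transpose_mul, transpose_one] at this
    rw [← this]; congr 1
  have hUc : (cj U)⁻¹ = Uᵀ := inv_eq_left_inv hUU
  conv_rhs => rw [hXU]
  rw [cj_mul, cj_matC, Matrix.mul_inv_rev, hUc, Matrix.mul_assoc, ← Matrix.mul_assoc _ _ Uᵀ,
    mul_nonsing_inv _ hR, Matrix.one_mul]

theorem det_mul_transpose (U : Matrix (Fin n) (Fin n) ℂ) : (U * Uᵀ).det = U.det ^ 2 := by
  rw [det_mul, det_transpose, sq]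

/-- On the Lagrangian subspace `U ℝⁿ`, complex conjugation of vectors thus agrees with the
complex-linear map of matrix `cj (U * Uᵀ)`. -/
theorem cj_mul_transpose_mul {U : Matrix (Fin n) (Fin n) ℂ} (hU : U ∈ unitaryGroup (Fin n) ℂ) :
    cj (U * Uᵀ) * U = cj U := by
  have : cj Uᵀ * U = 1 := by
    have := mem_unitaryGroup_iff'.1 hU
    rw [star_eq_conjTranspose] at this
    rw [← this]; congr 1
  rw [cj_mul, Matrix.mul_assoc, this, Matrix.mul_one]

theorem cj_mem_unitaryGroup {U : Matrix (Fin n) (Fin n) ℂ} (hU : U ∈ unitaryGroup (Fin n) ℂ) :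
    cj U ∈ unitaryGroup (Fin n) ℂ := by
  rw [mem_unitaryGroup_iff', star_eq_conjTranspose, conjTranspose_cj]
  have := congrArg transpose (mem_unitaryGroup_iff'.1 hU)
  rw [star_eq_conjTranspose, transpose_mul, transpose_one] at this
  rw [← this]; congr 1

theorem transpose_mem_unitaryGroup {U : Matrix (Fin n) (Fin n) ℂ}
    (hU : U ∈ unitaryGroup (Fin n) ℂ) : Uᵀ ∈ unitaryGroup (Fin n) ℂ := by
  have h := cj_mem_unitaryGroup hU
  have : Uᵀ = star (cj U) := by rw [star_eq_conjTranspose, conjTranspose_cj]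
  rw [this]
  exact Unitary.star_mem h

/-! Real-linear maps of `ℂⁿ` as `v ↦ P v + Q v̄`. -/

/-- The complex-linear part of a real-linear map. -/
def linPart (B : Cn n →L[ℝ] Cn n) : Matrix (Fin n) (Fin n) ℂ :=
  of fun i k => (B (EuclideanSpace.single k 1) i - Complex.I * B (EuclideanSpace.single k Complex.I) i) / 2

/-- The antilinear part of a real-linear map. -/
def antiPart (B : Cn n →L[ℝ] Cn n) : Matrix (Fin n) (Fin n) ℂ :=
  of fun i k => (B (EuclideanSpace.single k 1) i + Complex.I * B (EuclideanSpace.single k Complex.I) i) / 2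

theorem eq_sum_single (v : Cn n) :
    v = ∑ k, ((v k).re • EuclideanSpace.single k (1 : ℂ) +
      (v k).im • EuclideanSpace.single k Complex.I) := by
  ext i
  simp only [WithLp.ofLp_sum, WithLp.ofLp_add, WithLp.ofLp_smul, Finset.sum_apply, Pi.add_apply,
    Pi.smul_apply, PiLp.single_apply]
  simp [Finset.sum_add_distrib, Complex.re_add_im]

theorem apply_eq_linPart_add_antiPart (B : Cn n →L[ℝ] Cn n) (v : Cn n) :
    (B v).ofLp = linPart B *ᵥ v.ofLp + antiPart B *ᵥ (star v.ofLp) := by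
  conv_lhs => rw [eq_sum_single v]
  ext i
  simp only [map_sum, map_add, map_smul, WithLp.ofLp_sum, WithLp.ofLp_add, WithLp.ofLp_smul,
    Finset.sum_apply, Pi.add_apply, Pi.smul_apply, mulVec, dotProduct, linPart, antiPart, of_apply]
  rw [← Finset.sum_add_distrib]
  refine Finset.sum_congr rfl fun k _ => ?_
  obtain ⟨a, ha⟩ : ∃ a, a = v.ofLp k := ⟨_, rfl⟩
  have h1 : a = a.re + a.im * Complex.I := (Complex.re_add_im _).symm
  have h2 : star v.ofLp k = (v k).re - (v k).im * Complex.I := by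
    apply Complex.ext <;> simp
  rw [h2, ← ha]
  simp only [Complex.real_smul]
  linear_combination ((B (EuclideanSpace.single k 1) i -
      Complex.I * B (EuclideanSpace.single k Complex.I) i) / 2) * (-h1) +
    (a.im * B (EuclideanSpace.single k Complex.I) i) * Complex.I_mul_I

/-- The linear map `B` of `ℂⁿ` is symplectic. -/
def IsSymplecticMap (B : Cn n →L[ℝ] Cn n) : Prop := ∀ v w, stdForm (B v) (B w) = stdForm v w

theorem stdForm_single_single (j k : Fin n) (a b : ℂ) :
    stdForm (EuclideanSpace.single j a) (EuclideanSpace.single k b) =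
      if j = k then a.re * b.im - a.im * b.re else 0 := by
  rw [stdForm, Finset.sum_eq_single j]
  · by_cases h : j = k
    · subst h; simp
    · simp [h]
  · intro i _ hi
    simp [hi]
  · simp

/-- Together the relations say that `w ↦ Pᴴ w - Qᵀ w̄` is a left inverse of `v ↦ P v + Q v̄`. The
standard form is the imaginary part of the Hermitian product, so preserving it on the real basis
vectors `e_k`, `i e_k` gives four matrix identities, of which these are linear combinations. -/
theorem IsSymplecticMap.relations {B : Cn n →L[ℝ] Cn n} (hB : IsSymplecticMap B) :
    (linPart B)ᴴ * linPart B - (antiPart B)ᵀ * cj (antiPart B) = 1 ∧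
      (linPart B)ᴴ * antiPart B - (antiPart B)ᵀ * cj (linPart B) = 0 := by
  let b (w : ℂ) : Matrix (Fin n) (Fin n) ℂ := of fun i k => B (EuclideanSpace.single k w) i
  have key : ∀ w w' : ℂ, (b w)ᴴ * b w' - (b w)ᵀ * cj (b w') =
      (2 * Complex.I * (w.re * w'.im - w.im * w'.re : ℝ)) • 1 := by
    intro w w'
    ext j k
    have h1 := hB (EuclideanSpace.single j w) (EuclideanSpace.single k w')
    rw [stdForm_single_single, stdForm_eq_im] at h1
    have h2 : ((b w)ᵀ * cj (b w')) j k = star (((b w)ᴴ * b w') j k) := by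
      simp [mul_apply, b]
    have h3 : ((b w)ᴴ * b w') j k = star (B (EuclideanSpace.single j w)).ofLp ⬝ᵥ
        (B (EuclideanSpace.single k w')).ofLp := rfl
    rw [Matrix.sub_apply, h2, h3, Matrix.smul_apply, Matrix.one_apply]
    apply Complex.ext
    · by_cases hjk : j = k <;> simp [hjk]
    · rw [Complex.sub_im, RCLike.star_def, Complex.conj_im, h1]
      by_cases hjk : j = k
      · simp [hjk]; ring
      · simp [hjk]
  have h11 := key 1 1
  have h12 := key 1 Complex.I
  have h21 := key Complex.I 1
  have h22 := key Complex.I Complex.I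
  simp only [Complex.one_re, Complex.one_im, Complex.I_re, Complex.I_im, mul_one, mul_zero,
    sub_zero, zero_sub, sub_self, Complex.ofReal_zero, zero_smul, Complex.ofReal_one,
    Complex.ofReal_neg] at h11 h12 h21 h22
  have hP : linPart B = (1 / 2 : ℂ) • b 1 - (Complex.I / 2) • b Complex.I := by
    ext i k; simp [linPart, b]; ring
  have hQ : antiPart B = (1 / 2 : ℂ) • b 1 + (Complex.I / 2) • b Complex.I := by
    ext i k; simp [antiPart, b]; ring
  have hPH : (linPart B)ᴴ = (1 / 2 : ℂ) • (b 1)ᴴ + (Complex.I / 2) • (b Complex.I)ᴴ := by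
    rw [hP]; ext i k; simp [map_ofNat (starRingEnd ℂ)]; ring
  have hQT : (antiPart B)ᵀ = (1 / 2 : ℂ) • (b 1)ᵀ + (Complex.I / 2) • (b Complex.I)ᵀ := by
    rw [hQ]; ext i k; simp
  have hPc : cj (linPart B) = (1 / 2 : ℂ) • cj (b 1) + (Complex.I / 2) • cj (b Complex.I) := by
    rw [hP]; ext i k; simp [map_ofNat (starRingEnd ℂ)]; ring
  have hQc : cj (antiPart B) = (1 / 2 : ℂ) • cj (b 1) - (Complex.I / 2) • cj (b Complex.I) := by
    rw [hQ]; ext i k; simp [map_ofNat (starRingEnd ℂ)]; ring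
  rw [hPH, hPc, hQT, hQc, hP, hQ]
  generalize b 1 = x at *
  generalize b Complex.I = y at *
  rw [sub_eq_iff_eq_add] at h11 h12 h21 h22
  have hI : Complex.I / 2 * (Complex.I / 2) = -(1 / 4) := by
    linear_combination Complex.I_mul_I / 4
  constructor
  · simp only [Matrix.add_mul, Matrix.mul_sub, Matrix.smul_mul, Matrix.mul_smul, h11, h12, h21,
      h22, smul_smul, smul_add, hI]
    match_scalars <;> ring_nf <;> simp [Complex.I_sq]
  · simp only [Matrix.add_mul, Matrix.mul_add, Matrix.smul_mul, Matrix.mul_smul, h11, h12, h21,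
      h22, smul_smul, smul_add, hI]
    match_scalars <;> ring

/-- A loop of symplectic maps which extends over the disk does not change the winding number of
`det²` of a loop of Lagrangian subspaces. -/
theorem winding_det_sq_unique {B : ℂ → Cn n →L[ℝ] Cn n}
    (hBc : ∀ v, ContinuousOn (fun z => B z v) disk) (hB : ∀ z ∈ disk, IsSymplecticMap (B z))
    {U U₀ : ℝ → Matrix (Fin n) (Fin n) ℂ} (hU : ∀ t, U t ∈ unitaryGroup (Fin n) ℂ)
    (hU₀ : ∀ t, U₀ t ∈ unitaryGroup (Fin n) ℂ) (hS : Continuous fun t => U₀ t * (U₀ t)ᵀ)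
    (hper : U₀ (2 * Real.pi) * (U₀ (2 * Real.pi))ᵀ = U₀ 0 * (U₀ 0)ᵀ)
    (hBU : ∀ (t : ℝ) (x : Fin n → ℝ), ∃ y : Fin n → ℝ,
      (B (Complex.exp (t * Complex.I)) (WithLp.toLp 2 (U t *ᵥ toC x))).ofLp = U₀ t *ᵥ toC y)
    {m m₀ : ℤ} (hm : HasWindingNumber (fun t => (U t).det ^ 2) m)
    (hm₀ : HasWindingNumber (fun t => (U₀ t).det ^ 2) m₀) : m = m₀ := by
  let P (z : ℂ) := linPart (B z)
  let Q (z : ℂ) := antiPart (B z)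
  let e (t : ℝ) : ℂ := Complex.exp (t * Complex.I)
  -- For `w` in `U₀ ℝⁿ` one has `w̄ = -K w`, so on this subspace the inverse `w ↦ Pᴴ w - Qᵀ w̄` of
  -- `B` is the complex matrix `Pᴴ + Qᵀ K`.
  let K (t : ℝ) := -cj (U₀ t * (U₀ t)ᵀ)
  have hcoord : ∀ v i, ContinuousOn (fun z => B z v i) disk := fun v i =>
    (contDiff_coord i).continuous.comp_continuousOn (hBc v)
  have hPc : ContinuousOn P disk := by
    refine continuousOn_pi.2 fun i => continuousOn_pi.2 fun k => ?_
    exact ((hcoord _ i).sub (continuousOn_const.mul (hcoord _ i))).div_const _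
  have hQc : ContinuousOn Q disk := by
    refine continuousOn_pi.2 fun i => continuousOn_pi.2 fun k => ?_
    exact ((hcoord _ i).add (continuousOn_const.mul (hcoord _ i))).div_const _
  have hK : ∀ t, K t ∈ unitaryGroup (Fin n) ℂ := fun t => by
    have h1 := cj_mem_unitaryGroup (mul_mem (hU₀ t) (transpose_mem_unitaryGroup (hU₀ t)))
    rw [mem_unitaryGroup_iff] at h1 ⊢
    simpa [K] using h1
  have hKc : Continuous K := by
    refine Continuous.neg (continuous_pi fun i => continuous_pi fun k => ?_)
    exact Complex.continuous_conj.comp (hS.matrix_elem i k)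
  have hrel : ∀ z ∈ disk, (P z)ᴴ * P z - (Q z)ᵀ * cj (Q z) = 1 ∧
      (P z)ᴴ * Q z - (Q z)ᵀ * cj (P z) = 0 := fun z hz => (hB z hz).relations
  have hPe : Continuous fun t => P (e t) := hPc.comp_continuous continuous_exp_mul_I exp_mul_I_mem_disk
  have hQe : Continuous fun t => Q (e t) := hQc.comp_continuous continuous_exp_mul_I exp_mul_I_mem_disk
  -- At `τ = 1` this is the determinant of the complex matrix that inverts `B` on the Lagrangian
  -- subspace. At `τ = 0` it is `det Pᴴ`, which is defined and nonzero over the whole disk and so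
  -- winds `0` times.
  let H (τ t : ℝ) : ℂ := ((P (e t))ᴴ + (τ : ℂ) • ((Q (e t))ᵀ * K t)).det
  have hHc : Continuous fun p : ℝ × ℝ => H p.1 p.2 := by
    refine Continuous.matrix_det (Continuous.add ?_ ?_)
    · exact (hPe.comp continuous_snd).matrix_conjTranspose
    · exact Continuous.smul (Complex.continuous_ofReal.comp continuous_fst) (((hQe.comp continuous_snd).matrix_transpose).matrix_mul
        (hKc.comp continuous_snd))
  have hH0 : HasWindingNumber (H 0) 0 := by
    have h1 : HasWindingNumber (fun t => ((P (e t))ᴴ).det) 0 := by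
      refine hasWindingNumber_of_disk (d := fun z => ((P z)ᴴ).det) ?_ fun z hz => ?_
      · exact (Continuous.matrix_det continuous_id).comp_continuousOn
          (continuous_id.matrix_conjTranspose.comp_continuousOn hPc)
      · have := det_add_smul_ne_zero (hrel z hz).1 (hK 0) (τ := 0) (by simp)
        simpa using this
    refine h1.congr fun t _ => ?_
    simp [H]
  have hH1 : HasWindingNumber (H 1) 0 := by
    refine HasWindingNumber.homotopy hHc.continuousOn (fun s hs t _ => ?_) (fun s _ => ?_) hH0
    · exact det_add_smul_ne_zero (hrel _ (exp_mul_I_mem_disk t)).1 (hK t)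
        (abs_le.2 ⟨by linarith [hs.1], hs.2⟩)
    · simp only [H, K, hper, e, exp_two_pi_mul_I]
  choose y hy using hBU
  let R (t : ℝ) : Matrix (Fin n) (Fin n) ℝ := (of fun j => y t (Pi.single j 1))ᵀ
  have hR : ∀ t, P (e t) * U t + Q (e t) * cj (U t) = U₀ t * matC (R t) := by
    intro t
    ext i j
    have h1 := congrFun (hy t (Pi.single j 1)) i
    rw [apply_eq_linPart_add_antiPart] at h1
    have h2 : toC (Pi.single j 1) = Pi.single j 1 := by
      ext k; by_cases hk : k = j
      · subst hk; simp
      · simp [hk]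
    rw [h2] at h1
    simp only [mulVec_single_one] at h1
    exact h1
  have hdet : ∀ t, (U t).det = H 1 t * (U₀ t).det * ((R t).det : ℂ) := by
    intro t
    have hr := hrel _ (exp_mul_I_mem_disk t)
    -- `B` sends the frame `U` to `U₀ R` with `R` real; applying the inverse expresses `U` by `U₀`.
    have h1 : U t = ((P (e t))ᴴ + ((1 : ℝ) : ℂ) • ((Q (e t))ᵀ * K t)) * U₀ t * matC (R t) := by
      have h2 : (Q (e t))ᵀ * K t * U₀ t * matC (R t) = -((Q (e t))ᵀ * cj (U₀ t * matC (R t))) := by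
        rw [cj_mul, cj_matC, ← cj_mul_transpose_mul (hU₀ t)]
        simp only [K, Matrix.mul_neg, Matrix.neg_mul, Matrix.mul_assoc]
      have h3 : cj (P (e t) * U t + Q (e t) * cj (U t)) =
          cj (P (e t)) * cj (U t) + cj (Q (e t)) * U t := by
        rw [← cj_mul]
        ext i j
        simp [mul_apply]
      rw [Complex.ofReal_one, one_smul, Matrix.add_mul, Matrix.add_mul, h2, ← hR, h3,
        Matrix.mul_assoc, ← hR, Matrix.mul_add, Matrix.mul_add, ← Matrix.mul_assoc,
        ← Matrix.mul_assoc, ← Matrix.mul_assoc, ← Matrix.mul_assoc, eq_add_of_sub_eq hr.1,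
        sub_eq_zero.1 hr.2, Matrix.add_mul, Matrix.one_mul]
      abel
    rw [← det_matC]
    conv_lhs => rw [h1]
    rw [det_mul, det_mul]
  -- In `(det U)²` the real matrix `R` contributes the positive factor `(det R)²`, which does not
  -- affect winding.
  have hfin := (hH1.pow 2).mul hm₀
  have h5 : HasWindingNumber (fun t => (U t).det ^ 2) _ :=
    hfin.of_pos_mul (r := fun t => (R t).det ^ 2) (fun t _ => ?_) (fun t _ => ?_)
  · have := hm.unique h5
    simpa using this
  · have h6 := det_ne_zero_of_mem_unitaryGroup (hU t)
    rw [hdet] at h6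
    have : (R t).det ≠ 0 := by exact_mod_cast right_ne_zero_of_mul h6
    positivity
  · rw [hdet]; push_cast; ring

end linear
end LagBlowUp

namespace LagBlowUp

/-! ### Unitary frames -/

section frames
variable {n k : ℕ} {V : Type*} [AddCommGroup V] [Module ℝ V] [TopologicalSpace V]

/-- The symplectic form `σ` and the complex structure `J` of a vector space are compatible. -/
structure LinCompatible (σ : V →L[ℝ] V →L[ℝ] ℝ) (J : V →L[ℝ] V) : Prop where
  alt (a : V) : σ a a = 0
  sq (a : V) : J (J a) = -a
  invariant (a b : V) : σ (J a) (J b) = σ a b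
  pos (a : V) : a ≠ 0 → 0 < σ a (J a)

namespace LinCompatible
variable {σ : V →L[ℝ] V →L[ℝ] ℝ} {J : V →L[ℝ] V}

theorem symm (h : LinCompatible σ J) (a b : V) : σ a b = -σ b a := by
  have := h.alt (a + b)
  simp only [map_add, _root_.add_apply, h.alt] at this
  linarith

theorem apply_J_left (h : LinCompatible σ J) (a b : V) : σ (J a) b = -σ a (J b) := by
  rw [← h.invariant, h.sq]; simp

theorem metric_symm (h : LinCompatible σ J) (a b : V) : σ a (J b) = σ b (J a) := by
  rw [h.symm, h.apply_J_left, neg_neg]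

end LinCompatible

theorem stdForm_I_smul (v w : Cn n) :
    stdForm v (Complex.I • w) = ∑ i, ((v i).re * (w i).re + (v i).im * (w i).im) := by
  simp [stdForm]

/-- A `k`-frame which is unitary for the Hermitian form of `σ` and `J`. -/
def IsUnitaryFamily (σ : V →L[ℝ] V →L[ℝ] ℝ) (J : V →L[ℝ] V) (E : Fin k → V) : Prop :=
  ∀ i j, σ (E i) (E j) = 0 ∧ σ (E i) (J (E j)) = if i = j then 1 else 0

/-- `Φ : ℂⁿ → V` is a unitary isomorphism. -/
structure IsUnitaryFrame (σ : V →L[ℝ] V →L[ℝ] ℝ) (J : V →L[ℝ] V) (Φ : Cn n →L[ℝ] V) : Prop where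
  symplectic (v w : Cn n) : σ (Φ v) (Φ w) = stdForm v w
  complex (v : Cn n) : Φ (Complex.I • v) = J (Φ v)

section
variable [IsTopologicalAddGroup V] [ContinuousSMul ℝ V]

/-- The real parts of the coordinates of a complex vector, as real-linear functionals. -/
def reCoord (i : Fin k) : Cn k →L[ℝ] ℝ :=
  Complex.reCLM.comp ((EuclideanSpace.proj i : Cn k →L[ℂ] ℂ).restrictScalars ℝ)

/-- The imaginary parts of the coordinates of a complex vector, as real-linear functionals. -/
def imCoord (i : Fin k) : Cn k →L[ℝ] ℝ :=
  Complex.imCLM.comp ((EuclideanSpace.proj i : Cn k →L[ℂ] ℂ).restrictScalars ℝ)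

@[simp] theorem reCoord_apply (i : Fin k) (v : Cn k) : reCoord i v = (v i).re := rfl

@[simp] theorem imCoord_apply (i : Fin k) (v : Cn k) : imCoord i v = (v i).im := rfl

/-- The complex-linear map `ℂᵏ → V` with the given images of the basis vectors. -/
def frameMap (J : V →L[ℝ] V) (E : Fin k → V) : Cn k →L[ℝ] V :=
  ∑ i, ((reCoord i).smulRight (E i) + (imCoord i).smulRight (J (E i)))

theorem frameMap_apply (J : V →L[ℝ] V) (E : Fin k → V) (v : Cn k) :
    frameMap J E v = ∑ i, ((v i).re • E i + (v i).im • J (E i)) := by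
  simp [frameMap, _root_.sum_apply]

theorem IsUnitaryFamily.isUnitaryFrame {σ : V →L[ℝ] V →L[ℝ] ℝ} {J : V →L[ℝ] V}
    (h : LinCompatible σ J) {E : Fin k → V} (hE : IsUnitaryFamily σ J E) :
    IsUnitaryFrame σ J (frameMap J E) := by
  constructor
  · intro v w
    rw [frameMap_apply, frameMap_apply, stdForm]
    simp only [map_sum, _root_.sum_apply]
    rw [Finset.sum_comm]
    refine Finset.sum_congr rfl fun i _ => ?_
    rw [Finset.sum_eq_single i]
    · simp only [map_add, map_smul, _root_.add_apply, _root_.smul_apply,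
        h.invariant, h.apply_J_left, (hE i i).1, (hE i i).2, smul_eq_mul, if_true]
      ring
    · intro j _ hj
      simp only [map_add, map_smul, _root_.add_apply, _root_.smul_apply,
        h.invariant, h.apply_J_left, (hE i j).1, (hE i j).2, smul_eq_mul, if_neg hj.symm]
      ring
    · simp
  · intro v
    rw [frameMap_apply, frameMap_apply, map_sum]
    refine Finset.sum_congr rfl fun i _ => ?_
    simp only [map_add, map_smul, h.sq]
    simp
    abel

/-- The unitary coordinates of a vector in a frame. -/
def frameCoord (σ : V →L[ℝ] V →L[ℝ] ℝ) (J : V →L[ℝ] V) (Φ : Cn n →L[ℝ] V) : V →L[ℝ] Cn n :=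
  ∑ i, (((σ (Φ (EuclideanSpace.single i 1))).comp J).smulRight (EuclideanSpace.single i (1 : ℂ)) +
    (σ (Φ (EuclideanSpace.single i 1))).smulRight (EuclideanSpace.single i Complex.I))

theorem frameCoord_apply (σ : V →L[ℝ] V →L[ℝ] ℝ) (J : V →L[ℝ] V) (Φ : Cn n →L[ℝ] V) (a : V)
    (i : Fin n) : frameCoord σ J Φ a i = σ (Φ (EuclideanSpace.single i 1)) (J a) +
      σ (Φ (EuclideanSpace.single i 1)) a * Complex.I := by
  simp only [frameCoord, _root_.sum_apply, WithLp.ofLp_sum, Finset.sum_apply]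
  rw [Finset.sum_eq_single i]
  · simp
  · intro j _ hj
    simp [hj.symm]
  · simp

namespace IsUnitaryFrame
variable {σ : V →L[ℝ] V →L[ℝ] ℝ} {J : V →L[ℝ] V} {Φ : Cn n →L[ℝ] V}

theorem frameCoord_frame (hΦ : IsUnitaryFrame σ J Φ) (v : Cn n) : frameCoord σ J Φ (Φ v) = v := by
  ext i
  rw [frameCoord_apply, ← hΦ.complex, hΦ.symplectic, hΦ.symplectic, stdForm_I_smul, stdForm,
    Finset.sum_eq_single i, Finset.sum_eq_single i]
  · simp
  · intro j _ hj; simp [hj]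
  · simp
  · intro j _ hj; simp [hj]
  · simp

theorem injective (hΦ : IsUnitaryFrame σ J Φ) : Function.Injective Φ :=
  Function.LeftInverse.injective hΦ.frameCoord_frame

theorem finrank_Cn : Module.finrank ℝ (Cn n) = 2 * n := by
  have h1 := Module.finrank_mul_finrank ℝ ℂ (Cn n)
  rw [Complex.finrank_real_complex, finrank_euclideanSpace, Fintype.card_fin] at h1
  exact h1.symm

theorem surjective [FiniteDimensional ℝ V] (hV : Module.finrank ℝ V = 2 * n)
    (hΦ : IsUnitaryFrame σ J Φ) : Function.Surjective Φ :=
  (LinearMap.injective_iff_surjective_of_finrank_eq_finrank (f := (Φ : Cn n →ₗ[ℝ] V))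
    (finrank_Cn.trans hV.symm)).1 hΦ.injective

theorem frame_frameCoord [FiniteDimensional ℝ V] (hV : Module.finrank ℝ V = 2 * n)
    (hΦ : IsUnitaryFrame σ J Φ) (a : V) : Φ (frameCoord σ J Φ a) = a := by
  obtain ⟨v, rfl⟩ := hΦ.surjective hV a
  rw [hΦ.frameCoord_frame]

end IsUnitaryFrame

/-- The component of `w` orthogonal to a unitary family. -/
def orthPart (σ : V →L[ℝ] V →L[ℝ] ℝ) (J : V →L[ℝ] V) (E : Fin k → V) (w : V) : V :=
  w - ∑ i, (σ (E i) (J w) • E i + σ (E i) w • J (E i))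

theorem IsUnitaryFamily.orthPart_eq {σ : V →L[ℝ] V →L[ℝ] ℝ} {J : V →L[ℝ] V}
    (h : LinCompatible σ J) {E : Fin k → V} (hE : IsUnitaryFamily σ J E) (w : V) (j : Fin k) :
    σ (E j) (orthPart σ J E w) = 0 ∧ σ (E j) (J (orthPart σ J E w)) = 0 := by
  have h0 : ∀ i, σ (E j) (J (J (E i))) = 0 := fun i => by rw [h.sq, map_neg, (hE j i).1, neg_zero]
  constructor
  · rw [orthPart, map_sub, map_sum, Finset.sum_eq_single j]
    · simp [(hE j j).1, (hE j j).2]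
    · intro i _ hi
      simp [(hE j i).1, (hE j i).2, hi.symm]
    · simp
  · rw [orthPart, map_sub, map_sub, map_sum, map_sum, Finset.sum_eq_single j]
    · simp [h0, (hE j j).2]
    · intro i _ hi
      simp [h0, (hE j i).2, hi.symm]
    · simp

theorem orthPart_ne_zero {σ : V →L[ℝ] V →L[ℝ] ℝ} {J : V →L[ℝ] V} {E : Fin k → V} {w : V}
    (hw : w ∉ range (frameMap J E)) : orthPart σ J E w ≠ 0 := by
  intro h0
  apply hw
  -- If the orthogonal part vanishes, the vector is the image of its own unitary coefficients.
  refine ⟨WithLp.toLp 2 fun i => (⟨σ (E i) (J w), σ (E i) w⟩ : ℂ), ?_⟩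
  rw [frameMap_apply]
  exact (sub_eq_zero.1 h0).symm

/-- By dimension: the range has real dimension at most `2 k < 2 n`. -/
theorem exists_notMem_range_frameMap [FiniteDimensional ℝ V] (hV : Module.finrank ℝ V = 2 * n)
    (hk : k < n) (J : V →L[ℝ] V) (E : Fin k → V) : ∃ w, w ∉ range (frameMap J E) := by
  by_contra hcon
  push Not at hcon
  have h1 := LinearMap.finrank_range_le (frameMap J E : Cn k →ₗ[ℝ] V)
  rw [LinearMap.range_eq_top.2 hcon, finrank_top, hV, IsUnitaryFrame.finrank_Cn] at h1
  omega

/-- The unit vector in the direction of the orthogonal part. -/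
def nextVec (σ : V →L[ℝ] V →L[ℝ] ℝ) (J : V →L[ℝ] V) (E : Fin k → V) (w : V) : V :=
  (√(σ (orthPart σ J E w) (J (orthPart σ J E w))))⁻¹ • orthPart σ J E w

/-- One step of the Gram-Schmidt process for the Hermitian form of `σ` and `J`. -/
theorem IsUnitaryFamily.snoc {σ : V →L[ℝ] V →L[ℝ] ℝ} {J : V →L[ℝ] V}
    (h : LinCompatible σ J) {E : Fin k → V} (hE : IsUnitaryFamily σ J E) {w : V}
    (hw : orthPart σ J E w ≠ 0) :
    IsUnitaryFamily σ J (Fin.snoc E (nextVec σ J E w) : Fin (k + 1) → V) := by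
  have h1 : ∀ j, σ (E j) (nextVec σ J E w) = 0 := fun j => by
    rw [nextVec, map_smul, (hE.orthPart_eq h w j).1, smul_zero]
  have h2 : ∀ j, σ (E j) (J (nextVec σ J E w)) = 0 := fun j => by
    rw [nextVec, map_smul, map_smul, (hE.orthPart_eq h w j).2, smul_zero]
  intro i j
  refine Fin.lastCases ?_ (fun i => ?_) i <;> refine Fin.lastCases ?_ (fun j => ?_) j
  · simp only [Fin.snoc_last, if_true]
    refine ⟨h.alt _, ?_⟩
    have hp := h.pos _ hw
    have hs := Real.mul_self_sqrt hp.le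
    have hs0 := (Real.sqrt_pos.2 hp).ne'
    simp only [nextVec, map_smul, _root_.smul_apply, smul_eq_mul]
    field_simp
    rw [sq, hs]
  · simp only [Fin.snoc_last, Fin.snoc_castSucc]
    rw [if_neg (by exact (Fin.castSucc_lt_last j).ne')]
    refine ⟨?_, ?_⟩
    · rw [h.symm, h1, neg_zero]
    · rw [h.metric_symm, h2]
  · simp only [Fin.snoc_last, Fin.snoc_castSucc]
    rw [if_neg (by exact (Fin.castSucc_lt_last i).ne)]
    exact ⟨h1 i, h2 i⟩
  · simp only [Fin.snoc_castSucc, Fin.castSucc_inj]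
    exact hE i j

end
end frames

/-! ### Continuous vector fields along maps and unitary trivializations over the disk -/

section manifold
variable {n : ℕ} {M : Type*} [TopologicalSpace M] [ChartedSpace (Cn n) M] [IsManifold (mdl n) ∞ M]
  {X : Type*} [TopologicalSpace X] {f : X → M} {s : Set X} {x₀ : X}

instance (x : M) : FiniteDimensional ℝ (TangentSpace (mdl n) x) :=
  inferInstanceAs (FiniteDimensional ℝ (Cn n))

theorem finrank_tangentSpace (x : M) : Module.finrank ℝ (TangentSpace (mdl n) x) = 2 * n :=
  IsUnitaryFrame.finrank_Cn (n := n)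

variable (n) in
/-- A vector field along the map `f` is continuous on `s`. -/
def ContField (f : X → M) (s : Set X) (a : ∀ x, TangentSpace (mdl n) (f x)) : Prop :=
  ContinuousOn (fun x => (⟨f x, a x⟩ : TangentBundle (mdl n) M)) s

theorem SymplecticForm.continuousOn (Ω : SymplecticForm n M) {a b : ∀ x, TangentSpace (mdl n) (f x)}
    (ha : ContField n f s a) (hb : ContField n f s b) :
    ContinuousOn (fun x => Ω.form (f x) (a x) (b x)) s := by
  have hf : ContinuousOn f s :=
    (FiberBundle.continuous_proj (Cn n) (TangentSpace (mdl n) (M := M))).comp_continuousOn ha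
  have hΩ := Ω.smooth.continuous.comp_continuousOn hf
  have h1 := ContinuousOn.clm_bundle_apply₂ (F₁ := Cn n) (F₂ := Cn n) (F₃ := ℝ)
    (E₁ := fun x : M => TangentSpace (mdl n) x) (E₂ := fun x : M => TangentSpace (mdl n) x)
    (E₃ := Bundle.Trivial M ℝ) (b := f) (ψ := fun x => Ω.form (f x)) hΩ ha hb
  exact (continuous_snd.comp (Bundle.Trivial.homeomorphProd M ℝ).continuous).comp_continuousOn h1

theorem AlmostComplex.continuousOn (J : AlmostComplex n M) {a : ∀ x, TangentSpace (mdl n) (f x)}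
    (ha : ContField n f s a) : ContField n f s (fun x => J.J (f x) (a x)) := by
  have hf : ContinuousOn f s :=
    (FiberBundle.continuous_proj (Cn n) (TangentSpace (mdl n) (M := M))).comp_continuousOn ha
  have hJ := J.smooth.continuous.comp_continuousOn hf
  exact ContinuousOn.clm_bundle_apply (F₁ := Cn n) (F₂ := Cn n) 
    (E₁ := fun x : M => TangentSpace (mdl n) x) (E₂ := fun x : M => TangentSpace (mdl n) x)
     (b := f) (ϕ := fun x => J.J (f x)) hJ ha

/-- Once the base map is continuous, only the fibre coordinate in a local trivialization matters; it
is linear on fibres, which is what makes sums and multiples of fields tractable. -/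
theorem contField_iff_of_continuousOn (hf : ContinuousOn f s) {a : ∀ x, TangentSpace (mdl n) (f x)} :
    ContField n f s a ↔ ∀ x₀ ∈ s, ContinuousWithinAt (fun x =>
      (trivializationAt (Cn n) (TangentSpace (mdl n)) (f x₀)
        (⟨f x, a x⟩ : TangentBundle (mdl n) M)).2) s x₀ := by
  refine forall₂_congr fun x₀ hx₀ => ?_
  rw [FiberBundle.continuousWithinAt_totalSpace]
  exact and_iff_right (hf x₀ hx₀)

theorem ContField.base (h : ContField n f s a) : ContinuousOn f s :=
  (FiberBundle.continuous_proj (Cn n) (TangentSpace (mdl n) (M := M))).comp_continuousOn h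

theorem ContField.linear_comb {a b : ∀ x, TangentSpace (mdl n) (f x)} (ha : ContField n f s a)
    (hb : ContField n f s b) {c d : X → ℝ} (hc : ContinuousOn c s) (hd : ContinuousOn d s) :
    ContField n f s (fun x => c x • a x + d x • b x) := by
  have hf := ha.base
  rw [contField_iff_of_continuousOn hf] at *
  intro x₀ hx₀
  let e := trivializationAt (Cn n) (TangentSpace (mdl n) (M := M)) (f x₀)
  have h1 := ((hc x₀ hx₀).smul (ha x₀ hx₀)).add ((hd x₀ hx₀).smul (hb x₀ hx₀))
  refine h1.congr_of_eventuallyEq ?_ ?_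
  · have : ∀ᶠ x in 𝓝[s] x₀, f x ∈ e.baseSet := (hf x₀ hx₀).eventually
      (e.open_baseSet.mem_nhds (FiberBundle.mem_baseSet_trivializationAt' _))
    filter_upwards [this] with x hx
    have hl := e.linear ℝ hx
    simp only [Pi.add_apply, Pi.smul_apply']
    exact (hl.map_add _ _).trans (congrArg₂ _ (hl.map_smul _ _) (hl.map_smul _ _))
  · have hl := e.linear ℝ (FiberBundle.mem_baseSet_trivializationAt' (f x₀))
    simp only [Pi.add_apply, Pi.smul_apply']
    exact (hl.map_add _ _).trans (congrArg₂ _ (hl.map_smul _ _) (hl.map_smul _ _))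

theorem ContField.add {a b : ∀ x, TangentSpace (mdl n) (f x)} (ha : ContField n f s a)
    (hb : ContField n f s b) : ContField n f s (fun x => a x + b x) := by
  simpa using ha.linear_comb hb (c := fun _ => 1) (d := fun _ => 1) continuousOn_const
    continuousOn_const

theorem ContField.sub {a b : ∀ x, TangentSpace (mdl n) (f x)} (ha : ContField n f s a)
    (hb : ContField n f s b) : ContField n f s (fun x => a x - b x) := by
  simpa [sub_eq_add_neg] using ha.linear_comb hb (c := fun _ => 1) (d := fun _ => -1)
    continuousOn_const continuousOn_const

theorem ContField.smul {a : ∀ x, TangentSpace (mdl n) (f x)} (ha : ContField n f s a)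
    {c : X → ℝ} (hc : ContinuousOn c s) : ContField n f s (fun x => c x • a x) := by
  simpa using ha.linear_comb ha hc (d := fun _ => 0) continuousOn_const

theorem ContField.zero (hf : ContinuousOn f s) : ContField n f s (fun x => 0) := by
  rw [contField_iff_of_continuousOn hf]
  intro x₀ hx₀
  let e := trivializationAt (Cn n) (TangentSpace (mdl n) (M := M)) (f x₀)
  refine (continuousWithinAt_const (b := (0 : Cn n))).congr_of_eventuallyEq ?_ ?_
  · have : ∀ᶠ x in 𝓝[s] x₀, f x ∈ e.baseSet := (hf x₀ hx₀).eventually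
      (e.open_baseSet.mem_nhds (FiberBundle.mem_baseSet_trivializationAt' _))
    filter_upwards [this] with x hx
    exact (e.linear ℝ hx).map_zero
  · exact (e.linear ℝ (FiberBundle.mem_baseSet_trivializationAt' (f x₀))).map_zero

theorem ContField.sum {ι : Type*} (t : Finset ι) {a : ι → ∀ x, TangentSpace (mdl n) (f x)}
    (hf : ContinuousOn f s) (ha : ∀ i, ContField n f s (a i)) :
    ContField n f s (fun x => ∑ i ∈ t, a i x) := by
  classical
  induction t using Finset.induction_on with
  | empty => simpa using ContField.zero hf
  | insert i t hi ih => simpa [Finset.sum_insert hi] using (ha i).add ih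

theorem ContField.comp {Y : Type*} [TopologicalSpace Y] {g : Y → X} {t : Set Y}
    {a : ∀ x, TangentSpace (mdl n) (f x)} (ha : ContField n f s a) (hg : ContinuousOn g t)
    (hgt : MapsTo g t s) : ContField n (f ∘ g) t (fun y => a (g y)) :=
  ContinuousOn.comp (g := fun x => (⟨f x, a x⟩ : TangentBundle (mdl n) M)) ha hg hgt

theorem ContField.mono {t : Set X} {a : ∀ x, TangentSpace (mdl n) (f x)} (ha : ContField n f s a)
    (h : t ⊆ s) : ContField n f t a := ContinuousOn.mono ha h

theorem Compatible.lin {Ω : SymplecticForm n M} {J : AlmostComplex n M} (h : Compatible Ω J)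
    (x : M) : LinCompatible (Ω.form x) (J.J x) :=
  ⟨Ω.alt x, J.sq x, h.invariant x, h.pos x⟩

theorem ContField.frameMap (J : AlmostComplex n M) {k : ℕ}
    {E : Fin k → ∀ x, TangentSpace (mdl n) (f x)} (hf : ContinuousOn f s)
    (hE : ∀ i, ContField n f s (E i)) {v : X → Cn k} (hv : ContinuousOn v s) :
    ContField n f s (fun x => LagBlowUp.frameMap (J.J (f x)) (fun i => E i x) (v x)) := by
  simp only [frameMap_apply]
  refine ContField.sum _ hf fun i => ?_
  have h1 : ContinuousOn (fun x => v x i) s := (contDiff_coord i).continuous.comp_continuousOn hv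
  exact (hE i).linear_comb (J.continuousOn (hE i)) (Complex.continuous_re.comp_continuousOn h1)
    (Complex.continuous_im.comp_continuousOn h1)

theorem ContField.orthPart (Ω : SymplecticForm n M) (J : AlmostComplex n M) {k : ℕ}
    {E : Fin k → ∀ x, TangentSpace (mdl n) (f x)}
    (hE : ∀ i, ContField n f s (E i)) {w : ∀ x, TangentSpace (mdl n) (f x)}
    (hw : ContField n f s w) :
    ContField n f s (fun x => LagBlowUp.orthPart (Ω.form (f x)) (J.J (f x)) (fun i => E i x) (w x)) :=
  hw.sub (ContField.sum _ hw.base fun i => (hE i).linear_comb (J.continuousOn (hE i))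
    (Ω.continuousOn (hE i) (J.continuousOn hw)) (Ω.continuousOn (hE i) hw))

/-- Locally there are unitary families of vector fields. -/
theorem exists_unitaryFamily {Ω : SymplecticForm n M} {J : AlmostComplex n M} (h : Compatible Ω J)
    (x₀ : M) (k : ℕ) (hk : k ≤ n) : ∃ s : Set M, IsOpen s ∧ x₀ ∈ s ∧
      ∃ E : Fin k → ∀ x : M, TangentSpace (mdl n) x, (∀ i, ContField n id s (E i)) ∧
        ∀ x ∈ s, IsUnitaryFamily (Ω.form x) (J.J x) (fun i => E i x) := by
  induction k with
  | zero => exact ⟨univ, isOpen_univ, mem_univ _, fun i => i.elim0, fun i => i.elim0,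
      fun x _ i => i.elim0⟩
  | succ k ih =>
    obtain ⟨s, hs, hxs, E, hE, hEu⟩ := ih (by omega)
    obtain ⟨w₀, hw₀⟩ := exists_notMem_range_frameMap (finrank_tangentSpace x₀) (by omega : k < n)
      (J.J x₀) (fun i => E i x₀)
    let e := trivializationAt (Cn n) (TangentSpace (mdl n) (M := M)) x₀
    have hxe : x₀ ∈ e.baseSet := FiberBundle.mem_baseSet_trivializationAt' x₀
    let w : ∀ x : M, TangentSpace (mdl n) x := fun x => e.symm x (e ⟨x₀, w₀⟩).2
    -- The vector `w₀` outside the span of the family at `x₀` is extended with constant fibre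
    -- coordinates in the trivialization around `x₀`.
    have hwx : w x₀ = w₀ := e.symm_apply_apply_mk hxe w₀
    have hw : ContField n id e.baseSet w :=
      e.continuousOn_symm.comp (f := fun x : M => (x, (e ⟨x₀, w₀⟩).2)) (by fun_prop)
        (fun x hx => ⟨hx, mem_univ _⟩)
    let t := s ∩ e.baseSet
    have ht : IsOpen t := hs.inter e.open_baseSet
    have hEt : ∀ i, ContField n id t (E i) := fun i => (hE i).mono inter_subset_left
    let p : ∀ x : M, TangentSpace (mdl n) x := fun x =>
      orthPart (Ω.form x) (J.J x) (fun i => E i x) (w x)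
    have hp : ContField n id t p := ContField.orthPart Ω J hEt (hw.mono inter_subset_right)
    have hN := Ω.continuousOn hp (J.continuousOn hp)
    let N : M → ℝ := fun x => Ω.form x (p x) (J.J x (p x))
    have hNc : ContinuousOn N t := hN
    -- Shrinking to where the orthogonal part has positive norm, which is open and contains `x₀`,
    -- makes the normalization continuous.
    let t' := t ∩ N ⁻¹' Ioi 0
    have ht't : t' ⊆ t := inter_subset_left
    have hp0 : p x₀ ≠ 0 := orthPart_ne_zero (by rw [hwx]; exact hw₀)
    refine ⟨t', hNc.isOpen_inter_preimage ht isOpen_Ioi, ⟨⟨hxs, hxe⟩, h.pos _ _ hp0⟩,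
      fun i x => (Fin.snoc (fun i => E i x)
        (nextVec (Ω.form x) (J.J x) (fun i => E i x) (w x)) : Fin (k + 1) → _) i, ?_, ?_⟩
    · intro i
      refine Fin.lastCases ?_ (fun i => ?_) i
      · simp only [Fin.snoc_last, nextVec]
        refine (hp.mono ht't).smul (c := fun x => (√(N x))⁻¹) ?_
        exact ((hNc.mono ht't).sqrt).inv₀ fun x hx => (Real.sqrt_pos.2 hx.2).ne'
      · simp only [Fin.snoc_castSucc]
        exact (hEt i).mono ht't
    · intro x hx
      refine (hEu x hx.1.1).snoc (h.lin x) ?_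
      intro h0
      have h1 : p x = 0 := h0
      have h2 : 0 < N x := hx.2
      simp only [N, h1] at h2
      simp at h2

/-- `Φ` is a unitary trivialization of `f^* TM` over `s`. -/
structure IsUnitaryTriv (Ω : SymplecticForm n M) (J : AlmostComplex n M) (f : X → M) (s : Set X)
    (Φ : ∀ x, Cn n →L[ℝ] TangentSpace (mdl n) (f x)) : Prop where
  continuous : ContField n (fun q : X × Cn n => f q.1) (s ×ˢ univ) (fun q => Φ q.1 q.2)
  frame (x : X) : x ∈ s → IsUnitaryFrame (Ω.form (f x)) (J.J (f x)) (Φ x)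

theorem exists_unitaryTriv_nhds {Ω : SymplecticForm n M} {J : AlmostComplex n M}
    (h : Compatible Ω J) (x₀ : M) : ∃ s : Set M, IsOpen s ∧ x₀ ∈ s ∧
      ∃ Φ : ∀ x : M, Cn n →L[ℝ] TangentSpace (mdl n) x, IsUnitaryTriv Ω J id s Φ := by
  obtain ⟨s, hs, hx, E, hE, hEu⟩ := exists_unitaryFamily h x₀ n le_rfl
  refine ⟨s, hs, hx, fun x => frameMap (J.J x) (fun i => E i x), ?_, fun x hx =>
    (hEu x hx).isUnitaryFrame (h.lin x)⟩
  refine ContField.frameMap (f := fun q : M × Cn n => q.1) J (E := fun i q => E i q.1)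
    continuousOn_fst (fun i => ?_) continuousOn_snd
  exact (hE i).comp continuousOn_fst (fun q hq => hq.1)

namespace IsUnitaryTriv
variable {Ω : SymplecticForm n M} {J : AlmostComplex n M}
  {Φ : ∀ x, Cn n →L[ℝ] TangentSpace (mdl n) (f x)}

theorem comp (h : IsUnitaryTriv Ω J f s Φ) {Y : Type*} [TopologicalSpace Y] {g : Y → X} {t : Set Y}
    (hg : ContinuousOn g t) (hgt : MapsTo g t s) :
    IsUnitaryTriv Ω J (f ∘ g) t (fun y => Φ (g y)) := by
  refine ⟨?_, fun y hy => h.frame _ (hgt hy)⟩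
  exact h.continuous.comp (g := fun q : Y × Cn n => (g q.1, q.2))
    ((hg.comp continuousOn_fst fun q hq => hq.1).prodMk continuousOn_snd)
    (fun q hq => ⟨hgt hq.1, mem_univ _⟩)

theorem mono (h : IsUnitaryTriv Ω J f s Φ) {t : Set X} (ht : t ⊆ s) : IsUnitaryTriv Ω J f t Φ :=
  ⟨h.continuous.mono (prod_mono ht le_rfl), fun x hx => h.frame x (ht hx)⟩

theorem contField (h : IsUnitaryTriv Ω J f s Φ) {v : X → Cn n} (hv : ContinuousOn v s) :
    ContField n f s (fun x => Φ x (v x)) :=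
  h.continuous.comp (g := fun x => (x, v x)) (continuousOn_id.prodMk hv)
    (fun x hx => ⟨hx, mem_univ _⟩)

theorem continuousOn_frameCoord (h : IsUnitaryTriv Ω J f s Φ)
    {a : ∀ x, TangentSpace (mdl n) (f x)} (ha : ContField n f s a) :
    ContinuousOn (fun x => frameCoord (Ω.form (f x)) (J.J (f x)) (Φ x) (a x)) s := by
  have : ContinuousOn (fun x => (frameCoord (Ω.form (f x)) (J.J (f x)) (Φ x) (a x)).ofLp) s := by
    refine continuousOn_pi.2 fun i => ?_
    simp only [frameCoord_apply]
    have h1 := h.contField (v := fun _ => EuclideanSpace.single i 1) continuousOn_const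
    exact (Complex.continuous_ofReal.comp_continuousOn (Ω.continuousOn h1 (J.continuousOn ha))).add
      ((Complex.continuous_ofReal.comp_continuousOn (Ω.continuousOn h1 ha)).mul continuousOn_const)
  exact (PiLp.continuous_toLp 2 _).comp_continuousOn this

/-- Unitary trivializations over two closed sets glue, if the second set retracts onto the
intersection. -/
theorem glue {t : Set X} (hs : IsClosed s) (ht : IsClosed t)
    {Ψ : ∀ x, Cn n →L[ℝ] TangentSpace (mdl n) (f x)} (hΦ : IsUnitaryTriv Ω J f s Φ)
    (hΨ : IsUnitaryTriv Ω J f t Ψ) {r : X → X} (hr : ContinuousOn r t) (hrt : MapsTo r t (s ∩ t))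
    (hri : ∀ x ∈ s ∩ t, r x = x) :
    ∃ Θ : ∀ x, Cn n →L[ℝ] TangentSpace (mdl n) (f x), IsUnitaryTriv Ω J f (s ∪ t) Θ := by
  classical
  let g : X → (Cn n →L[ℝ] Cn n) := fun x => (frameCoord (Ω.form (f x)) (J.J (f x)) (Ψ x)).comp (Φ x)
  -- The transition `g` between the two frames makes sense only on the overlap. Transported to all
  -- of `t` by the retraction `r`, it corrects `Ψ` so that it agrees with `Φ` on the overlap.
  let Ψ' : ∀ x, Cn n →L[ℝ] TangentSpace (mdl n) (f x) := fun x => (Ψ x).comp (g (r x))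
  have hst : ∀ x ∈ s ∩ t, Ψ' x = Φ x := by
    intro x hx
    have e : g (r x) = g x := by rw [hri x hx]
    ext v : 1
    change Ψ x (g (r x) v) = _
    rw [e]
    exact (hΨ.frame x hx.2).frame_frameCoord (finrank_tangentSpace _) _
  have hΨ' : IsUnitaryTriv Ω J f t Ψ' := by
    constructor
    · have h1 : ContinuousOn (fun q : X × Cn n => g q.1 q.2) ((s ∩ t) ×ˢ univ) :=
        (hΨ.comp (g := Prod.fst) (t := (s ∩ t) ×ˢ (univ : Set (Cn n))) continuousOn_fst
          (fun q hq => hq.1.2)).continuousOn_frameCoord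
          (hΦ.continuous.mono (prod_mono inter_subset_left le_rfl))
      have h2 : ContinuousOn (fun q : X × Cn n => g (r q.1) q.2) (t ×ˢ univ) :=
        h1.comp (f := fun q : X × Cn n => (r q.1, q.2))
          ((hr.comp continuousOn_fst fun q hq => hq.1).prodMk continuousOn_snd)
          (fun q hq => ⟨hrt hq.1, mem_univ _⟩)
      exact hΨ.continuous.comp (g := fun q : X × Cn n => (q.1, g (r q.1) q.2))
        (continuousOn_fst.prodMk h2) (fun q hq => ⟨hq.1, mem_univ _⟩)
    · intro x hx
      have h1 := hΨ.frame x hx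
      have h2 := hΦ.frame _ (hrt hx).1
      have h3 := hΨ.frame _ (hrt hx).2
      -- At the point `r x` of the overlap both frames are unitary, so the transition between them
      -- is unitary and may be composed with the frame at `x`.
      have h4 : ∀ v, Ψ (r x) (g (r x) v) = Φ (r x) v := fun v =>
        h3.frame_frameCoord (finrank_tangentSpace _) _
      constructor
      · intro v w
        simp only [Ψ', ContinuousLinearMap.comp_apply]
        rw [h1.symplectic, ← h3.symplectic, h4, h4, h2.symplectic]
      · intro v
        simp only [Ψ', ContinuousLinearMap.comp_apply]
        rw [← h1.complex]
        congr 1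
        apply h3.injective
        rw [h4, h3.complex, h4, h2.complex]
  refine ⟨fun x => if x ∈ s then Φ x else Ψ' x, ?_, ?_⟩
  · rw [union_prod]
    refine ContinuousOn.union_of_isClosed ?_ ?_ (hs.prod isClosed_univ) (ht.prod isClosed_univ)
    · refine hΦ.continuous.congr fun q hq => ?_
      simp only [if_pos hq.1]
    · refine hΨ'.continuous.congr fun q hq => ?_
      by_cases hqs : q.1 ∈ s
      · simp only [if_pos hqs, hst _ ⟨hqs, hq.1⟩]
      · simp only [if_neg hqs]
  · intro x hx
    by_cases hxs : x ∈ s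
    · simp only [if_pos hxs]; exact hΦ.frame x hxs
    · simp only [if_neg hxs]; exact hΨ'.frame x (hx.resolve_left hxs)

end IsUnitaryTriv

/-- A relation between reals which is local and additive holds between the ends of intervals. -/
theorem interval_induction {Q : ℝ → ℝ → Prop} {A B : ℝ} (hAB : A ≤ B)
    (hglue : ∀ a m b, a ≤ m → m ≤ b → Q a m → Q m b → Q a b)
    (hloc : ∀ x ∈ Icc A B, ∃ ε > 0, ∀ a b, a ≤ b → x - ε < a → b < x + ε → Q a b) : Q A B := by
  choose! ε hε hQ using hloc
  -- With a Lebesgue number `δ` of the cover, the relation holds across any step of length at most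
  -- `δ / 2`, and finitely many such steps lead from `A` to `B`.
  obtain ⟨δ, hδ, hcov⟩ := lebesgue_number_lemma_of_metric (s := Icc A B)
    (c := fun x : Icc A B => Metric.ball (x : ℝ) (ε x)) isCompact_Icc (fun _ => Metric.isOpen_ball)
    (fun x hx => mem_iUnion.2 ⟨⟨x, hx⟩, Metric.mem_ball_self (hε x hx)⟩)
  have hstep : ∀ a b, b ∈ Icc A B → a ≤ b → b - δ / 2 ≤ a → Q a b := by
    intro a b hb hab hba
    obtain ⟨x, hx⟩ := hcov b hb
    have h1 := hx (show a ∈ Metric.ball b δ by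
      rw [Metric.mem_ball, Real.dist_eq, abs_lt]; constructor <;> linarith)
    have h2 := hx (Metric.mem_ball_self hδ)
    rw [Metric.mem_ball, Real.dist_eq, abs_lt] at h1 h2
    exact hQ x x.2 a b hab (by linarith) (by linarith)
  have key : ∀ k : ℕ, ∀ b ∈ Icc A B, b ≤ A + k * (δ / 2) → Q A b := by
    intro k
    induction k with
    | zero =>
      intro b hb hbA
      have : b = A := le_antisymm (by simpa using hbA) hb.1
      subst this
      exact hstep _ _ hb le_rfl (by linarith)
    | succ k ih =>
      intro b hb hbA
      push_cast at hbA
      have h1 := le_max_left A (b - δ / 2)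
      have h2 := le_max_right A (b - δ / 2)
      have h3 : max A (b - δ / 2) ≤ b := max_le hb.1 (by linarith)
      refine hglue A (max A (b - δ / 2)) b h1 h3 (ih _ ⟨h1, h3.trans hb.2⟩ (max_le ?_ ?_))
        (hstep _ _ hb h3 h2)
      · have : (0 : ℝ) ≤ k * (δ / 2) := by positivity
        linarith
      · linarith
  obtain ⟨k, hk⟩ := exists_nat_ge ((B - A) / (δ / 2))
  refine key k B ⟨hAB, le_rfl⟩ ?_
  rw [div_le_iff₀ (by linarith)] at hk
  linarith

/-- Small squares have trivializations. They are glued along vertical edges into horizontal strips,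
whose height is the minimum of finitely many sizes, and the strips are glued along horizontal edges.
The retraction used for gluing is the projection onto the common edge. -/
theorem exists_unitaryTriv_rectangle {Ω : SymplecticForm n M} {J : AlmostComplex n M}
    (h : Compatible Ω J) {f : ℝ × ℝ → M} (hf : Continuous f) {a b c d : ℝ} (hab : a ≤ b)
    (hcd : c ≤ d) : ∃ Φ : ∀ x, Cn n →L[ℝ] TangentSpace (mdl n) (f x),
      IsUnitaryTriv Ω J f (Icc a b ×ˢ Icc c d) Φ := by
  let T (s : Set (ℝ × ℝ)) : Prop := ∃ Φ : ∀ x, Cn n →L[ℝ] TangentSpace (mdl n) (f x),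
    IsUnitaryTriv Ω J f s Φ
  have hmono : ∀ {s t : Set (ℝ × ℝ)}, t ⊆ s → T s → T t := fun hst ⟨Φ, hΦ⟩ => ⟨Φ, hΦ.mono hst⟩
  have hclosed : ∀ a b c d : ℝ, IsClosed (Icc a b ×ˢ Icc c d) := fun a b c d =>
    isClosed_Icc.prod isClosed_Icc
  have hglue1 : ∀ c d a m b, a ≤ m → m ≤ b → T (Icc a m ×ˢ Icc c d) → T (Icc m b ×ˢ Icc c d) →
      T (Icc a b ×ˢ Icc c d) := by
    rintro c d a m b ham hmb ⟨Φ, hΦ⟩ ⟨Ψ, hΨ⟩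
    have := hΦ.glue (hclosed _ _ _ _) (hclosed _ _ _ _) hΨ (r := fun p => (m, p.2)) (by fun_prop)
      (fun p hp => ⟨⟨⟨ham, le_rfl⟩, hp.2⟩, ⟨⟨le_rfl, hmb⟩, hp.2⟩⟩)
      (fun p hp => Prod.ext (le_antisymm hp.2.1.1 hp.1.1.2) rfl)
    rwa [← union_prod, Icc_union_Icc_eq_Icc ham hmb] at this
  have hglue2 : ∀ a b c m d, c ≤ m → m ≤ d → T (Icc a b ×ˢ Icc c m) → T (Icc a b ×ˢ Icc m d) →
      T (Icc a b ×ˢ Icc c d) := by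
    rintro a b c m d hcm hmd ⟨Φ, hΦ⟩ ⟨Ψ, hΨ⟩
    have := hΦ.glue (hclosed _ _ _ _) (hclosed _ _ _ _) hΨ (r := fun p => (p.1, m)) (by fun_prop)
      (fun p hp => ⟨⟨hp.1, ⟨hcm, le_rfl⟩⟩, ⟨hp.1, ⟨le_rfl, hmd⟩⟩⟩)
      (fun p hp => Prod.ext rfl (le_antisymm hp.2.2.1 hp.1.2.2))
    rwa [← prod_union, Icc_union_Icc_eq_Icc hcm hmd] at this
  have hloc : ∀ p : ℝ × ℝ, ∃ ε > 0, T (Icc (p.1 - ε) (p.1 + ε) ×ˢ Icc (p.2 - ε) (p.2 + ε)) := by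
    intro p
    obtain ⟨s, hs, hps, Φ, hΦ⟩ := exists_unitaryTriv_nhds h (f p)
    obtain ⟨ε, hε, hsub⟩ := Metric.nhds_basis_closedBall.mem_iff.1
      (hf.continuousAt.preimage_mem_nhds (hs.mem_nhds hps))
    refine ⟨ε, hε, _, hΦ.comp (g := f) hf.continuousOn (t := _) fun q hq => hsub ?_⟩
    rw [← Real.closedBall_eq_Icc, ← Real.closedBall_eq_Icc, closedBall_prod_same] at hq
    exact hq
  have hrow : ∀ y, ∃ ε > 0, T (Icc a b ×ˢ Icc (y - ε) (y + ε)) := by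
    intro y
    refine interval_induction (Q := fun a b => ∃ ε > 0, T (Icc a b ×ˢ Icc (y - ε) (y + ε))) hab ?_ ?_
    · rintro a m b ham hmb ⟨ε, hε, h1⟩ ⟨ε', hε', h2⟩
      have hl := min_le_left ε ε'
      have hr := min_le_right ε ε'
      refine ⟨min ε ε', lt_min hε hε', hglue1 _ _ a m b ham hmb (hmono ?_ h1) (hmono ?_ h2)⟩
      · exact prod_mono le_rfl (Icc_subset_Icc (by linarith) (by linarith))
      · exact prod_mono le_rfl (Icc_subset_Icc (by linarith) (by linarith))
    · intro x _
      obtain ⟨ε, hε, h1⟩ := hloc (x, y)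
      exact ⟨ε, hε, fun a b _ ha hb => ⟨ε, hε,
        hmono (prod_mono (Icc_subset_Icc ha.le hb.le) le_rfl) h1⟩⟩
  refine interval_induction (Q := fun c d => T (Icc a b ×ˢ Icc c d)) hcd (hglue2 a b) fun y _ => ?_
  obtain ⟨ε, hε, h1⟩ := hrow y
  exact ⟨ε, hε, fun c d _ hc hd => hmono (prod_mono le_rfl (Icc_subset_Icc hc.le hd.le)) h1⟩

/-- The pullback of the tangent bundle to the disk has a unitary trivialization. -/
theorem exists_unitaryTriv_disk {Ω : SymplecticForm n M} {J : AlmostComplex n M}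
    (h : Compatible Ω J) {u : ℂ → M} (hu : ContinuousOn u disk) :
    ∃ Φ : ∀ z, Cn n →L[ℝ] TangentSpace (mdl n) (u z), IsUnitaryTriv Ω J u disk Φ := by
  -- The disk is contained in the square `[-1, 1]²`, to which `u` is extended by the radial
  -- retraction; the trivialization over the square is then restricted.
  obtain ⟨Φ, hΦ⟩ := exists_unitaryTriv_rectangle h
    (f := fun p : ℝ × ℝ => u (toDisk (Complex.equivRealProdCLM.symm p)))
    (hu.comp_continuous (continuous_toDisk.comp Complex.equivRealProdCLM.symm.continuous)
      (fun p => toDisk_mem _)) (show (-1 : ℝ) ≤ 1 by norm_num) (show (-1 : ℝ) ≤ 1 by norm_num)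
  have h1 := hΦ.comp (g := Complex.equivRealProdCLM) (t := disk)
    Complex.equivRealProdCLM.continuous.continuousOn (fun z hz => by
      rw [mem_closedBall_zero_iff] at hz
      exact ⟨abs_le.1 ((Complex.abs_re_le_norm z).trans hz),
        abs_le.1 ((Complex.abs_im_le_norm z).trans hz)⟩)
  have h2 : ∀ z ∈ disk, u (toDisk (Complex.equivRealProdCLM.symm (Complex.equivRealProdCLM z))) =
      u z := fun z hz => by
    rw [ContinuousLinearEquiv.symm_apply_apply, toDisk_of_mem hz]
  let Ψ : ∀ z, Cn n →L[ℝ] TangentSpace (mdl n) (u z) := fun z => Φ (Complex.equivRealProdCLM z)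
  refine ⟨Ψ, ?_, fun z hz => ?_⟩
  · refine h1.continuous.congr fun q hq => ?_
    have := h2 q.1 hq.1
    exact congrArg (fun p => (⟨p, (Ψ q.1 q.2 : Cn n)⟩ : TangentBundle (mdl n) M)) this.symm
  · have h3 := h1.frame z hz
    -- The base points agree only propositionally; since all tangent spaces are definitionally `Cn
    -- n`, the frame itself need not be changed.
    have : ∀ p : M, p = u z → IsUnitaryFrame (V := TangentSpace (mdl n) p) (Ω.form p) (J.J p)
        (show Cn n →L[ℝ] TangentSpace (mdl n) p from (Ψ z : Cn n →L[ℝ] Cn n)) →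
        IsUnitaryFrame (Ω.form (u z)) (J.J (u z)) (Ψ z) := by
      rintro p rfl hp; exact hp
    exact this _ (h2 z hz) h3

theorem IsUnitaryTriv.isSymplecticTrivialization {Ω : SymplecticForm n M} {J : AlmostComplex n M}
    {u : ℂ → M} {Φ : ∀ z, Cn n →L[ℝ] TangentSpace (mdl n) (u z)}
    (h : IsUnitaryTriv Ω J u disk Φ) : IsSymplecticTrivialization Ω u Φ :=
  ⟨h.continuous, fun z hz => (h.frame z hz).symplectic⟩

end manifold
end LagBlowUp

namespace LagBlowUp

/-! ### Chart frames and tangent spaces of Lagrangian submanifolds -/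

section manifold
variable {n : ℕ} {M : Type*} [TopologicalSpace M] [ChartedSpace (Cn n) M] [IsManifold (mdl n) ∞ M]
  {X : Type*} [TopologicalSpace X] {f : X → M} {s : Set X}

theorem tangentBundle_mk_eq {x y : M} (h : x = y) {v w : Cn n} (hv : v = w) :
    (⟨x, v⟩ : TangentBundle (mdl n) M) = ⟨y, w⟩ := by
  subst h hv; rfl

theorem snd_eq_of_tangentBundle_eq {p q : TangentBundle (mdl n) M} (h : p = q) :
    (p.2 : Cn n) = q.2 :=
  congrArg (fun p : TangentBundle (mdl n) M => (p.2 : Cn n)) h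

/-- The fields take values in `Cn n`, to which every tangent space is definitionally equal, so that
the base map may be replaced by one that agrees with it only on `s`. -/
theorem ContField.congr {f' : X → M} {a a' : X → Cn n}
    (h : ContField n f s (fun x => (a x : TangentSpace (mdl n) (f x))))
    (hf : ∀ x ∈ s, f' x = f x) (ha : ∀ x ∈ s, a' x = a x) :
    ContField n f' s (fun x => (a' x : TangentSpace (mdl n) (f' x))) :=
  ContinuousOn.congr h fun x hx => tangentBundle_mk_eq (hf x hx) (ha x hx)

/-- The frame of the tangent space at `x` given by the chart `e`. -/
def chartFrame (e : OpenPartialHomeomorph M (Cn n)) (x : M) : Cn n →L[ℝ] TangentSpace (mdl n) x :=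
  (mfderiv (mdl n) (mdl n) e.symm (e x) : Cn n →L[ℝ] Cn n)

theorem mdifferentiable_of_mem_maximalAtlas {e : OpenPartialHomeomorph M (Cn n)}
    (he : e ∈ IsManifold.maximalAtlas (mdl n) ∞ M) : e.MDifferentiable (mdl n) (mdl n) :=
  ⟨(contMDiffOn_of_mem_maximalAtlas he).mdifferentiableOn (by simp),
    (contMDiffOn_symm_of_mem_maximalAtlas he).mdifferentiableOn (by simp)⟩

variable {e : OpenPartialHomeomorph M (Cn n)}

theorem chartFrame_mfderiv (he : e ∈ IsManifold.maximalAtlas (mdl n) ∞ M) {x : M}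
    (hx : x ∈ e.source) (v : TangentSpace (mdl n) x) :
    chartFrame e x (mfderiv (mdl n) (mdl n) e x v) = v :=
  DFunLike.congr_fun ((mdifferentiable_of_mem_maximalAtlas he).symm_comp_deriv hx) v

theorem mfderiv_chartFrame (he : e ∈ IsManifold.maximalAtlas (mdl n) ∞ M) {x : M}
    (hx : x ∈ e.source) (v : Cn n) :
    mfderiv (mdl n) (mdl n) e x (chartFrame e x v) = v := by
  obtain ⟨w, rfl⟩ := (mdifferentiable_of_mem_maximalAtlas he).mfderiv_surjective hx v
  rw [chartFrame_mfderiv he hx]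

theorem contField_mfderiv_symm (he : e ∈ IsManifold.maximalAtlas (mdl n) ∞ M) :
    ContField n (fun q : Cn n × Cn n => e.symm q.1) (e.target ×ˢ univ)
      (fun q => mfderiv (mdl n) (mdl n) e.symm q.1 q.2) := by
  have h1 := (contMDiffOn_symm_of_mem_maximalAtlas he).continuousOn_tangentMapWithin (by simp)
    e.open_target.uniqueMDiffOn
  have h2 := h1.comp (g := tangentMapWithin (mdl n) (mdl n) e.symm e.target)
    (f := (tangentBundleModelSpaceHomeomorph (mdl n)).symm) (s := e.target ×ˢ univ)
    (Homeomorph.continuous _).continuousOn (fun q hq => hq.1)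
  refine ContinuousOn.congr h2 fun q hq => ?_
  simp only [Function.comp, tangentMapWithin]
  refine tangentBundle_mk_eq rfl ?_
  have h3 : mfderivWithin (mdl n) (mdl n) e.symm e.target q.1 = mfderiv (mdl n) (mdl n) e.symm q.1 :=
    mfderivWithin_of_mem_nhds (e.open_target.mem_nhds hq.1)
  exact (DFunLike.congr_fun h3 q.2).symm

theorem contField_chartFrame (he : e ∈ IsManifold.maximalAtlas (mdl n) ∞ M) :
    ContField n (fun q : M × Cn n => q.1) (e.source ×ˢ univ) (fun q => chartFrame e q.1 q.2) := by
  have h1 := (contField_mfderiv_symm he).comp (g := fun q : M × Cn n => (e q.1, q.2))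
    (t := e.source ×ˢ univ) ((e.continuousOn.comp continuousOn_fst fun q hq => hq.1).prodMk
      continuousOn_snd) (fun q hq => ⟨e.map_source hq.1, mem_univ _⟩)
  exact h1.congr (fun q hq => (e.left_inv hq.1).symm) (fun q hq => rfl)

theorem ContField.chartFrame (he : e ∈ IsManifold.maximalAtlas (mdl n) ∞ M)
    (hf : ContinuousOn f s) (hfs : MapsTo f s e.source) {v : X → Cn n} (hv : ContinuousOn v s) :
    ContField n f s (fun x => LagBlowUp.chartFrame e (f x) (v x)) :=
  (contField_chartFrame he).comp (g := fun x => (f x, v x)) (hf.prodMk hv)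
    (fun x hx => ⟨hfs hx, mem_univ _⟩)

theorem ContField.mfderiv_chart (he : e ∈ IsManifold.maximalAtlas (mdl n) ∞ M)
    (hfs : MapsTo f s e.source) {a : ∀ x, TangentSpace (mdl n) (f x)} (ha : ContField n f s a) :
    ContinuousOn (fun x => (mfderiv (mdl n) (mdl n) e (f x) (a x) : Cn n)) s := by
  have h1 := (contMDiffOn_of_mem_maximalAtlas he).continuousOn_tangentMapWithin (by simp)
    e.open_source.uniqueMDiffOn
  have h2 := h1.comp ha (fun x hx => hfs hx)
  have h3 := (continuous_snd.comp
    (tangentBundleModelSpaceHomeomorph (mdl n)).continuous).comp_continuousOn h2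
  refine ContinuousOn.congr h3 fun x hx => ?_
  change _ = mfderivWithin (mdl n) (mdl n) e e.source (f x) (a x)
  rw [mfderivWithin_of_mem_nhds (e.open_source.mem_nhds (hfs hx))]

theorem mfderiv_apply_congr {M' : Type*} [TopologicalSpace M'] [ChartedSpace (Cn n) M'] {E : Type*}
    [NormedAddCommGroup E] [NormedSpace ℝ E] (g : E → M') {x y : E} (h : x = y) (v : E) :
    (mfderiv 𝓘(ℝ, E) (mdl n) g x v : Cn n) = mfderiv 𝓘(ℝ, E) (mdl n) g y v := by
  subst h; rfl

theorem mfderiv_apply_congr_point {N : Type*} [TopologicalSpace N] [ChartedSpace (Cn n) N]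
    (g : M → N) {x y : M} (h : x = y) (v : Cn n) :
    (mfderiv (mdl n) (mdl n) g x v : Cn n) = mfderiv (mdl n) (mdl n) g y v := by
  subst h; rfl

/-- A smooth curve through `y` with bounded image, following the direction `w`. -/
theorem exists_bounded_curve {E : Type*} [NormedAddCommGroup E] [NormedSpace ℝ E] (y w : E) {ε : ℝ}
    (hε : 0 < ε) : ∃ φ : ℝ → ℝ, ContDiff ℝ ∞ φ ∧ φ 0 = 0 ∧ HasDerivAt φ 1 0 ∧
      ∀ t, y + φ t • w ∈ Metric.ball y ε := by
  -- The reparametrization `a sin (t / a)` has speed `1` at `0` and is bounded by `a`, and `a ‖w‖ <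
  -- ε`. A globally defined curve is needed because `tangentTo` uses curves on all of `ℝ`.
  let a : ℝ := ε / (2 * (‖w‖ + 1))
  have ha : 0 < a := by positivity
  refine ⟨fun t => a * Real.sin (t / a), by fun_prop, by simp, ?_, fun t => ?_⟩
  · have h1 : HasDerivAt (fun t : ℝ => t / a) (1 / a) 0 := (hasDerivAt_id _).div_const a
    have h2 := (h1.sin).const_mul a
    have h3 : a * (Real.cos (0 / a) * (1 / a)) = 1 := by
      rw [zero_div, Real.cos_zero]; field_simp
    rwa [h3] at h2
  · rw [mem_ball_iff_norm, add_sub_cancel_left, norm_smul, norm_mul, Real.norm_of_nonneg ha.le]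
    have h1 : ‖Real.sin (t / a)‖ ≤ 1 := Real.abs_sin_le_one _
    have h3 : a * ‖Real.sin (t / a)‖ * ‖w‖ ≤ a * 1 * ‖w‖ := by gcongr
    have h2 : a * (‖w‖ + 1) = ε / 2 := by simp only [a]; field_simp
    nlinarith

/-- The tangent space of a slice. -/
theorem mem_tangentTo_iff {L : Set M} (he : e ∈ IsManifold.maximalAtlas (mdl n) ∞ M)
    (hL : ∀ y ∈ e.source, y ∈ L ↔ ∀ i, (e y i).im = 0) {x : M} (hx : x ∈ e.source) (hxL : x ∈ L)
    (v : TangentSpace (mdl n) x) :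
    (⟨x, v⟩ : TangentBundle (mdl n) M) ∈ tangentTo n L ↔
      ∀ i, imCoord i (mfderiv (mdl n) (mdl n) e x v) = 0 := by
  have hed := mdifferentiable_of_mem_maximalAtlas he
  constructor
  · rintro ⟨γ, hγ, hγL, hp⟩ i
    have h0 : x = γ 0 := congrArg Bundle.TotalSpace.proj hp
    subst h0
    have h1 : v = mfderiv 𝓘(ℝ, ℝ) (mdl n) γ 0 (1 : ℝ) := snd_eq_of_tangentBundle_eq hp
    have hγd : MDifferentiableAt 𝓘(ℝ, ℝ) (mdl n) γ 0 := hγ.mdifferentiableAt (by simp)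
    have h2 : HasMFDerivAt 𝓘(ℝ, ℝ) (mdl n) (e ∘ γ) 0 _ :=
      (hed.mdifferentiableAt hx).hasMFDerivAt.comp 0 hγd.hasMFDerivAt
    have h3 : HasFDerivAt (e ∘ γ) _ (0 : ℝ) := hasMFDerivAt_iff_hasFDerivAt.1 h2
    have h4 := (imCoord i).hasFDerivAt.comp (0 : ℝ) h3
    -- Near `0` the curve lies in the slice, so the imaginary parts of its coordinates vanish and so
    -- do their derivatives.
    have h5 : (imCoord i) ∘ (e ∘ γ) =ᶠ[𝓝 0] fun _ => (0 : ℝ) := by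
      have : ∀ᶠ t in 𝓝 (0 : ℝ), γ t ∈ e.source :=
        hγ.continuous.continuousAt (e.open_source.mem_nhds hx)
      filter_upwards [this] with t ht
      exact (hL _ ht).1 (hγL t) i
    have h6 := (h4.congr_of_eventuallyEq h5.symm).unique (hasFDerivAt_const (0 : ℝ) (0 : ℝ))
    have h7 := DFunLike.congr_fun h6 (1 : ℝ)
    rw [h1]
    exact h7
  · intro hv
    let w : Cn n := mfderiv (mdl n) (mdl n) e x v
    obtain ⟨ε, hε, hball⟩ := Metric.mem_nhds_iff.1 (e.open_target.mem_nhds (e.map_source hx))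
    obtain ⟨φ, hφ, hφ0, hφ1, hφb⟩ := exists_bounded_curve (e x) w hε
    let c : ℝ → Cn n := fun t => e x + φ t • w
    have hc : ContDiff ℝ ∞ c := contDiff_const.add (hφ.smul contDiff_const)
    have hct : ∀ t, c t ∈ e.target := fun t => hball (hφb t)
    have hc0 : c 0 = e x := by simp [c, hφ0]
    have hcd : HasFDerivAt c (ContinuousLinearMap.toSpanSingleton ℝ w) 0 := by
      have := (hφ1.smul_const w).const_add (e x)
      rw [one_smul] at this
      exact this.hasFDerivAt
    refine ⟨fun t => e.symm (c t), ?_, fun t => ?_, ?_⟩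
    · exact (contMDiffOn_symm_of_mem_maximalAtlas he).comp_contMDiff hc.contMDiff hct
    · refine (hL _ (e.map_target (hct t))).2 fun i => ?_
      rw [e.right_inv (hct t)]
      have h1 := (hL x hx).1 hxL i
      have h2 : (w i).im = 0 := hv i
      change ((e x i + (φ t) • (w i))).im = 0
      rw [Complex.add_im, Complex.smul_im, h1]
      change _ + φ t • (w i).im = 0
      rw [h2]; simp
    · refine tangentBundle_mk_eq ?_ ?_
      · simp only [hc0, e.left_inv hx]
      · have h1 : HasMFDerivAt 𝓘(ℝ, ℝ) (mdl n) (e.symm ∘ c) 0 _ :=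
          (hed.mdifferentiableAt_symm (hct 0)).hasMFDerivAt.comp 0 hcd.hasMFDerivAt
        have h2 := DFunLike.congr_fun h1.mfderiv (1 : ℝ)
        refine Eq.trans ?_ h2.symm
        change v = mfderiv (mdl n) (mdl n) e.symm (c 0)
          (ContinuousLinearMap.toSpanSingleton ℝ w (1 : ℝ))
        rw [ContinuousLinearMap.toSpanSingleton_apply, one_smul]
        refine Eq.trans ?_ (mfderiv_apply_congr e.symm hc0 w).symm
        exact (chartFrame_mfderiv he hx v).symm

end manifold
end LagBlowUp

namespace LagBlowUp

/-! ### The Maslov index in a unitary trivialization -/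

section manifold
variable {n : ℕ} {M : Type*} [TopologicalSpace M] [ChartedSpace (Cn n) M] [IsManifold (mdl n) ∞ M]
  {Ω : SymplecticForm n M} {J : AlmostComplex n M} {L : Set M} {u : ℂ → M}
  {Φ : ∀ z : ℂ, Cn n →L[ℝ] TangentSpace (mdl n) (u z)}
  {U : ℝ → Matrix (Fin n) (Fin n) ℂ}
open Matrix

theorem toC_single (j : Fin n) : toC (Pi.single j 1) = Pi.single j 1 := by
  ext k
  by_cases hk : k = j
  · subst hk; simp [toC]
  · simp [toC, hk]

/-- In the trivialization `Φ` the tangent spaces of `L` along the boundary of the disk `u` are the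
subspaces `U_t ℝⁿ`, and they depend continuously on `t`. -/
structure IsLagrangianLoop (L : Set M) (u : ℂ → M)
    (Φ : ∀ z : ℂ, Cn n →L[ℝ] TangentSpace (mdl n) (u z)) (U : ℝ → Matrix (Fin n) (Fin n) ℂ) :
    Prop where
  unitary (t : ℝ) : U t ∈ unitaryGroup (Fin n) ℂ
  mem_iff (t : ℝ) (v : Cn n) :
    (⟨u (Complex.exp (t * Complex.I)), Φ (Complex.exp (t * Complex.I)) v⟩ :
      TangentBundle (mdl n) M) ∈ tangentTo n L ↔ ∃ x : Fin n → ℝ, v.ofLp = (U t) *ᵥ toC x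
  continuous : Continuous fun t => U t * (U t)ᵀ

/-- The parameters `0` and `2π` give the same point and the same subspace, but possibly different
unitary frames; `U Uᵀ` depends only on the subspace. -/
theorem IsLagrangianLoop.periodic (h : IsLagrangianLoop L u Φ U) :
    U (2 * Real.pi) * (U (2 * Real.pi))ᵀ = U 0 * (U 0)ᵀ := by
  have hd := det_ne_zero_of_mem_unitaryGroup (h.unitary 0)
  have h0 : ∀ x : Fin n → ℝ, ∃ y : Fin n → ℝ, U 0 *ᵥ toC x = U (2 * Real.pi) *ᵥ toC y := by
    intro x
    have h1 := (h.mem_iff 0 (WithLp.toLp 2 (U 0 *ᵥ toC x))).2 ⟨x, rfl⟩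
    have h2 := h.mem_iff (2 * Real.pi) (WithLp.toLp 2 (U 0 *ᵥ toC x))
    rw [exp_two_pi_mul_I] at h2
    exact h2.1 h1
  have hcol : ∀ j, ∃ x : Fin n → ℝ, (U 0)ᵀ j = U 0 *ᵥ toC x := fun j => by
    refine ⟨Pi.single j 1, ?_⟩
    rw [toC_single, mulVec_single_one]; rfl
  rw [mul_transpose_eq_of_frame (h.unitary 0) hd hcol,
    mul_transpose_eq_of_frame (h.unitary _) hd fun j => ?_]
  obtain ⟨x, hx⟩ := hcol j
  rw [hx]
  exact h0 x

theorem IsLagrangianLoop.exists_winding (h : IsLagrangianLoop L u Φ U) :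
    ∃ m, HasWindingNumber (fun t => (U t).det ^ 2) m := by
  refine exists_hasWindingNumber ?_ (fun t _ =>
    pow_ne_zero _ (det_ne_zero_of_mem_unitaryGroup (h.unitary t))) ?_
  · simp only [← det_mul_transpose]
    exact h.continuous.matrix_det.continuousOn
  · simp only [← det_mul_transpose, h.periodic]

/-- The Maslov index can be computed in any unitary trivialization. -/
theorem IsLagrangianLoop.hasMaslovIndex_iff (h : IsLagrangianLoop L u Φ U)
    (hΦ : IsUnitaryTriv Ω J u disk Φ) (m : ℤ) :
    HasMaslovIndex Ω L u m ↔ HasWindingNumber (fun t => (U t).det ^ 2) m := by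
  constructor
  · rintro ⟨Ψ, hΨ, V, hV, hm⟩
    obtain ⟨m₀, hm₀⟩ := h.exists_winding
    -- The change from the given symplectic trivialization `Ψ` to the unitary one; it is a family of
    -- symplectic maps over the whole disk.
    let B : ℂ → (Cn n →L[ℝ] Cn n) := fun z =>
      (frameCoord (Ω.form (u z)) (J.J (u z)) (Φ z)).comp (Ψ z)
    have hΦB : ∀ z ∈ disk, ∀ v, Φ z (B z v) = Ψ z v := fun z hz v =>
      (hΦ.frame z hz).frame_frameCoord (finrank_tangentSpace _) _
    have hBc : ∀ v, ContinuousOn (fun z => B z v) disk := by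
      intro v
      refine hΦ.continuousOn_frameCoord ?_
      exact hΨ.continuous.comp (f := fun z : ℂ => (z, v)) (by fun_prop)
        (fun z hz => ⟨hz, mem_univ _⟩)
    have hBs : ∀ z ∈ disk, IsSymplecticMap (B z) := by
      intro z hz v w
      rw [← (hΦ.frame z hz).symplectic, hΦB z hz, hΦB z hz, hΨ.symplectic z hz]
    have := winding_det_sq_unique hBc hBs (fun t => (hV t).1) h.unitary h.continuous h.periodic
      (fun t x => ?_) hm hm₀
    · rwa [this]
    · rw [← h.mem_iff, hΦB _ (exp_mul_I_mem_disk t), (hV t).2]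
      exact ⟨x, rfl⟩
  · intro hm
    exact ⟨Φ, hΦ.isSymplecticTrivialization, U, fun t => ⟨h.unitary t, h.mem_iff t⟩, hm⟩

theorem IsLagrangianLoop.existsUnique (h : IsLagrangianLoop L u Φ U)
    (hΦ : IsUnitaryTriv Ω J u disk Φ) : ∃! m, HasMaslovIndex Ω L u m := by
  obtain ⟨m, hm⟩ := h.exists_winding
  exact ⟨m, (h.hasMaslovIndex_iff hΦ m).2 hm, fun k hk =>
    ((h.hasMaslovIndex_iff hΦ k).1 hk).unique hm⟩

/-- The matrix of a family of `n` tangent vectors in unitary coordinates. -/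
def chartMatrix (Ω : SymplecticForm n M) (J : AlmostComplex n M) (x : M)
    (Φ : Cn n →L[ℝ] TangentSpace (mdl n) x) (e : OpenPartialHomeomorph M (Cn n)) :
    Matrix (Fin n) (Fin n) ℂ :=
  of fun i k => frameCoord (Ω.form x) (J.J x) Φ (chartFrame e x (EuclideanSpace.single k 1)) i

theorem chartMatrix_mulVec_toC (x : M) (Φ : Cn n →L[ℝ] TangentSpace (mdl n) x)
    (e : OpenPartialHomeomorph M (Cn n)) (y : Fin n → ℝ) :
    chartMatrix Ω J x Φ e *ᵥ toC y =
      (frameCoord (Ω.form x) (J.J x) Φ (chartFrame e x (WithLp.toLp 2 (toC y)))).ofLp := by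
  have h : WithLp.toLp 2 (toC y) = ∑ k, y k • EuclideanSpace.single k (1 : ℂ) := by
    conv_lhs => rw [eq_sum_single (WithLp.toLp 2 (toC y))]
    simp
  rw [h]
  ext i
  simp only [map_sum, map_smul, WithLp.ofLp_sum, WithLp.ofLp_smul, Finset.sum_apply, Pi.smul_apply,
    mulVec, dotProduct, chartMatrix, of_apply]
  refine Finset.sum_congr rfl fun k _ => ?_
  rw [Complex.real_smul, mul_comm]

/-- In a slice chart, the Lagrangian tangent space in unitary coordinates. -/
theorem chartMatrix_slice (hL : IsLagrangian Ω L) {e : OpenPartialHomeomorph M (Cn n)}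
    (he : e ∈ IsManifold.maximalAtlas (mdl n) ∞ M)
    (heL : ∀ y ∈ e.source, y ∈ L ↔ ∀ i, (e y i).im = 0) {x : M} (hx : x ∈ e.source) (hxL : x ∈ L)
    {Φ : Cn n →L[ℝ] TangentSpace (mdl n) x} (hΦ : IsUnitaryFrame (Ω.form x) (J.J x) Φ) :
    (∀ v, (⟨x, Φ v⟩ : TangentBundle (mdl n) M) ∈ tangentTo n L ↔
      ∃ y : Fin n → ℝ, v.ofLp = chartMatrix Ω J x Φ e *ᵥ toC y) ∧
    ∃ R : Matrix (Fin n) (Fin n) ℝ, R.det ≠ 0 ∧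
      chartMatrix Ω J x Φ e * matC R ∈ unitaryGroup (Fin n) ℂ := by
  have hfc := fun a => hΦ.frame_frameCoord (finrank_tangentSpace x) a
  have hiff : ∀ v : TangentSpace (mdl n) x, (⟨x, v⟩ : TangentBundle (mdl n) M) ∈ tangentTo n L ↔
      ∃ y : Fin n → ℝ, v = chartFrame e x (WithLp.toLp 2 (toC y)) := by
    intro v
    rw [mem_tangentTo_iff he heL hx hxL]
    constructor
    · intro h
      refine ⟨fun i => reCoord i (mfderiv (mdl n) (mdl n) e x v), ?_⟩
      rw [← chartFrame_mfderiv he hx v]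
      congr 1
      rw [chartFrame_mfderiv he hx v]
      refine PiLp.ext fun i => Complex.ext ?_ ?_
      · rfl
      · exact (h i).trans (by simp)
    · rintro ⟨y, rfl⟩ i
      rw [mfderiv_chartFrame he hx]
      simp
  refine ⟨fun v => ?_, exists_real_mul_mem_unitaryGroup (fun j k => ?_) fun y hy => ?_⟩
  · rw [hiff]
    refine exists_congr fun y => ?_
    rw [chartMatrix_mulVec_toC]
    constructor
    · intro h
      rw [← h, hΦ.frameCoord_frame]
    · intro h
      have h1 : v = _ := WithLp.ofLp_injective 2 h
      rw [h1, hfc]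
  · have htan : ∀ k, (⟨x, chartFrame e x (EuclideanSpace.single k 1)⟩ : TangentBundle (mdl n) M) ∈
        tangentTo n L := fun k => by
      rw [hiff]
      refine ⟨Pi.single k 1, ?_⟩
      congr 1
      rw [toC_single]; rfl
    have h1 := hL.isotropic x _ _ (htan j) (htan k)
    rw [← hfc (chartFrame e x (EuclideanSpace.single j 1)),
      ← hfc (chartFrame e x (EuclideanSpace.single k 1)), hΦ.symplectic, stdForm_eq_im] at h1
    rw [← h1]
    simp [mul_apply, dotProduct, chartMatrix]
  · rw [chartMatrix_mulVec_toC] at hy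
    have h1 : frameCoord (Ω.form x) (J.J x) Φ (chartFrame e x (WithLp.toLp 2 (toC y))) = 0 :=
      WithLp.ofLp_injective 2 hy
    have h2 := hfc (chartFrame e x (WithLp.toLp 2 (toC y)))
    rw [h1, map_zero] at h2
    have h3 := mfderiv_chartFrame he hx (WithLp.toLp 2 (toC y))
    rw [← h2, map_zero] at h3
    ext i
    have h4 : ((0 : Cn n) i).re = ((y i : ℝ) : ℂ).re := congrArg (fun v : Cn n => (v i).re) h3
    simpa using h4.symm

theorem continuousOn_chartMatrix {X : Type*} [TopologicalSpace X] {f : X → M} {s : Set X}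
    {Φ : ∀ x, Cn n →L[ℝ] TangentSpace (mdl n) (f x)} (hΦ : IsUnitaryTriv Ω J f s Φ)
    {e : OpenPartialHomeomorph M (Cn n)} (he : e ∈ IsManifold.maximalAtlas (mdl n) ∞ M)
    (hf : ContinuousOn f s) (hfs : MapsTo f s e.source) :
    ContinuousOn (fun x => chartMatrix Ω J (f x) (Φ x) e) s := by
  refine continuousOn_pi.2 fun i => continuousOn_pi.2 fun k => ?_
  exact (contDiff_coord i).continuous.comp_continuousOn (hΦ.continuousOn_frameCoord
    (ContField.chartFrame he hf hfs continuousOn_const))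

/-- Serves to show that the invariant `X X̄⁻¹` of a Lagrangian subspace varies continuously with a
real frame `X`. -/
theorem continuousAt_mul_inv_cj {X : Type*} [TopologicalSpace X] {x : X}
    {A : X → Matrix (Fin n) (Fin n) ℂ} (hA : ContinuousAt A x) (h0 : (A x).det ≠ 0) :
    ContinuousAt (fun x => A x * (cj (A x))⁻¹) x := by
  have hc : ContinuousAt (fun x => cj (A x)) x :=
    (Continuous.matrix_map continuous_id Complex.continuous_conj).continuousAt.comp hA
  have hdet : (cj (A x)).det ≠ 0 := by
    have : (cj (A x)).det = starRingEnd ℂ (A x).det := (RingHom.map_det _ _).symm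
    rw [this]
    simpa using h0
  have hdc : ContinuousAt (fun x => (cj (A x)).det) x :=
    (Continuous.matrix_det continuous_id).continuousAt.comp hc
  have hadj : ContinuousAt (fun x => (cj (A x)).adjugate) x :=
    (Continuous.matrix_adjugate continuous_id).continuousAt.comp hc
  have hinv : ContinuousAt (fun x => (cj (A x))⁻¹) x := by
    simp only [inv_def, Ring.inverse_eq_inv']
    exact (hdc.inv₀ hdet).smul hadj
  have hmul : Continuous fun p : Matrix (Fin n) (Fin n) ℂ × Matrix (Fin n) (Fin n) ℂ => p.1 * p.2 :=
    continuous_fst.matrix_mul continuous_snd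
  exact hmul.continuousAt.comp (hA.prodMk hinv)

/-- The boundary of a disk on a Lagrangian submanifold gives a loop of Lagrangian subspaces. -/
theorem exists_isLagrangianLoop (hL : IsLagrangian Ω L) (hΦ : IsUnitaryTriv Ω J u disk Φ)
    (hu : ContinuousOn u disk) (hb : ∀ z ∈ Metric.sphere (0 : ℂ) 1, u z ∈ L) :
    ∃ U, IsLagrangianLoop L u Φ U := by
  let E : ℝ → ℂ := fun t => Complex.exp (t * Complex.I)
  have huE : Continuous fun t => u (E t) := hu.comp_continuous continuous_exp_mul_I exp_mul_I_mem_disk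
  have hxL : ∀ t, u (E t) ∈ L := fun t => hb _ (exp_mul_I_mem_sphere t)
  choose e he hxe heL using fun t => hL.slice (u (E t)) (hxL t)
  have hfr : ∀ t, IsUnitaryFrame (Ω.form (u (E t))) (J.J (u (E t))) (Φ (E t)) := fun t =>
    hΦ.frame _ (exp_mul_I_mem_disk t)
  let X (s t : ℝ) : Matrix (Fin n) (Fin n) ℂ := chartMatrix Ω J (u (E t)) (Φ (E t)) (e s)
  have hslice := fun s t (h : u (E t) ∈ (e s).source) =>
    chartMatrix_slice hL (he s) (heL s) h (hxL t) (hfr t)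
  -- The frames are chosen independently for each `t`, using the slice chart at that very point, and
  -- need not depend continuously on `t`.
  choose R hR hU using fun t => (hslice t t (hxe t)).2
  have hmem : ∀ t v, (⟨u (E t), Φ (E t) v⟩ : TangentBundle (mdl n) M) ∈ tangentTo n L ↔
      ∃ x : Fin n → ℝ, v.ofLp = (X t t * matC (R t)) *ᵥ toC x := by
    intro t v
    rw [(hslice t t (hxe t)).1]
    have hreal : ∀ (A : Matrix (Fin n) (Fin n) ℝ) (x : Fin n → ℝ), matC A *ᵥ toC x = toC (A *ᵥ x) := by
      intro A x; ext i; simp [mulVec, dotProduct, toC]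
    constructor
    · rintro ⟨y, hy⟩
      refine ⟨(R t)⁻¹ *ᵥ y, ?_⟩
      rw [← mulVec_mulVec, hreal, mulVec_mulVec, mul_nonsing_inv _ (hR t).isUnit, one_mulVec, hy]
    · rintro ⟨x, hx⟩
      refine ⟨R t *ᵥ x, ?_⟩
      rw [hx, ← mulVec_mulVec, hreal]
  refine ⟨fun t => X t t * matC (R t), hU, hmem, ?_⟩
  -- Near `t₀` the product `U Uᵀ` is computed instead from the frame of the single slice chart at
  -- `t₀`, which is continuous in `t`.
  rw [continuous_iff_continuousAt]
  intro t₀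
  let T : Set ℝ := (fun t => u (E t)) ⁻¹' (e t₀).source
  have hT : IsOpen T := (e t₀).open_source.preimage huE
  have hdet : ∀ t ∈ T, (X t₀ t).det ≠ 0 := by
    intro t ht
    obtain ⟨R', -, hR'⟩ := (hslice t₀ t ht).2
    have := det_ne_zero_of_mem_unitaryGroup hR'
    rw [det_mul] at this
    exact left_ne_zero_of_mul this
  have hXc : ContinuousOn (X t₀) T := by
    have hΦE : IsUnitaryTriv Ω J (fun t => u (E t)) T (fun t => Φ (E t)) :=
      hΦ.comp continuous_exp_mul_I.continuousOn (fun t _ => exp_mul_I_mem_disk t)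
    exact continuousOn_chartMatrix hΦE (he t₀) huE.continuousOn (fun t ht => ht)
  have h1 := continuousAt_mul_inv_cj (hXc.continuousAt (hT.mem_nhds (hxe t₀))) (hdet t₀ (hxe t₀))
  refine h1.congr ?_
  filter_upwards [hT.mem_nhds (hxe t₀)] with t ht
  refine (mul_transpose_eq_of_frame (hU t) (hdet t ht) fun j => ?_).symm
  have h2 := (hmem t (WithLp.toLp 2 ((X t₀ t)ᵀ j))).1 (((hslice t₀ t ht).1 _).2 ⟨Pi.single j 1, ?_⟩)
  · exact h2
  · rw [toC_single, mulVec_single_one]; rfl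

end manifold
end LagBlowUp

namespace LagBlowUp

/-! ### The smooth structure of the blow-up -/

section manifold
variable {n : ℕ} {M : Type*} [TopologicalSpace M] [ChartedSpace (Cn n) M] [IsManifold (mdl n) ∞ M]
  [T1Space M] (b : BallEmbedding n M)

namespace BlowUp

/-- The `j`-th standard chart of `L(r)`. -/
def excHomeo (j : Fin n) : OpenPartialHomeomorph (BlowUp b) (Cn n) :=
  (core b).openPartialHomeomorph (excChart b j) (IsChart.exc j)

/-- The chart of the blow-up induced by the preferred chart of `M` at `x ≠ x₀`. -/
def offHomeo (x : M) (hx : x ≠ b.center) : OpenPartialHomeomorph (BlowUp b) (Cn n) :=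
  (core b).openPartialHomeomorph (offChart b x hx) (IsChart.off x hx)

theorem excHomeo_mem (j : Fin n) :
    excHomeo b j ∈ IsManifold.maximalAtlas (mdl n) ∞ (BlowUp b) :=
  IsManifold.subset_maximalAtlas (mem_iUnion₂.2 ⟨excChart b j, IsChart.exc j, rfl⟩)

theorem offHomeo_mem (x : M) (hx : x ≠ b.center) :
    offHomeo b x hx ∈ IsManifold.maximalAtlas (mdl n) ∞ (BlowUp b) :=
  IsManifold.subset_maximalAtlas (mem_iUnion₂.2 ⟨offChart b x hx, IsChart.off x hx, rfl⟩)

variable {b}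

theorem mem_excHomeo_source {j : Fin n} {p : BlowUp b} :
    p ∈ (excHomeo b j).source ↔ excSource b j p := Iff.rfl

theorem mem_excHomeo_target {j : Fin n} {y : Cn n} :
    y ∈ (excHomeo b j).target ↔ blowDown j y ∈ b.chart.target := by
  rw [b.target_eq]; rfl

theorem excHomeo_apply (j : Fin n) (p : BlowUp b) : excHomeo b j p = excFun b j p := rfl

/-- The `j`-th component of the `j`-th chart. -/
theorem excHomeo_apply_self (j : Fin n) (p : BlowUp b) :
    excHomeo b j p j = b.chart (proj b p) j := by
  rw [excHomeo_apply]
  cases p with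
  | off x hx => simp [excFun, blowCoord, proj]
  | exc l => simp [excFun, excCoord, proj, chart_center]

theorem blowDown_excHomeo {j : Fin n} {p : BlowUp b} (hp : p ∈ (excHomeo b j).source) :
    blowDown j (excHomeo b j p) = b.chart (proj b p) := by
  rw [mem_excHomeo_source] at hp
  rw [excHomeo_apply]
  cases p with
  | off x hx => exact blowDown_blowCoord j hp.2
  | exc l =>
    simp only [excFun, proj, chart_center]
    rw [blowDown_eq_zero]
    simp [excCoord]

theorem proj_mem_source {j : Fin n} {p : BlowUp b} (hp : p ∈ (excHomeo b j).source) :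
    proj b p ∈ b.chart.source := by
  rw [mem_excHomeo_source] at hp
  cases p with
  | off x hx => exact hp.1
  | exc l => exact center_mem_source

theorem proj_eq_emb {j : Fin n} {p : BlowUp b} (hp : p ∈ (excHomeo b j).source) :
    proj b p = b.chart.symm (blowDown j (excHomeo b j p)) := by
  rw [blowDown_excHomeo hp, b.chart.left_inv (proj_mem_source hp)]

theorem mem_excDivisor_iff_of_source {j : Fin n} {p : BlowUp b} (hp : p ∈ (excHomeo b j).source) :
    p ∈ excDivisor b ↔ excHomeo b j p j = 0 := by
  rw [← blowDown_eq_zero, blowDown_excHomeo hp]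
  have := chart_ne_zero (proj_mem_source hp)
  exact not_iff_not.1 this.symm

theorem exists_excHomeo_source {p : BlowUp b} (hp : proj b p ∈ b.chart.source) :
    ∃ j, p ∈ (excHomeo b j).source := by
  cases p with
  | off x hx =>
    have h0 := (chart_ne_zero hp).2 hx
    by_contra hcon
    push Not at hcon
    apply h0
    ext j
    by_contra hj
    exact hcon j ⟨hp, hj⟩
  | exc l => exact exists_rep_ne_zero l

/-- In a standard chart of `L(r)` the map is the polynomial `blowDown` followed by the embedding of
the ball; in the charts away from `x₀` it is the identity. -/
theorem contMDiff_proj : ContMDiff (mdl n) (mdl n) ∞ (proj b) := by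
  intro p
  by_cases hp : proj b p ∈ b.chart.source
  · obtain ⟨j, hj⟩ := exists_excHomeo_source hp
    have h1 : ContMDiffOn (mdl n) (mdl n) ∞
        (fun q => b.chart.symm (blowDown j (excHomeo b j q))) (excHomeo b j).source :=
      (contMDiffOn_symm_of_mem_maximalAtlas b.chart_mem).comp
        ((contDiff_blowDown j).contMDiff.comp_contMDiffOn
          (contMDiffOn_of_mem_maximalAtlas (excHomeo_mem b j)))
        (fun q hq => mem_excHomeo_target.1 ((excHomeo b j).map_source hq))
    exact (h1.congr fun q hq => proj_eq_emb hq).contMDiffAt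
      ((excHomeo b j).open_source.mem_nhds hj)
  · have hx : proj b p ≠ b.center := fun h => hp (h ▸ center_mem_source)
    have hps : p ∈ (offHomeo b _ hx).source := ⟨hx, mem_chart_source (Cn n) _⟩
    have h1 : ContMDiffOn (mdl n) (mdl n) ∞
        (fun q => (chartAt (Cn n) (proj b p)).symm (offHomeo b _ hx q)) (offHomeo b _ hx).source :=
      (contMDiffOn_symm_of_mem_maximalAtlas (IsManifold.chart_mem_maximalAtlas (proj b p))).comp
        (contMDiffOn_of_mem_maximalAtlas (offHomeo_mem b _ hx))
        (fun q hq => ((offHomeo b _ hx).map_source hq).1)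
    refine (h1.congr fun q hq => ?_).contMDiffAt ((offHomeo b _ hx).open_source.mem_nhds hps)
    exact ((chartAt (Cn n) (proj b p)).left_inv hq.2).symm

theorem isClosed_excDivisor : IsClosed (excDivisor b) :=
  isClosed_singleton.preimage contMDiff_proj.continuous

theorem pointOver_proj (p₀ : BlowUp b) {p : BlowUp b} (hp : p ∉ excDivisor b) :
    pointOver p₀ (proj b p) = p := by
  rw [pointOver_of_ne p₀ hp]
  cases p with
  | off x hx => rfl
  | exc l => exact absurd rfl hp

theorem proj_pointOver (p₀ : BlowUp b) {x : M} (hx : x ≠ b.center) :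
    proj b (pointOver p₀ x) = x := by
  rw [pointOver_of_ne p₀ hx]; rfl

theorem contMDiffAt_pointOver (p₀ : BlowUp b) {x : M} (hx : x ≠ b.center) :
    ContMDiffAt (mdl n) (mdl n) ∞ (pointOver p₀) x := by
  have hs : IsOpen ((chartAt (Cn n) x).source ∩ {b.center}ᶜ) :=
    (chartAt (Cn n) x).open_source.inter isOpen_compl_singleton
  have h1 : ContMDiffOn (mdl n) (mdl n) ∞
      (fun y => (offHomeo b x hx).symm (chartAt (Cn n) x y))
      ((chartAt (Cn n) x).source ∩ {b.center}ᶜ) := by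
    refine (contMDiffOn_symm_of_mem_maximalAtlas (offHomeo_mem b x hx)).comp
      ((contMDiffOn_of_mem_maximalAtlas (IsManifold.chart_mem_maximalAtlas x)).mono
        inter_subset_left) ?_
    rintro y ⟨hy, hyc⟩
    refine ⟨(chartAt (Cn n) x).map_source hy, ?_⟩
    rw [(chartAt (Cn n) x).left_inv hy]; exact hyc
  refine (h1.congr ?_).contMDiffAt (hs.mem_nhds ⟨mem_chart_source (Cn n) x, hx⟩)
  rintro y ⟨hy, hyc⟩
  change _ = pointOver (off x hx) ((chartAt (Cn n) x).symm (chartAt (Cn n) x y))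
  rw [(chartAt (Cn n) x).left_inv hy, pointOver_of_ne _ hyc, pointOver_of_ne _ hyc]

/-- The derivative of the blow-up map. -/
abbrev dproj (p : BlowUp b) : TangentSpace (mdl n) p →L[ℝ] TangentSpace (mdl n) (proj b p) :=
  mfderiv (mdl n) (mdl n) (proj b) p

/-- Off the exceptional divisor `pointOver p₀` is a smooth local inverse of the blow-up map. -/
theorem mfderiv_pointOver_dproj (p₀ : BlowUp b) {p : BlowUp b} (hp : p ∉ excDivisor b)
    (v : TangentSpace (mdl n) p) :
    (mfderiv (mdl n) (mdl n) (pointOver p₀) (proj b p) (dproj p v) : Cn n) = v := by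
  have h1 : HasMFDerivAt (mdl n) (mdl n) (pointOver p₀ ∘ proj b) p _ :=
    ((contMDiffAt_pointOver p₀ hp).mdifferentiableAt (by simp)).hasMFDerivAt.comp p
      ((contMDiff_proj p).mdifferentiableAt (by simp)).hasMFDerivAt
  have h2 : pointOver p₀ ∘ proj b =ᶠ[𝓝 p] id := by
    filter_upwards [isClosed_excDivisor.isOpen_compl.mem_nhds hp] with q hq
    exact pointOver_proj p₀ hq
  have h3 := h2.mfderiv_eq (I := mdl n) (I' := mdl n)
  have h4 := h1.mfderiv.symm.trans h3
  rw [mfderiv_id] at h4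
  exact DFunLike.congr_fun h4 v

theorem dproj_injective {p : BlowUp b} (hp : p ∉ excDivisor b) : Function.Injective (dproj p) := by
  intro v w h
  have h1 := mfderiv_pointOver_dproj p hp v
  have h2 := mfderiv_pointOver_dproj p hp w
  rw [h] at h1
  exact h1.symm.trans h2

/-- Tangent vectors of the preimage of a set which does not contain the centre. -/
theorem mem_tangentTo_preimage_iff {L : Set M} (hL : b.center ∉ L) {p : BlowUp b}
    (hp : proj b p ∈ L) (v : TangentSpace (mdl n) p) :
    (⟨p, v⟩ : TangentBundle (mdl n) (BlowUp b)) ∈ tangentTo n (proj b ⁻¹' L) ↔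
      (⟨proj b p, dproj p v⟩ : TangentBundle (mdl n) M) ∈ tangentTo n L := by
  have hne : ∀ {x}, x ∈ L → x ≠ b.center := fun hx h => hL (h ▸ hx)
  constructor
  · rintro ⟨γ, hγ, hγL, hq⟩
    have h0 : p = γ 0 := congrArg Bundle.TotalSpace.proj hq
    subst h0
    have h1 : v = mfderiv 𝓘(ℝ, ℝ) (mdl n) γ 0 (1 : ℝ) := snd_eq_of_tangentBundle_eq hq
    refine ⟨proj b ∘ γ, contMDiff_proj.comp hγ, hγL, tangentBundle_mk_eq rfl ?_⟩
    have h2 : HasMFDerivAt 𝓘(ℝ, ℝ) (mdl n) (proj b ∘ γ) 0 _ :=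
      ((contMDiff_proj (γ 0)).mdifferentiableAt (by simp)).hasMFDerivAt.comp 0
        (hγ.mdifferentiableAt (by simp)).hasMFDerivAt
    rw [h2.mfderiv, h1]
    rfl
  · rintro ⟨γ, hγ, hγL, hq⟩
    have h0 : proj b p = γ 0 := congrArg Bundle.TotalSpace.proj hq
    have h1 : (dproj p v : Cn n) = mfderiv 𝓘(ℝ, ℝ) (mdl n) γ 0 (1 : ℝ) :=
      snd_eq_of_tangentBundle_eq hq
    have hpE : p ∉ excDivisor b := hne hp
    refine ⟨pointOver p ∘ γ, fun t => ?_, fun t => ?_, tangentBundle_mk_eq ?_ ?_⟩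
    · exact (contMDiffAt_pointOver p (hne (hγL t))).comp t (hγ t)
    · change proj b (pointOver p (γ t)) ∈ L
      rw [proj_pointOver p (hne (hγL t))]; exact hγL t
    · change p = pointOver p (γ 0)
      rw [← h0, pointOver_proj p hpE]
    · have h2 : HasMFDerivAt 𝓘(ℝ, ℝ) (mdl n) (pointOver p ∘ γ) 0 _ :=
        ((contMDiffAt_pointOver p (hne (hγL 0))).mdifferentiableAt (by simp)).hasMFDerivAt.comp 0
          (hγ.mdifferentiableAt (by simp)).hasMFDerivAt
      rw [h2.mfderiv]
      refine (mfderiv_pointOver_dproj p hpE v).symm.trans ?_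
      refine (mfderiv_apply_congr_point (pointOver p) h0 (dproj p v)).trans ?_
      exact congrArg (fun w : Cn n => (mfderiv (mdl n) (mdl n) (pointOver p) (γ 0) w : Cn n)) h1

/-- The blow-up map in the standard charts is `blowDown`. -/
theorem mfderiv_chart_dproj {j : Fin n} {p : BlowUp b} (hp : p ∈ (excHomeo b j).source)
    (v : TangentSpace (mdl n) p) :
    (mfderiv (mdl n) (mdl n) b.chart (proj b p) (dproj p v) : Cn n) =
      fderiv ℝ (blowDown j) (excHomeo b j p) (mfderiv (mdl n) (mdl n) (excHomeo b j) p v) := by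
  have h1 : HasMFDerivAt (mdl n) (mdl n) (b.chart ∘ proj b) p _ :=
    ((mdifferentiable_of_mem_maximalAtlas b.chart_mem).mdifferentiableAt
      (proj_mem_source hp)).hasMFDerivAt.comp p
      ((contMDiff_proj p).mdifferentiableAt (by simp)).hasMFDerivAt
  have h2 : HasMFDerivAt (mdl n) (mdl n) (blowDown j ∘ excHomeo b j) p _ :=
    (((contDiff_blowDown j).differentiable (by simp)) (excHomeo b j p)).hasFDerivAt.hasMFDerivAt.comp
      p ((mdifferentiable_of_mem_maximalAtlas (excHomeo_mem b j)).mdifferentiableAt hp).hasMFDerivAt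
  have h3 : b.chart ∘ proj b =ᶠ[𝓝 p] blowDown j ∘ excHomeo b j := by
    filter_upwards [(excHomeo b j).open_source.mem_nhds hp] with q hq
    exact (blowDown_excHomeo hq).symm
  have h4 := h3.mfderiv_eq (I := mdl n) (I' := mdl n)
  exact DFunLike.congr_fun (h1.mfderiv.symm.trans (h4.trans h2.mfderiv)) v

theorem dproj_chartFrame {j : Fin n} {p : BlowUp b} (hp : p ∈ (excHomeo b j).source) (w : Cn n) :
    dproj p (chartFrame (excHomeo b j) p w) =
      chartFrame b.chart (proj b p) (fderiv ℝ (blowDown j) (excHomeo b j p) w) := by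
  rw [← chartFrame_mfderiv b.chart_mem (proj_mem_source hp)
    (dproj p (chartFrame (excHomeo b j) p w))]
  congr 1
  refine (mfderiv_chart_dproj hp _).trans ?_
  congr 1
  exact mfderiv_chartFrame (excHomeo_mem b j) hp w

theorem contField_dproj {X : Type*} [TopologicalSpace X] {f : X → BlowUp b} {s : Set X}
    {a : ∀ x, TangentSpace (mdl n) (f x)} (ha : ContField n f s a) :
    ContField n (fun x => proj b (f x)) s (fun x => dproj (f x) (a x)) :=
  (contMDiff_proj.continuous_tangentMap (by simp)).comp_continuousOn ha

/-- The points off the exceptional divisor are dense in each standard chart. -/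
theorem mem_of_mem_off {j : Fin n} {c : BlowUp b → ℝ}
    (hc : ContinuousOn c (excHomeo b j).source) {S : Set ℝ} (hS : IsClosed S)
    (h0 : ∀ p ∈ (excHomeo b j).source, p ∉ excDivisor b → c p ∈ S) {p : BlowUp b}
    (hp : p ∈ (excHomeo b j).source) : c p ∈ S := by
  by_cases hpE : p ∉ excDivisor b
  · exact h0 p hp hpE
  rw [not_not] at hpE
  let e := excHomeo b j
  -- The point of `E` is approached along the `j`-th coordinate direction: the local equation of `E`
  -- takes the value `t` on this line.
  let γ : ℝ → Cn n := fun t => e p + t • EuclideanSpace.single j (1 : ℂ)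
  have hγ : Continuous γ := by fun_prop
  have hγ0 : γ 0 = e p := by simp [γ]
  have hγj : ∀ t, γ t j = t := fun t => by
    have := (mem_excDivisor_iff_of_source hp).1 hpE
    simp [γ, e, this]
  have htar : ∀ᶠ t in 𝓝 (0 : ℝ), γ t ∈ e.target :=
    hγ.continuousAt.eventually (by rw [hγ0]; exact e.open_target.mem_nhds (e.map_source hp))
  have hlim : Tendsto (fun t => c (e.symm (γ t))) (𝓝 0) (𝓝 (c p)) := by
    have h1 : ContinuousAt e.symm (γ 0) := by
      rw [hγ0]; exact e.continuousAt_symm (e.map_source hp)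
    have h2 : e.symm (γ 0) = p := by rw [hγ0, e.left_inv hp]
    have h3 : ContinuousAt c (e.symm (γ 0)) := by
      rw [h2]; exact hc.continuousAt (e.open_source.mem_nhds hp)
    have h4 : ContinuousAt (fun t => c (e.symm (γ t))) 0 :=
      ContinuousAt.comp (f := fun t => e.symm (γ t)) h3
        (ContinuousAt.comp (f := γ) h1 hγ.continuousAt)
    have := h4.tendsto
    rwa [h2] at this
  refine hS.mem_of_tendsto (hlim.mono_left (nhdsWithin_le_nhds (s := {0}ᶜ))) ?_
  filter_upwards [nhdsWithin_le_nhds htar, self_mem_nhdsWithin] with t ht ht0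
  refine h0 _ (e.map_target ht) ?_
  rw [mem_excDivisor_iff_of_source (e.map_target ht)]
  change e (e.symm (γ t)) j ≠ 0
  rw [e.right_inv ht, hγj]
  exact Complex.ofReal_ne_zero.2 ht0

end BlowUp
end manifold
end LagBlowUp

namespace LagBlowUp

/-! ### Compatibility of the forms and complex structures of the blow-up -/

section linear
variable {n : ℕ}

theorem stdForm_add_left (u v w : Cn n) : stdForm (u + v) w = stdForm u w + stdForm v w := by
  simp only [stdForm, ← Finset.sum_add_distrib]
  refine Finset.sum_congr rfl fun i _ => ?_
  simp; ring

theorem stdForm_smul_left (a : ℝ) (v w : Cn n) : stdForm (a • v) w = a * stdForm v w := by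
  simp only [stdForm, Finset.mul_sum]
  refine Finset.sum_congr rfl fun i _ => ?_
  simp; ring

theorem stdForm_antisymm (v w : Cn n) : stdForm v w = -stdForm w v := by
  simp only [stdForm, ← Finset.sum_neg_distrib]
  refine Finset.sum_congr rfl fun i _ => ?_
  ring

theorem stdForm_add_right (u v w : Cn n) : stdForm w (u + v) = stdForm w u + stdForm w v := by
  rw [stdForm_antisymm, stdForm_add_left, stdForm_antisymm u, stdForm_antisymm v]; ring

theorem stdForm_smul_right (a : ℝ) (v w : Cn n) : stdForm w (a • v) = a * stdForm w v := by
  rw [stdForm_antisymm, stdForm_smul_left, stdForm_antisymm v]; ring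

theorem stdForm_self (v : Cn n) : stdForm v v = 0 := by
  have := stdForm_antisymm v v; linarith

theorem stdForm_I_I (v w : Cn n) : stdForm (Complex.I • v) (Complex.I • w) = stdForm v w := by
  simp only [stdForm]
  refine Finset.sum_congr rfl fun i _ => ?_
  simp; ring

theorem I_smul_I_smul (v : Cn n) : Complex.I • Complex.I • v = -v := by
  rw [smul_smul, Complex.I_mul_I, neg_one_smul]

theorem stdForm_neg_right (v w : Cn n) : stdForm v (-w) = -stdForm v w := by
  rw [← neg_one_smul ℝ w, stdForm_smul_right]; ring

theorem stdForm_I_left (v w : Cn n) : stdForm (Complex.I • v) w = -stdForm v (Complex.I • w) := by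
  rw [← stdForm_I_I v, I_smul_I_smul, stdForm_neg_right, neg_neg]

theorem stdForm_I_smul_self (v : Cn n) : stdForm v (Complex.I • v) = ‖v‖ ^ 2 := by
  rw [stdForm_I_smul, EuclideanSpace.norm_sq_eq]
  refine Finset.sum_congr rfl fun i _ => ?_
  rw [Complex.sq_norm, Complex.normSq_apply]

/-- The Cauchy-Schwarz inequality. -/
theorem stdForm_sq_add_sq_le (z v : Cn n) :
    stdForm z v ^ 2 + stdForm z (Complex.I • v) ^ 2 ≤ ‖z‖ ^ 2 * ‖v‖ ^ 2 := by
  have h1 : stdForm z v = (inner ℂ z v).im := by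
    rw [EuclideanSpace.inner_eq_star_dotProduct, stdForm_eq_im, dotProduct_comm]
  have h2 : stdForm z (Complex.I • v) = (inner ℂ z v).re := by
    rw [EuclideanSpace.inner_eq_star_dotProduct, stdForm_eq_im, dotProduct_comm]
    simp
  have h3 := norm_inner_le_norm (𝕜 := ℂ) z v
  have h4 : ‖inner ℂ z v‖ ^ 2 ≤ (‖z‖ * ‖v‖) ^ 2 := by gcongr
  rw [Complex.sq_norm, Complex.normSq_apply] at h4
  rw [h1, h2]; nlinarith

/-- The derivative of `z ↦ β(|z|) z / |z|` is `radialDeriv` with `a = β / |z|` and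
`c = (β' |z| - β) / |z| ^ 3`. -/
def radialDeriv (a c : ℝ) (z v : Cn n) : Cn n := a • v + (c * stdForm z (Complex.I • v)) • z

theorem stdForm_radialDeriv (a c : ℝ) (z v w : Cn n) :
    stdForm (radialDeriv a c z v) (radialDeriv a c z w) = a ^ 2 * stdForm v w +
      a * c * (stdForm z (Complex.I • w) * stdForm v z + stdForm z (Complex.I • v) * stdForm z w) := by
  simp only [radialDeriv, stdForm_add_left, stdForm_add_right, stdForm_smul_left,
    stdForm_smul_right, stdForm_self]
  ring

theorem stdForm_radialDeriv_I_I (a c : ℝ) (z v w : Cn n) :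
    stdForm (radialDeriv a c z (Complex.I • v)) (radialDeriv a c z (Complex.I • w)) =
      stdForm (radialDeriv a c z v) (radialDeriv a c z w) := by
  rw [stdForm_radialDeriv, stdForm_radialDeriv, I_smul_I_smul, I_smul_I_smul, stdForm_I_I,
    stdForm_neg_right, stdForm_neg_right, stdForm_I_left, stdForm_antisymm v z,
    stdForm_antisymm v (Complex.I • z), stdForm_I_left]
  ring

theorem stdForm_radialDeriv_nonneg {s β β' : ℝ} (hs : 0 < s) (hβ : 0 < β) (hβ' : 0 ≤ β') {z : Cn n}
    (hz : ‖z‖ = s) (v : Cn n) :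
    0 ≤ stdForm (radialDeriv (β / s) ((β' * s - β) / s ^ 3) z v)
      (radialDeriv (β / s) ((β' * s - β) / s ^ 3) z (Complex.I • v)) := by
  rw [stdForm_radialDeriv, I_smul_I_smul, stdForm_neg_right, stdForm_I_smul_self,
    stdForm_antisymm v z]
  have h := stdForm_sq_add_sq_le z v
  rw [hz] at h
  -- The first term is the contribution of the part of `v` Hermitian-orthogonal to `z`, nonnegative
  -- by Cauchy-Schwarz; the second is that of the part in the complex line of `z`, weighted by `β
  -- β'`.
  have e : (β / s) ^ 2 * ‖v‖ ^ 2 + β / s * ((β' * s - β) / s ^ 3) *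
      (-stdForm z v * -stdForm z v + stdForm z (Complex.I • v) * stdForm z (Complex.I • v)) =
      β ^ 2 / s ^ 4 * (s ^ 2 * ‖v‖ ^ 2 - (stdForm z v ^ 2 + stdForm z (Complex.I • v) ^ 2)) +
      β * β' / s ^ 3 * (stdForm z v ^ 2 + stdForm z (Complex.I • v) ^ 2) := by
    field_simp
    ring
  rw [e]
  have h1 : 0 ≤ s ^ 2 * ‖v‖ ^ 2 - (stdForm z v ^ 2 + stdForm z (Complex.I • v) ^ 2) := by linarith
  positivity

theorem hasFDerivAt_norm_Cn {z : Cn n} (hz : z ≠ 0) : ∃ f : Cn n →L[ℝ] ℝ,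
    (∀ v, f v = stdForm z (Complex.I • v) / ‖z‖) ∧ HasFDerivAt (fun z : Cn n => ‖z‖) f z := by
  have h1 : HasFDerivAt (fun z : Cn n => ‖z‖ ^ 2) _ z := (hasStrictFDerivAt_norm_sq z).hasFDerivAt
  have h2 := h1.sqrt (by positivity)
  have h3 : (fun z : Cn n => √(‖z‖ ^ 2)) = fun z => ‖z‖ := by
    funext z; exact Real.sqrt_sq (norm_nonneg z)
  rw [h3] at h2
  refine ⟨_, fun v => ?_, h2⟩
  have h4 : inner ℝ z v = stdForm z (Complex.I • v) := by
    rw [stdForm_I_smul, PiLp.inner_apply]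
    refine Finset.sum_congr rfl fun i _ => ?_
    simp [Complex.inner]; ring
  simp only [_root_.smul_apply, innerSL_apply_apply, h4, smul_eq_mul,
    Real.sqrt_sq (norm_nonneg z)]
  have := norm_ne_zero_iff.2 hz
  simp
  field_simp

theorem hasFDerivAt_radial {β : ℝ → ℝ} {β' : ℝ} {z : Cn n} (hz : z ≠ 0)
    (hβ : HasDerivAt β β' ‖z‖) : ∃ f : Cn n →L[ℝ] Cn n,
      (∀ v, f v = radialDeriv (β ‖z‖ / ‖z‖) ((β' * ‖z‖ - β ‖z‖) / ‖z‖ ^ 3) z v) ∧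
      HasFDerivAt (fun z : Cn n => (β ‖z‖ / ‖z‖) • z) f z := by
  obtain ⟨f, hf, hfd⟩ := hasFDerivAt_norm_Cn hz
  have h0 := norm_ne_zero_iff.2 hz
  have h1 : HasDerivAt (fun s => β s / s) ((β' * ‖z‖ - β ‖z‖ * 1) / ‖z‖ ^ 2) ‖z‖ :=
    hβ.div (hasDerivAt_id _) h0
  have h2 := (h1.comp_hasFDerivAt z hfd).smul (hasFDerivAt_id z)
  refine ⟨_, fun v => ?_, h2⟩
  simp only [radialDeriv, _root_.add_apply, _root_.smul_apply,
    ContinuousLinearMap.smulRight_apply, ContinuousLinearMap.coe_id', id, Function.comp, hf]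
  congr 2
  rw [smul_eq_mul]
  field_simp

end linear

namespace IsProfile
variable {r ρ δ : ℝ} {β : ℝ → ℝ}

/-- Otherwise the two prescribed formulas would both hold at `s = r` and give `√(ρ² + r²) = r`. -/
theorem lt_radius (h : IsProfile r ρ δ β) (hρ : 0 < ρ) (hr : 0 < r) : δ < r := by
  by_contra hcon
  rw [not_lt] at hcon
  have h1 := h.near r ⟨hr.le, hcon⟩
  have h2 := h.far r ⟨by linarith, le_rfl⟩
  rw [h2] at h1
  have h3 : r < √(ρ ^ 2 + r ^ 2) := Real.lt_sqrt_of_sq_lt (by nlinarith)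
  linarith

theorem hasDerivAt (h : IsProfile r ρ δ β) {s : ℝ} (hs : 0 < s) (hsr : s < r) :
    HasDerivAt β (deriv β s) s := by
  have h1 : ContDiffAt ℝ ∞ β s := h.smooth.contDiffAt (Icc_mem_nhds hs hsr)
  exact (h1.differentiableAt (by simp)).hasDerivAt

theorem deriv_pos (h : IsProfile r ρ δ β) {s : ℝ} (hs : 0 < s) (hsr : s < r) : 0 < deriv β s := by
  rcases le_or_gt s (r - δ) with h1 | h1
  · exact (h.deriv_mem s ⟨hs, h1⟩).1
  · have h2 : β =ᶠ[𝓝 s] id := by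
      filter_upwards [Ioo_mem_nhds h1 hsr] with t ht
      exact h.far t ⟨ht.1.le, ht.2.le⟩
    rw [h2.deriv_eq]
    simp

theorem pos (h : IsProfile r ρ δ β) (hρ : 0 < ρ) {s : ℝ} (hs : 0 < s) (hsr : s < r) : 0 < β s :=
  hρ.trans_le (h.mapsTo ⟨hs.le, hsr.le⟩).1

/-- `β` is strictly increasing and `β r ≤ r`. So the radial map sends the punctured ball into the
ball, where the embedding is known to be symplectic. -/
theorem lt (h : IsProfile r ρ δ β) {s : ℝ} (hs : 0 < s) (hsr : s < r) : β s < r := by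
  have hc : ContinuousOn β (Icc s r) :=
    h.smooth.continuousOn.mono (Icc_subset_Icc hs.le le_rfl)
  have h1 : StrictMonoOn β (Icc s r) := by
    refine strictMonoOn_of_deriv_pos (convex_Icc _ _) hc fun t ht => ?_
    rw [interior_Icc] at ht
    exact h.deriv_pos (hs.trans ht.1) ht.2
  have h2 := h1 (left_mem_Icc.2 hsr.le) (right_mem_Icc.2 hsr.le) hsr
  exact h2.trans_le (h.mapsTo ⟨(hs.trans hsr).le, le_rfl⟩).2

end IsProfile

/-- A null vector of a semidefinite symmetric form lies in its radical, which is zero by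
nondegeneracy of `σ`. Weak positivity therefore suffices, and unlike strict positivity it survives
passage to a limit. -/
theorem LinCompatible.of_nonneg {V : Type*} [AddCommGroup V] [Module ℝ V] [TopologicalSpace V]
    {σ : V →L[ℝ] V →L[ℝ] ℝ} {J : V →L[ℝ] V} (alt : ∀ a, σ a a = 0) (sq : ∀ a, J (J a) = -a)
    (inv : ∀ a b, σ (J a) (J b) = σ a b) (nonneg : ∀ a, 0 ≤ σ a (J a))
    (nondeg : ∀ a, (∀ b, σ a b = 0) → a = 0) : LinCompatible σ J := by
  refine ⟨alt, sq, inv, fun a ha => lt_of_le_of_ne (nonneg a) fun h0 => ha (nondeg a fun b => ?_)⟩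
  have hanti : ∀ a b, σ a b = -σ b a := by
    intro a b
    have := alt (a + b)
    simp only [map_add, _root_.add_apply, alt] at this
    linarith
  have hsymm : ∀ a b, σ a (J b) = σ b (J a) := by
    intro a b
    rw [← inv a (J b), sq, map_neg, hanti (J a) b, neg_neg]
  have key : ∀ c, σ a (J c) = 0 := by
    intro c
    have h1 : ∀ t : ℝ, 0 ≤ σ c (J c) + 2 * t * σ a (J c) := by
      intro t
      have h2 := nonneg (c + t • a)
      simp only [map_add, map_smul, _root_.add_apply, _root_.smul_apply,
        smul_eq_mul, ← h0, hsymm c a] at h2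
      linarith
    by_contra hne
    -- For this `t` the affine function of `t` takes the value `-1`.
    have h3 := h1 (-(σ c (J c) + 1) / (2 * σ a (J c)))
    have h4 : 2 * (-(σ c (J c) + 1) / (2 * σ a (J c))) * σ a (J c) = -(σ c (J c) + 1) := by
      field_simp
    linarith
  have h5 := key (-(J b))
  rwa [map_neg, sq, neg_neg] at h5

end LagBlowUp

namespace LagBlowUp

/-! ### Compatibility on the blow-up, off the exceptional divisor and across it -/

section manifold
variable {n : ℕ} {M : Type*} [TopologicalSpace M] [ChartedSpace (Cn n) M] [IsManifold (mdl n) ∞ M]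

theorem SymplecticForm.form_congr (Ω : SymplecticForm n M) {x y : M} (h : x = y) {v w v' w' : Cn n}
    (hv : v = v') (hw : w = w') : Ω.form x v w = Ω.form y v' w' := by
  subst h hv hw; rfl

theorem AlmostComplex.J_congr (J : AlmostComplex n M) {x y : M} (h : x = y) {v v' : Cn n}
    (hv : v = v') : (J.J x v : Cn n) = J.J y v' := by
  subst h hv; rfl

/-- The coordinates of a tangent vector in the chart `e`. -/
def chartCoord (e : OpenPartialHomeomorph M (Cn n)) (x : M) : TangentSpace (mdl n) x →L[ℝ] Cn n :=
  mfderiv (mdl n) (mdl n) e x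

theorem chartFrame_chartCoord {e : OpenPartialHomeomorph M (Cn n)}
    (he : e ∈ IsManifold.maximalAtlas (mdl n) ∞ M) {x : M} (hx : x ∈ e.source)
    (v : TangentSpace (mdl n) x) : chartFrame e x (chartCoord e x v) = v :=
  chartFrame_mfderiv he hx v

theorem chartCoord_chartFrame {e : OpenPartialHomeomorph M (Cn n)}
    (he : e ∈ IsManifold.maximalAtlas (mdl n) ∞ M) {x : M} (hx : x ∈ e.source) (v : Cn n) :
    chartCoord e x (chartFrame e x v) = v :=
  mfderiv_chartFrame he hx v

/-- The frame of a holomorphic ball is complex linear. -/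
theorem BallEmbedding.IsHolomorphic.chartFrame_I_smul {b : BallEmbedding n M} {J : AlmostComplex n M}
    (hbJ : b.IsHolomorphic J) {x : M} (hx : x ∈ b.chart.source) (v : Cn n) :
    chartFrame b.chart x (Complex.I • v) = J.J x (chartFrame b.chart x v) := by
  have h1 : b.chart x ∈ Metric.ball (0 : Cn n) b.r := by
    rw [← b.target_eq]; exact b.chart.map_source hx
  exact (hbJ _ h1 v).trans (J.J_congr (b.chart.left_inv hx) rfl)

theorem BallEmbedding.IsHolomorphic.chartCoord_J {b : BallEmbedding n M} {J : AlmostComplex n M}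
    (hbJ : b.IsHolomorphic J) {x : M} (hx : x ∈ b.chart.source) (v : TangentSpace (mdl n) x) :
    chartCoord b.chart x (J.J x v) = Complex.I • chartCoord b.chart x v := by
  have h1 := hbJ.chartFrame_I_smul hx (chartCoord b.chart x v)
  rw [chartFrame_chartCoord b.chart_mem hx] at h1
  rw [← h1, chartCoord_chartFrame b.chart_mem hx]

namespace BlowUp
variable {b : BallEmbedding n M} {β : ℝ → ℝ} {ρ δ : ℝ}

theorem inflate_eq_self (hβ : IsProfile b.r ρ δ β) (hδr : δ < b.r) {x : M}
    (hx : x ∉ b.emb '' Metric.closedBall 0 (b.r - δ)) : inflate b β x = x := by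
  rw [inflate]
  split_ifs with h
  · have h1 : b.r - δ < ‖b.chart x‖ := by
      by_contra hcon
      exact hx ⟨b.chart x, mem_closedBall_zero_iff.2 (not_lt.1 hcon), b.chart.left_inv h⟩
    have h2 : ‖b.chart x‖ < b.r := by
      rw [← mem_ball_zero_iff, ← b.target_eq]; exact b.chart.map_source h
    rw [hβ.far _ ⟨h1.le, h2.le⟩, div_self (by linarith), one_smul]
    exact b.chart.left_inv h
  · rfl

/-- The closed ball is compact and `M` is Hausdorff. Closedness makes `inflate ∘ proj` equal to
`proj` on a neighbourhood of each point outside, so that the derivatives agree too. -/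
theorem isClosed_emb_closedBall [T2Space M] (hδ : 0 < δ) :
    IsClosed (b.emb '' Metric.closedBall 0 (b.r - δ)) := by
  have : Metric.closedBall (0 : Cn n) (b.r - δ) ⊆ b.chart.target := by
    rw [b.target_eq]; exact Metric.closedBall_subset_ball (by linarith)
  exact ((isCompact_closedBall _ _).image_of_continuousOn
    (b.chart.continuousOn_symm.mono this)).isClosed

theorem center_mem_emb_closedBall (hδr : δ < b.r) :
    b.center ∈ b.emb '' Metric.closedBall 0 (b.r - δ) :=
  ⟨0, Metric.mem_closedBall_self (by linarith), rfl⟩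

variable [T2Space M] {Ω : SymplecticForm n M} {J : AlmostComplex n M}
  {Ω' : SymplecticForm n (BlowUp b)} {J' : AlmostComplex n (BlowUp b)}

/-- Away from the ball the form of the blow-up is the pullback under the blow-up map. -/
theorem form_eq_of_notMem (hβ : IsProfile b.r ρ δ β) (hδ : 0 < δ) (hδr : δ < b.r)
    (hΩ' : IsBlowUpForm b β Ω Ω') {p : BlowUp b}
    (hp : proj b p ∉ b.emb '' Metric.closedBall 0 (b.r - δ)) (v w : TangentSpace (mdl n) p) :
    Ω'.form p v w = Ω.form (proj b p) (dproj p v) (dproj p w) := by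
  have h1 : (fun q => inflate b β (proj b q)) =ᶠ[𝓝 p] proj b := by
    have := contMDiff_proj.continuous.continuousAt
      ((isClosed_emb_closedBall (b := b) hδ).isOpen_compl.mem_nhds hp)
    filter_upwards [this] with q hq
    exact inflate_eq_self hβ hδr hq
  have h2 := h1.mfderiv_eq (I := mdl n) (I' := mdl n)
  have hpE : p ∉ excDivisor b := fun h => hp (by
    rw [show proj b p = b.center from h]; exact center_mem_emb_closedBall hδr)
  rw [hΩ' p hpE]
  exact Ω.form_congr (inflate_eq_self hβ hδr hp) (DFunLike.congr_fun h2 v) (DFunLike.congr_fun h2 w)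

/-- On the ball the form of the blow-up is given by the derivative of `z ↦ β(|z|) z / |z|`. -/
theorem form_eq_of_mem_source (hβ : IsProfile b.r ρ δ β) (hρ : 0 < ρ) (hbΩ : b.IsSymplectic Ω)
    (hΩ' : IsBlowUpForm b β Ω Ω') {p : BlowUp b} (hpE : p ∉ excDivisor b)
    (hp : proj b p ∈ b.chart.source) : ∃ s β₀ β₁ : ℝ, 0 < s ∧ 0 < β₀ ∧ 0 ≤ β₁ ∧
      ‖b.chart (proj b p)‖ = s ∧ ∀ v w : TangentSpace (mdl n) p, Ω'.form p v w = stdForm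
        (radialDeriv (β₀ / s) ((β₁ * s - β₀) / s ^ 3) (b.chart (proj b p))
          (chartCoord b.chart (proj b p) (dproj p v)))
        (radialDeriv (β₀ / s) ((β₁ * s - β₀) / s ^ 3) (b.chart (proj b p))
          (chartCoord b.chart (proj b p) (dproj p w))) := by
  have hz : b.chart (proj b p) ≠ 0 := (chart_ne_zero hp).2 hpE
  set z := b.chart (proj b p) with hzdef
  have hs : 0 < ‖z‖ := norm_pos_iff.2 hz
  have hsr : ‖z‖ < b.r := by
    rw [← mem_ball_zero_iff, ← b.target_eq]; exact b.chart.map_source hp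
  have hTz : (β ‖z‖ / ‖z‖) • z ∈ Metric.ball (0 : Cn n) b.r := by
    rw [mem_ball_zero_iff, norm_smul, Real.norm_of_nonneg (div_pos (hβ.pos hρ hs hsr) hs).le,
      div_mul_cancel₀ _ hs.ne']
    exact hβ.lt hs hsr
  obtain ⟨T, hT, hTd⟩ := hasFDerivAt_radial hz (hβ.hasDerivAt hs hsr)
  refine ⟨‖z‖, β ‖z‖, deriv β ‖z‖, hs, hβ.pos hρ hs hsr, (hβ.deriv_pos hs hsr).le, rfl,
    fun v w => ?_⟩
  have h1 : HasMFDerivAt (mdl n) (mdl n) (b.chart ∘ proj b) p _ :=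
    ((mdifferentiable_of_mem_maximalAtlas b.chart_mem).mdifferentiableAt hp).hasMFDerivAt.comp p
      ((contMDiff_proj p).mdifferentiableAt (by simp)).hasMFDerivAt
  have h2 : HasMFDerivAt (mdl n) (mdl n)
      ((fun z : Cn n => (β ‖z‖ / ‖z‖) • z) ∘ (b.chart ∘ proj b)) p _ :=
    hTd.hasMFDerivAt.comp p h1
  have h3 : HasMFDerivAt (mdl n) (mdl n)
      (b.emb ∘ ((fun z : Cn n => (β ‖z‖ / ‖z‖) • z) ∘ (b.chart ∘ proj b))) p _ :=
    ((mdifferentiable_of_mem_maximalAtlas b.chart_mem).mdifferentiableAt_symm (by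
      rw [b.target_eq]; exact hTz)).hasMFDerivAt.comp p h2
  have h4 : (fun q => inflate b β (proj b q)) =ᶠ[𝓝 p]
      b.emb ∘ ((fun z : Cn n => (β ‖z‖ / ‖z‖) • z) ∘ (b.chart ∘ proj b)) := by
    filter_upwards [contMDiff_proj.continuous.continuousAt
      (b.chart.open_source.mem_nhds hp)] with q hq
    exact if_pos hq
  have h5 := (h4.mfderiv_eq (I := mdl n) (I' := mdl n)).trans h3.mfderiv
  rw [hΩ' p hpE, ← hT, ← hT, ← hbΩ _ hTz]
  exact Ω.form_congr (if_pos hp) (DFunLike.congr_fun h5 v) (DFunLike.congr_fun h5 w)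

theorem fderiv_blowDown_apply (j : Fin n) (y w : Cn n) (i : Fin n) :
    fderiv ℝ (blowDown j) y w i = w j * fill j y i + if i = j then 0 else y j * w i := by
  have hc : ∀ i, HasFDerivAt (fun y : Cn n => y i)
      ((EuclideanSpace.proj i : Cn n →L[ℂ] ℂ).restrictScalars ℝ) y := fun i =>
    ((EuclideanSpace.proj i : Cn n →L[ℂ] ℂ).restrictScalars ℝ).hasFDerivAt
  have h1 : HasFDerivAt (fun y => blowDown j y i)
      (((EuclideanSpace.proj i : Cn n →L[ℂ] ℂ).restrictScalars ℝ).comp (fderiv ℝ (blowDown j) y)) y :=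
    ((EuclideanSpace.proj i : Cn n →L[ℂ] ℂ).restrictScalars ℝ).hasFDerivAt.comp y
      ((contDiff_blowDown j).differentiable (by simp) y).hasFDerivAt
  by_cases hi : i = j
  · subst hi
    simp only [blowDown_self] at h1
    have := DFunLike.congr_fun (h1.unique (hc i)) w
    simpa [fill_self] using this
  · simp only [blowDown_apply, fill_ne j hi] at h1
    have := DFunLike.congr_fun (h1.unique ((hc j).mul (hc i))) w
    simp only [fill_ne j hi, if_neg hi]
    refine Eq.trans this ?_
    simp
    ring

theorem fderiv_blowDown_I_smul (j : Fin n) (y w : Cn n) :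
    fderiv ℝ (blowDown j) y (Complex.I • w) = Complex.I • fderiv ℝ (blowDown j) y w := by
  ext i
  rw [PiLp.smul_apply, fderiv_blowDown_apply, fderiv_blowDown_apply]
  split_ifs <;> simp <;> ring

/-- The derivative of `blowDown` and the frame of the ball are complex linear and `dπ` intertwines
the complex structures; off `E` it is injective and can be cancelled. -/
theorem J_chartFrame_off (hbJ : b.IsHolomorphic J) (hJ' : IsBlowUpComplex b J J') {j : Fin n}
    {p : BlowUp b} (hpE : p ∉ excDivisor b) (hp : p ∈ (excHomeo b j).source) (w : Cn n) :
    J'.J p (chartFrame (excHomeo b j) p w) = chartFrame (excHomeo b j) p (Complex.I • w) := by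
  apply dproj_injective hpE
  have h1 : dproj p (J'.J p (chartFrame (excHomeo b j) p w)) =
    J.J (proj b p) (dproj p (chartFrame (excHomeo b j) p w)) := hJ' p _
  rw [h1, dproj_chartFrame hp, dproj_chartFrame hp, fderiv_blowDown_I_smul,
    hbJ.chartFrame_I_smul (proj_mem_source hp)]

/-- The standard charts of the blow-up are holomorphic. -/
theorem J_chartFrame (hbJ : b.IsHolomorphic J) (hJ' : IsBlowUpComplex b J J') {j : Fin n}
    {p : BlowUp b} (hp : p ∈ (excHomeo b j).source) (w : Cn n) :
    J'.J p (chartFrame (excHomeo b j) p w) = chartFrame (excHomeo b j) p (Complex.I • w) := by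
  have hF : ContinuousOn (fun q : BlowUp b => chartCoord (excHomeo b j) q
      (J'.J q (chartFrame (excHomeo b j) q w))) (excHomeo b j).source :=
    ContField.mfderiv_chart (f := id) (excHomeo_mem b j) (fun q hq => hq)
      (J'.continuousOn (ContField.chartFrame (f := id) (excHomeo_mem b j) continuousOn_id
        (fun q hq => hq) continuousOn_const))
  have hoff : ∀ q ∈ (excHomeo b j).source, q ∉ excDivisor b →
      chartCoord (excHomeo b j) q (J'.J q (chartFrame (excHomeo b j) q w)) = Complex.I • w :=
    fun q hq hqE => by
      rw [J_chartFrame_off hbJ hJ' hqE hq, chartCoord_chartFrame (excHomeo_mem b j) hq]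
  -- On `E` the differential of the blow-up map is not assumed injective, so the identity is
  -- extended there from the dense complement, coordinate by coordinate.
  have h1 : chartCoord (excHomeo b j) p (J'.J p (chartFrame (excHomeo b j) p w)) =
      Complex.I • w := by
    ext i
    apply Complex.ext
    · exact mem_of_mem_off ((reCoord i).continuous.comp_continuousOn hF)
        (S := {reCoord i (Complex.I • w)}) isClosed_singleton
        (fun q hq hqE => congrArg (reCoord i) (hoff q hq hqE)) hp
    · exact mem_of_mem_off ((imCoord i).continuous.comp_continuousOn hF)
        (S := {imCoord i (Complex.I • w)}) isClosed_singleton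
        (fun q hq hqE => congrArg (imCoord i) (hoff q hq hqE)) hp
  rw [← h1, chartFrame_chartCoord (excHomeo_mem b j) hp]

/-- In the ball this is the computation for the radial map, whose pullback form is invariant under
`i` and nonnegative; elsewhere the form is pulled back by `π` and inherits both properties from `Ω`.
-/
theorem compatible_off (hJ : Compatible Ω J) (hbΩ : b.IsSymplectic Ω) (hbJ : b.IsHolomorphic J)
    (hρ : 0 < ρ) (hδ : 0 < δ) (hβ : IsProfile b.r ρ δ β) (hΩ' : IsBlowUpForm b β Ω Ω')
    (hJ' : IsBlowUpComplex b J J') {p : BlowUp b} (hpE : p ∉ excDivisor b)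
    (v w : TangentSpace (mdl n) p) :
    Ω'.form p (J'.J p v) (J'.J p w) = Ω'.form p v w ∧ 0 ≤ Ω'.form p v (J'.J p v) := by
  have hδr := hβ.lt_radius hρ b.r_pos
  by_cases hp : proj b p ∈ b.chart.source
  · obtain ⟨s, β₀, β₁, hs, hβ₀, hβ₁, hz, hform⟩ := form_eq_of_mem_source hβ hρ hbΩ hΩ' hpE hp
    have hA : ∀ v : TangentSpace (mdl n) p,
        chartCoord b.chart (proj b p) (dproj p (J'.J p v)) =
        Complex.I • (chartCoord b.chart (proj b p) (dproj p v)) := by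
      intro v
      exact (congrArg _ (hJ' p v)).trans (hbJ.chartCoord_J hp _)
    constructor
    · rw [hform, hform, hA, hA, stdForm_radialDeriv_I_I]
    · rw [hform, hA]
      exact stdForm_radialDeriv_nonneg hs hβ₀ hβ₁ hz _
  · have hp' : proj b p ∉ b.emb '' Metric.closedBall 0 (b.r - δ) := by
      rintro ⟨z, hz, hzp⟩
      apply hp
      rw [← hzp]
      refine b.chart.map_target ?_
      rw [b.target_eq]
      exact Metric.closedBall_subset_ball (by linarith) hz
    have hf := form_eq_of_notMem hβ hδ hδr hΩ' hp'
    have hA : ∀ v, dproj p (J'.J p v) = J.J (proj b p) (dproj p v) := hJ' p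
    rw [hf, hf, hf, hA, hA]
    refine ⟨hJ.invariant _ _ _, ?_⟩
    by_cases h0 : dproj p v = 0
    · rw [h0]; simp
    · exact (hJ.pos _ _ h0).le

/-- Invariance and weak positivity are closed conditions, so they pass from the complement of `E` to
`E` along constant fields in a standard chart. Strict positivity then follows from nondegeneracy of
`Ω'`. -/
theorem compatible (hJ : Compatible Ω J) (hbΩ : b.IsSymplectic Ω) (hbJ : b.IsHolomorphic J)
    (hρ : 0 < ρ) (hδ : 0 < δ) (hβ : IsProfile b.r ρ δ β) (hΩ' : IsBlowUpForm b β Ω Ω')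
    (hJ' : IsBlowUpComplex b J J') : Compatible Ω' J' := by
  have key : ∀ (p : BlowUp b) (v w : TangentSpace (mdl n) p),
      Ω'.form p (J'.J p v) (J'.J p w) = Ω'.form p v w ∧ 0 ≤ Ω'.form p v (J'.J p v) := by
    intro p v w
    by_cases hpE : p ∉ excDivisor b
    · exact compatible_off hJ hbΩ hbJ hρ hδ hβ hΩ' hJ' hpE v w
    have hps : proj b p ∈ b.chart.source := by
      rw [show proj b p = b.center from not_not.1 hpE]; exact center_mem_source
    obtain ⟨j, hj⟩ := exists_excHomeo_source hps
    have hF : ∀ a : Cn n, ContField n id (excHomeo b j).source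
        (fun q : BlowUp b => chartFrame (excHomeo b j) q a) := fun a =>
      ContField.chartFrame (f := id) (excHomeo_mem b j) continuousOn_id (fun q hq => hq)
        continuousOn_const
    let a : Cn n := mfderiv (mdl n) (mdl n) (excHomeo b j) p v
    let c : Cn n := mfderiv (mdl n) (mdl n) (excHomeo b j) p w
    have ha : chartFrame (excHomeo b j) p a = v := chartFrame_mfderiv (excHomeo_mem b j) hj v
    have hc : chartFrame (excHomeo b j) p c = w := chartFrame_mfderiv (excHomeo_mem b j) hj w
    constructor
    · have := mem_of_mem_off (c := fun q : BlowUp b =>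
          Ω'.form q (J'.J q (chartFrame (excHomeo b j) q a)) (J'.J q (chartFrame (excHomeo b j) q c)) -
          Ω'.form q (chartFrame (excHomeo b j) q a) (chartFrame (excHomeo b j) q c))
        ((Ω'.continuousOn (f := id) (J'.continuousOn (hF a)) (J'.continuousOn (hF c))).sub
          (Ω'.continuousOn (f := id) (hF a) (hF c))) (S := {0}) isClosed_singleton
        (fun q hq hqE => sub_eq_zero.2
          (compatible_off hJ hbΩ hbJ hρ hδ hβ hΩ' hJ' hqE _ _).1) hj
      have h2 := sub_eq_zero.1 this
      rwa [ha, hc] at h2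
    · have := mem_of_mem_off (c := fun q : BlowUp b =>
          Ω'.form q (chartFrame (excHomeo b j) q a) (J'.J q (chartFrame (excHomeo b j) q a)))
        (Ω'.continuousOn (f := id) (hF a) (J'.continuousOn (hF a))) (S := Ici 0) isClosed_Ici
        (fun q hq hqE => (compatible_off hJ hbΩ hbJ hρ hδ hβ hΩ' hJ' hqE _ 0).2) hj
      rw [ha] at this
      exact this
  have h := fun p => LinCompatible.of_nonneg (Ω'.alt p) (J'.sq p) (fun v w => (key p v w).1)
    (fun v => (key p v 0).2) (Ω'.nondegenerate p)
  exact ⟨fun p => (h p).invariant, fun p => (h p).pos⟩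

end BlowUp
end manifold
end LagBlowUp

namespace LagBlowUp

/-! ### Matrices of complex linear maps -/

section linear
variable {n : ℕ}
open Matrix

/-- The matrix of a complex linear map. -/
def complexMatrix (B : Cn n →L[ℝ] Cn n) : Matrix (Fin n) (Fin n) ℂ :=
  of fun i k => B (EuclideanSpace.single k 1) i

/-- A real linear map which commutes with multiplication by `i`. -/
def IsComplexMap (B : Cn n →L[ℝ] Cn n) : Prop := ∀ v, B (Complex.I • v) = Complex.I • B v

namespace IsComplexMap
variable {B C : Cn n →L[ℝ] Cn n}

theorem apply_single_I (hB : IsComplexMap B) (i k : Fin n) :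
    B (EuclideanSpace.single k Complex.I) i = Complex.I * B (EuclideanSpace.single k 1) i := by
  have h1 : EuclideanSpace.single k Complex.I = Complex.I • EuclideanSpace.single k (1 : ℂ) := by
    ext l; by_cases h : l = k <;> simp [h]
  rw [h1, hB]
  rfl

theorem linPart_eq (hB : IsComplexMap B) : linPart B = complexMatrix B := by
  ext i k
  simp only [linPart, complexMatrix, of_apply, hB.apply_single_I]
  rw [← mul_assoc, Complex.I_mul_I]
  ring

theorem antiPart_eq (hB : IsComplexMap B) : antiPart B = 0 := by
  ext i k
  simp only [antiPart, of_apply, hB.apply_single_I, Matrix.zero_apply]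
  rw [← mul_assoc, Complex.I_mul_I]
  ring

theorem apply_eq (hB : IsComplexMap B) (v : Cn n) : (B v).ofLp = complexMatrix B *ᵥ v.ofLp := by
  rw [apply_eq_linPart_add_antiPart, hB.linPart_eq, hB.antiPart_eq, zero_mulVec, add_zero]

theorem matrix_comp (hB : IsComplexMap B) :
    complexMatrix (B.comp C) = complexMatrix B * complexMatrix C := by
  ext i k
  exact congrFun (hB.apply_eq (C (EuclideanSpace.single k 1))) i

theorem det_ne_zero (hB : IsComplexMap B) (hi : Function.Injective B) :
    (complexMatrix B).det ≠ 0 := by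
  intro h
  obtain ⟨v, hv, h0⟩ := exists_mulVec_eq_zero_iff.2 h
  have h1 := hB.apply_eq (WithLp.toLp 2 v)
  rw [h0] at h1
  have h2 : B (WithLp.toLp 2 v) = B 0 := by
    rw [map_zero]; ext i; exact congrFun h1 i
  exact hv (congrArg WithLp.ofLp (hi h2))

theorem mem_unitaryGroup (hB : IsComplexMap B) (hs : IsSymplecticMap B) :
    complexMatrix B ∈ unitaryGroup (Fin n) ℂ := by
  have h := hs.relations.1
  rw [hB.linPart_eq, hB.antiPart_eq, transpose_zero, Matrix.zero_mul, sub_zero] at h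
  exact mem_unitaryGroup_iff'.2 h

end IsComplexMap

/-- The Jacobian of the blow-down map in the `j`-th chart. -/
theorem det_fderiv_blowDown (j : Fin n) (y : Cn n) :
    (complexMatrix (fderiv ℝ (blowDown j) y)).det = y j ^ (n - 1) := by
  -- The Jacobian is the scalar matrix `y_j` with its `j`-th column replaced by `fill j y`. Cramer's
  -- rule reduces its determinant to the product of the `n - 1` other diagonal entries and the
  -- `j`-th entry of that column, which is `1`.
  have h1 : complexMatrix (fderiv ℝ (blowDown j) y) =
      (diagonal fun _ : Fin n => y j).updateCol j (fill j y).ofLp := by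
    ext i k
    rw [complexMatrix, of_apply, BlowUp.fderiv_blowDown_apply, updateCol_apply]
    by_cases hk : k = j
    · subst hk
      by_cases hi : i = k <;> simp [hi]
    · by_cases hi : i = j
      · subst hi; simp [hk, Ne.symm hk]
      · by_cases hik : i = k
        · subst hik; simp [hi, Ne.symm hi]
        · simp [hi, hk, hik, Ne.symm hk]
  rw [h1, ← cramer_apply, cramer_eq_adjugate_mulVec, adjugate_diagonal, mulVec_diagonal, fill_self,
    mul_one, Finset.prod_const, Finset.card_erase_of_mem (Finset.mem_univ _), Finset.card_univ,
    Fintype.card_fin]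

end linear

namespace IsUnitaryFrame
variable {n : ℕ} {V : Type*} [AddCommGroup V] [Module ℝ V] [TopologicalSpace V]
  [IsTopologicalAddGroup V] [ContinuousSMul ℝ V] [FiniteDimensional ℝ V]
  {σ : V →L[ℝ] V →L[ℝ] ℝ} {J : V →L[ℝ] V} {Φ : Cn n →L[ℝ] V}

theorem frameCoord_J (hΦ : IsUnitaryFrame σ J Φ) (hV : Module.finrank ℝ V = 2 * n) (a : V) :
    frameCoord σ J Φ (J a) = Complex.I • frameCoord σ J Φ a := by
  obtain ⟨v, rfl⟩ := hΦ.surjective hV a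
  rw [← hΦ.complex, hΦ.frameCoord_frame, hΦ.frameCoord_frame]

theorem frameCoord_injective (hΦ : IsUnitaryFrame σ J Φ) (hV : Module.finrank ℝ V = 2 * n) :
    Function.Injective (frameCoord σ J Φ) :=
  Function.LeftInverse.injective (g := Φ) (hΦ.frame_frameCoord hV)

end IsUnitaryFrame

/-! ### Maslov indices of the blow-up -/

section manifold
variable {n : ℕ} {M : Type*} [TopologicalSpace M] [ChartedSpace (Cn n) M] [IsManifold (mdl n) ∞ M]
  [T2Space M] {b : BallEmbedding n M} {Ω : SymplecticForm n M} {J : AlmostComplex n M}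
  {Ω' : SymplecticForm n (BlowUp b)} {J' : AlmostComplex n (BlowUp b)} {u : ℂ → BlowUp b}
  {Φ : ∀ z : ℂ, Cn n →L[ℝ] TangentSpace (mdl n) (BlowUp.proj b (u z))}
  {Ψ : ∀ z : ℂ, Cn n →L[ℝ] TangentSpace (mdl n) (u z)}
open Matrix

namespace BlowUp

/-- The derivative of the blow-up map in unitary frames along `u`. -/
def dprojCoord (Ω : SymplecticForm n M) (J : AlmostComplex n M) (u : ℂ → BlowUp b)
    (Φ : ∀ z : ℂ, Cn n →L[ℝ] TangentSpace (mdl n) (proj b (u z)))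
    (Ψ : ∀ z : ℂ, Cn n →L[ℝ] TangentSpace (mdl n) (u z)) (z : ℂ) : Cn n →L[ℝ] Cn n :=
  (frameCoord (Ω.form (proj b (u z))) (J.J (proj b (u z))) (Φ z)).comp ((dproj (u z)).comp (Ψ z))

theorem frame_dprojCoord (hΦ : IsUnitaryTriv Ω J (fun z => proj b (u z)) disk Φ) {z : ℂ}
    (hz : z ∈ disk) (v : Cn n) : Φ z (dprojCoord Ω J u Φ Ψ z v) = dproj (u z) (Ψ z v) :=
  (hΦ.frame z hz).frame_frameCoord (finrank_tangentSpace _) _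

theorem isComplexMap_dprojCoord (hJ' : IsBlowUpComplex b J J')
    (hΦ : IsUnitaryTriv Ω J (fun z => proj b (u z)) disk Φ) (hΨ : IsUnitaryTriv Ω' J' u disk Ψ)
    {z : ℂ} (hz : z ∈ disk) : IsComplexMap (dprojCoord Ω J u Φ Ψ z) := by
  intro v
  have h1 : dproj (u z) (Ψ z (Complex.I • v)) = J.J (proj b (u z)) (dproj (u z) (Ψ z v)) := by
    rw [(hΨ.frame z hz).complex]; exact hJ' _ _
  change frameCoord _ _ (Φ z) (dproj (u z) (Ψ z (Complex.I • v))) = _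
  rw [h1]
  exact (hΦ.frame z hz).frameCoord_J (finrank_tangentSpace _) _

theorem continuousOn_dprojCoord (hΦ : IsUnitaryTriv Ω J (fun z => proj b (u z)) disk Φ)
    (hΨ : IsUnitaryTriv Ω' J' u disk Ψ) :
    ContinuousOn (fun z => complexMatrix (dprojCoord Ω J u Φ Ψ z)) disk := by
  refine continuousOn_pi.2 fun i => continuousOn_pi.2 fun k => ?_
  exact (contDiff_coord i).continuous.comp_continuousOn (hΦ.continuousOn_frameCoord
    (contField_dproj (hΨ.contField continuousOn_const)))

/-- Off `E` the map is a composition of injective maps, and it is complex linear, so its complex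
determinant does not vanish. -/
theorem det_dprojCoord_ne_zero (hJ' : IsBlowUpComplex b J J')
    (hΦ : IsUnitaryTriv Ω J (fun z => proj b (u z)) disk Φ) (hΨ : IsUnitaryTriv Ω' J' u disk Ψ)
    {z : ℂ} (hz : z ∈ disk) (hzE : u z ∉ excDivisor b) :
    (complexMatrix (dprojCoord Ω J u Φ Ψ z)).det ≠ 0 :=
  (isComplexMap_dprojCoord hJ' hΦ hΨ hz).det_ne_zero
    (((hΦ.frame z hz).frameCoord_injective (finrank_tangentSpace _)).comp
      ((dproj_injective hzE).comp (hΨ.frame z hz).injective))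

/-- In a standard chart, the determinant of the derivative of the blow-up map is a non-vanishing
continuous function times a power of the local equation of the exceptional divisor. -/
theorem det_dprojCoord_mul (hbJ : b.IsHolomorphic J) (hJ' : IsBlowUpComplex b J J')
    (hΦ : IsUnitaryTriv Ω J (fun z => proj b (u z)) disk Φ) (hΨ : IsUnitaryTriv Ω' J' u disk Ψ)
    {z : ℂ} (hz : z ∈ disk) {j : Fin n} (hj : u z ∈ (excHomeo b j).source) :
    (complexMatrix (dprojCoord Ω J u Φ Ψ z)).det *
        (chartMatrix Ω' J' (u z) (Ψ z) (excHomeo b j)).det =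
      (chartMatrix Ω J (proj b (u z)) (Φ z) b.chart).det * excHomeo b j (u z) j ^ (n - 1) := by
  have h1 : IsComplexMap ((frameCoord (Ω.form (proj b (u z))) (J.J (proj b (u z))) (Φ z)).comp
      (chartFrame b.chart (proj b (u z)))) := by
    intro v
    change frameCoord _ _ (Φ z) (chartFrame b.chart (proj b (u z)) (Complex.I • v)) = _
    rw [hbJ.chartFrame_I_smul (proj_mem_source hj)]
    exact (hΦ.frame z hz).frameCoord_J (finrank_tangentSpace _) _
  rw [← det_fderiv_blowDown, ← det_mul, ← det_mul]
  congr 1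
  have h2 := (isComplexMap_dprojCoord hJ' hΦ hΨ hz).matrix_comp
    (C := (frameCoord (Ω'.form (u z)) (J'.J (u z)) (Ψ z)).comp (chartFrame (excHomeo b j) (u z)))
  have h3 := h1.matrix_comp (C := fderiv ℝ (blowDown j) (excHomeo b j (u z)))
  -- Both products are the matrix of the same map `dπ` read from the standard chart to the unitary
  -- frame `Φ`, through `Ψ` on one side and through the chart of the ball on the other.
  refine h2.symm.trans (Eq.trans ?_ h3)
  congr 1
  ext1 v
  change frameCoord _ _ (Φ z) (dproj (u z) (Ψ z (frameCoord _ _ (Ψ z) _))) =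
    frameCoord _ _ (Φ z) (chartFrame b.chart (proj b (u z)) _)
  rw [(hΨ.frame z hz).frame_frameCoord (finrank_tangentSpace _)]
  exact congrArg _ (dproj_chartFrame hj v)

/-- A holomorphic chart gives a complex-linear injective map into unitary coordinates, so the
columns form a complex basis. -/
theorem det_chartMatrix_ne_zero {N : Type*} [TopologicalSpace N] [ChartedSpace (Cn n) N]
    [IsManifold (mdl n) ∞ N] {σ : SymplecticForm n N} {K : AlmostComplex n N}
    {e : OpenPartialHomeomorph N (Cn n)} (he : e ∈ IsManifold.maximalAtlas (mdl n) ∞ N) {x : N}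
    (hx : x ∈ e.source) {Θ : Cn n →L[ℝ] TangentSpace (mdl n) x}
    (hΘ : IsUnitaryFrame (σ.form x) (K.J x) Θ)
    (hc : ∀ v : Cn n, chartFrame e x (Complex.I • v) = K.J x (chartFrame e x v)) :
    (chartMatrix σ K x Θ e).det ≠ 0 := by
  refine IsComplexMap.det_ne_zero (B := (frameCoord (σ.form x) (K.J x) Θ).comp (chartFrame e x))
    (fun v => ?_) ((hΘ.frameCoord_injective (finrank_tangentSpace x)).comp
      (Function.LeftInverse.injective (g := chartCoord e x) (chartCoord_chartFrame he hx)))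
  rw [ContinuousLinearMap.comp_apply, hc]
  exact hΘ.frameCoord_J (finrank_tangentSpace x) _

/-- A loop of Lagrangian subspaces for `L` gives one for the preimage of `L`. -/
theorem isLagrangianLoop_preimage (hJ' : IsBlowUpComplex b J J')
    (hΦ : IsUnitaryTriv Ω J (fun z => proj b (u z)) disk Φ) (hΨ : IsUnitaryTriv Ω' J' u disk Ψ)
    {L : Set M} (hbL : b.center ∉ L) (huL : ∀ z ∈ Metric.sphere (0 : ℂ) 1, proj b (u z) ∈ L)
    (hform : ∀ p, proj b p ∈ L → ∀ v w : TangentSpace (mdl n) p,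
      Ω'.form p v w = Ω.form (proj b p) (dproj p v) (dproj p w))
    {U : ℝ → Matrix (Fin n) (Fin n) ℂ} (hU : IsLagrangianLoop L (fun z => proj b (u z)) Φ U) :
    ∃ D : ℝ → Matrix (Fin n) (Fin n) ℂ,
      (∀ t, D t = complexMatrix (dprojCoord Ω J u Φ Ψ (Complex.exp (t * Complex.I)))) ∧
      (∀ t, D t ∈ unitaryGroup (Fin n) ℂ) ∧
      IsLagrangianLoop (proj b ⁻¹' L) u Ψ (fun t => (D t)ᴴ * U t) := by
  let E : ℝ → ℂ := fun t => Complex.exp (t * Complex.I)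
  let D : ℝ → Matrix (Fin n) (Fin n) ℂ := fun t => complexMatrix (dprojCoord Ω J u Φ Ψ (E t))
  have hE : ∀ t, E t ∈ disk := exp_mul_I_mem_disk
  have hB : ∀ t, IsComplexMap (dprojCoord Ω J u Φ Ψ (E t)) := fun t =>
    isComplexMap_dprojCoord hJ' hΦ hΨ (hE t)
  have hxL : ∀ t, proj b (u (E t)) ∈ L := fun t => huL _ (exp_mul_I_mem_sphere t)
  -- Over `L` the form upstairs is the pullback of `Ω`, so the complex-linear map `dπ` preserves the
  -- symplectic forms and is unitary.
  have hD : ∀ t, D t ∈ unitaryGroup (Fin n) ℂ := fun t => by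
    refine (hB t).mem_unitaryGroup fun v w => ?_
    rw [← (hΦ.frame _ (hE t)).symplectic, frame_dprojCoord hΦ (hE t), frame_dprojCoord hΦ (hE t),
      ← hform _ (hxL t), (hΨ.frame _ (hE t)).symplectic]
  have hDc : Continuous D := (continuousOn_dprojCoord hΦ hΨ).comp_continuous continuous_exp_mul_I hE
  have hDD : ∀ t, (D t)ᴴ * D t = 1 := fun t => mem_unitaryGroup_iff'.1 (hD t)
  have hDD' : ∀ t, D t * (D t)ᴴ = 1 := fun t => mem_unitaryGroup_iff.1 (hD t)
  refine ⟨D, fun t => rfl, hD, fun t => mul_mem (Unitary.star_mem (hD t)) (hU.unitary t),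
    fun t v => ?_, ?_⟩
  · rw [mem_tangentTo_preimage_iff hbL (hxL t), ← frame_dprojCoord hΦ (hE t)]
    refine (hU.mem_iff t _).trans (exists_congr fun x => ?_)
    rw [(hB t).apply_eq]
    change D t *ᵥ v.ofLp = _ ↔ _
    rw [← mulVec_mulVec]
    constructor
    · intro h
      rw [← h, mulVec_mulVec, hDD, one_mulVec]
    · intro h
      rw [h, mulVec_mulVec, hDD', one_mulVec]
  · have h1 : (fun t => (D t)ᴴ * U t * ((D t)ᴴ * U t)ᵀ) =
        fun t => (D t)ᴴ * (U t * (U t)ᵀ) * ((D t)ᴴ)ᵀ := by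
      funext t
      rw [transpose_mul]
      simp only [Matrix.mul_assoc]
    rw [h1]
    exact (hDc.matrix_conjTranspose.matrix_mul hU.continuous).matrix_mul
      hDc.matrix_conjTranspose.matrix_transpose

/-- The Maslov indices differ by twice the winding number of the determinant of the derivative of
the blow-up map. -/
theorem maslovIndex_preimage (hJ' : IsBlowUpComplex b J J')
    (hΦ : IsUnitaryTriv Ω J (fun z => proj b (u z)) disk Φ) (hΨ : IsUnitaryTriv Ω' J' u disk Ψ)
    {L : Set M} (hL : IsLagrangian Ω L) (hbL : b.center ∉ L)
    (huL : ∀ z ∈ Metric.sphere (0 : ℂ) 1, proj b (u z) ∈ L)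
    (hform : ∀ p, proj b p ∈ L → ∀ v w : TangentSpace (mdl n) p,
      Ω'.form p v w = Ω.form (proj b p) (dproj p v) (dproj p w)) (hu : ContinuousOn u disk) {k : ℤ}
    (hk : HasWindingNumber
      (fun t => (complexMatrix (dprojCoord Ω J u Φ Ψ (Complex.exp (t * Complex.I)))).det) k) :
    (∃! m, HasMaslovIndex Ω' (proj b ⁻¹' L) u m) ∧
    (∃! m, HasMaslovIndex Ω L (proj b ∘ u) m) ∧
    maslovIndex Ω' (proj b ⁻¹' L) u = maslovIndex Ω L (proj b ∘ u) - 2 * k := by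
  obtain ⟨U, hU⟩ := exists_isLagrangianLoop hL hΦ (contMDiff_proj.continuous.comp_continuousOn hu) huL
  obtain ⟨D, hDeq, hD, hDU⟩ := isLagrangianLoop_preimage hJ' hΦ hΨ hbL huL hform hU
  have e1 := hU.existsUnique hΦ
  have e2 := hDU.existsUnique hΨ
  refine ⟨e2, e1, ?_⟩
  have w1 : HasMaslovIndex Ω L (fun z => proj b (u z)) (maslovIndex Ω L (proj b ∘ u)) :=
    Classical.epsilon_spec e1.exists
  have w2 : HasMaslovIndex Ω' (proj b ⁻¹' L) u (maslovIndex Ω' (proj b ⁻¹' L) u) :=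
    Classical.epsilon_spec e2.exists
  rw [hU.hasMaslovIndex_iff hΦ] at w1
  rw [hDU.hasMaslovIndex_iff hΨ] at w2
  simp only [← hDeq] at hk
  -- `U = D (Dᴴ U)`, so `det²` of the frame downstairs is `(det D)²` times that of the frame
  -- upstairs.
  have h3 := ((hk.pow 2).mul w2).congr (c' := fun t => (U t).det ^ 2) fun t _ => by
    rw [← mul_pow, ← det_mul, ← Matrix.mul_assoc]
    have : D t * (D t)ᴴ = 1 := mem_unitaryGroup_iff.1 (hD t)
    rw [this, Matrix.one_mul]
  have := h3.unique w1
  push_cast at this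
  linarith

end BlowUp
end manifold
end LagBlowUp

namespace LagBlowUp

/-! ### Intersections of holomorphic disks with the exceptional divisor -/

/-- The winding number along small circles of a function with a zero of order `m`. -/
theorem eventually_hasWindingNumber {f : ℂ → ℂ} {z₀ c : ℂ} (hc : c ≠ 0) {m : ℕ}
    (hf : ∀ᶠ z in 𝓝 z₀, ContinuousAt f z)
    (h : Tendsto (fun z => f z / (z - z₀) ^ m) (𝓝[≠] z₀) (𝓝 c)) :
    ∀ᶠ ε : ℝ in 𝓝[>] 0,
      HasWindingNumber (fun t => f (z₀ + ε * Complex.exp (t * Complex.I))) m := by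
  -- The function is `c (z - z₀) ^ m` times a factor that tends to `1`; on small circles this factor
  -- has positive real part and does not wind.
  have h1 : ∀ᶠ z in 𝓝[≠] z₀, 0 < (f z / (z - z₀) ^ m / c).re := by
    have h2 := h.div_const c
    rw [div_self hc] at h2
    exact (Complex.continuous_re.tendsto _).comp h2 |>.eventually (lt_mem_nhds (by simp))
  obtain ⟨r, hr, hball⟩ := Metric.eventually_nhds_iff_ball.1
    ((eventually_nhdsWithin_iff.1 h1).and hf)
  obtain ⟨c', hc'⟩ : ∃ w : ℝ, c = ‖c‖ * Complex.exp (w * Complex.I) :=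
    ⟨c.arg, (Complex.norm_mul_exp_arg_mul_I c).symm⟩
  filter_upwards [Ioo_mem_nhdsGT hr] with ε hε
  have hz : ∀ t : ℝ, z₀ + ε * Complex.exp (t * Complex.I) ∈ Metric.ball z₀ r := fun t => by
    rw [mem_ball_iff_norm, add_sub_cancel_left, norm_mul, Complex.norm_exp_ofReal_mul_I, mul_one,
      Complex.norm_real, Real.norm_of_nonneg hε.1.le]
    exact hε.2
  have hε0 : (ε : ℂ) ≠ 0 := by exact_mod_cast hε.1.ne'
  have hne : ∀ t : ℝ, z₀ + ε * Complex.exp (t * Complex.I) ≠ z₀ := fun t h0 =>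
    mul_ne_zero hε0 (Complex.exp_ne_zero (t * Complex.I)) (add_eq_left.1 h0)
  have hw : HasWindingNumber (fun t : ℝ =>
      f (z₀ + ε * Complex.exp (t * Complex.I)) / (ε * Complex.exp (t * Complex.I)) ^ m / c) 0 := by
    refine hasWindingNumber_of_re_pos ?_ (fun t => ?_) ?_
    · refine Continuous.div_const (Continuous.div ?_ (by fun_prop) fun t =>
        pow_ne_zero _ (mul_ne_zero hε0 (Complex.exp_ne_zero _))) c
      exact continuous_iff_continuousAt.2 fun t =>
        ContinuousAt.comp (g := f) (f := fun t : ℝ => z₀ + ε * Complex.exp (t * Complex.I))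
          (hball _ (hz t)).2 (by fun_prop)
    · have := (hball _ (hz t)).1 (hne t)
      rwa [add_sub_cancel_left] at this
    · simp only [exp_two_pi_mul_I]
  have hcw : HasWindingNumber (fun _ => c) 0 :=
    ⟨fun _ => c', continuousOn_const, fun t _ => ⟨hc, hc'⟩, by simp⟩
  have h3 := (hw.mul hcw).mul ((hasWindingNumber_circle ε hε.1).pow m)
  rw [add_zero, zero_add, mul_one] at h3
  refine h3.congr fun t _ => ?_
  have : (ε * Complex.exp (t * Complex.I)) ^ m ≠ 0 :=
    pow_ne_zero _ (mul_ne_zero hε0 (Complex.exp_ne_zero _))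
  field_simp

section manifold
variable {n : ℕ} {M : Type*} [TopologicalSpace M] [ChartedSpace (Cn n) M] [IsManifold (mdl n) ∞ M]
  [T1Space M] {b : BallEmbedding n M} {J : AlmostComplex n M} {J' : AlmostComplex n (BlowUp b)}
  {u : ℂ → BlowUp b} {L : Set M}

theorem disk_mem_nhds {z : ℂ} (hz : z ∈ Metric.ball (0 : ℂ) 1) : disk ∈ 𝓝 z :=
  mem_of_superset (Metric.isOpen_ball.mem_nhds hz) Metric.ball_subset_closedBall

namespace IsHolomorphicDisk
open BlowUp

theorem continuousAt {N : Type*} [TopologicalSpace N] [ChartedSpace (Cn n) N]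
    [IsManifold (mdl n) ∞ N] {K : AlmostComplex n N} {S : Set N} {v : ℂ → N}
    (hv : IsHolomorphicDisk K S v) {z : ℂ} (hz : z ∈ Metric.ball (0 : ℂ) 1) : ContinuousAt v z :=
  hv.smooth.continuousOn.continuousAt (disk_mem_nhds hz)

variable {S : Set (BlowUp b)}

/-- The components of a holomorphic disk in the holomorphic ball are holomorphic functions. -/
theorem differentiableAt (hu : IsHolomorphicDisk J' S u) (hbJ : b.IsHolomorphic J)
    (hJ' : IsBlowUpComplex b J J') {z : ℂ} (hz : z ∈ Metric.ball (0 : ℂ) 1)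
    (hs : proj b (u z) ∈ b.chart.source) (i : Fin n) :
    DifferentiableAt ℂ (fun z => b.chart (proj b (u z)) i) z := by
  have hd : MDifferentiableAt 𝓘(ℝ, ℂ) (mdl n) u z :=
    ((hu.smooth z (Metric.ball_subset_closedBall hz)).contMDiffAt (disk_mem_nhds hz)).mdifferentiableAt
      (by simp)
  have h1 : HasMFDerivAt 𝓘(ℝ, ℂ) (mdl n) (b.chart ∘ (proj b ∘ u)) z _ :=
    ((mdifferentiable_of_mem_maximalAtlas b.chart_mem).mdifferentiableAt hs).hasMFDerivAt.comp z
      (((contMDiff_proj (u z)).mdifferentiableAt (by simp)).hasMFDerivAt.comp z hd.hasMFDerivAt)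
  have h2 : HasFDerivAt (b.chart ∘ (proj b ∘ u)) _ z := hasMFDerivAt_iff_hasFDerivAt.1 h1
  have hI : ∀ v : ℂ, chartCoord b.chart (proj b (u z)) (dproj (u z)
      (mfderiv 𝓘(ℝ, ℂ) (mdl n) u z (Complex.I * v : ℂ))) =
      Complex.I • chartCoord b.chart (proj b (u z)) (dproj (u z)
        (mfderiv 𝓘(ℝ, ℂ) (mdl n) u z v)) := by
    intro v
    have h3 := hu.holomorphic z (Metric.ball_subset_closedBall hz) v
    rw [mfderivWithin_of_mem_nhds (disk_mem_nhds hz)] at h3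
    rw [h3, ← hbJ.chartCoord_J hs]
    exact congrArg _ (hJ' (u z) _)
  obtain ⟨F, hF⟩ : ∃ F : ℂ →L[ℝ] Cn n, F = (chartCoord b.chart (proj b (u z))).comp
    ((dproj (u z)).comp (mfderiv 𝓘(ℝ, ℂ) (mdl n) u z)) := ⟨_, rfl⟩
  have h2' : HasFDerivAt (b.chart ∘ (proj b ∘ u)) F z := by rw [hF]; exact h2
  have hI' : ∀ v : ℂ, F (Complex.I * v) = Complex.I • F v := by rw [hF]; exact hI
  -- A real derivative that commutes with `i` is the complex-linear map determined by its value at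
  -- `1`.
  have h4 : HasFDerivAt (b.chart ∘ (proj b ∘ u)) (ContinuousLinearMap.toSpanSingleton ℂ (F 1)) z := by
    refine hasFDerivAt_of_restrictScalars ℝ h2' ?_
    ext1 v
    have h5 : v = v.re • (1 : ℂ) + v.im • (Complex.I * 1) := by
      simp [Complex.re_add_im]
    conv_rhs => rw [h5, map_add, map_smul, map_smul, hI']
    change v • F 1 = _
    conv_lhs => rw [← Complex.re_add_im v, add_smul, mul_smul]
    rfl
  exact ((EuclideanSpace.proj i : Cn n →L[ℂ] ℂ).hasFDerivAt.comp z h4).differentiableAt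

theorem eventually_source (hu : IsHolomorphicDisk J' S u) {z : ℂ}
    (hz : z ∈ Metric.ball (0 : ℂ) 1) {j : Fin n} (hj : u z ∈ (excHomeo b j).source) :
    ∀ᶠ w in 𝓝 z, w ∈ Metric.ball (0 : ℂ) 1 ∧ u w ∈ (excHomeo b j).source :=
  Filter.Eventually.and (Metric.isOpen_ball.mem_nhds hz)
    ((hu.continuousAt hz) ((excHomeo b j).open_source.mem_nhds hj))

theorem analyticAt (hu : IsHolomorphicDisk J' S u) (hbJ : b.IsHolomorphic J)
    (hJ' : IsBlowUpComplex b J J') {z : ℂ} (hz : z ∈ Metric.ball (0 : ℂ) 1) {j : Fin n}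
    (hj : u z ∈ (excHomeo b j).source) (i : Fin n) :
    AnalyticAt ℂ (fun z => b.chart (proj b (u z)) i) z := by
  refine DifferentiableOn.analyticAt (s := {w | w ∈ Metric.ball (0 : ℂ) 1 ∧
    u w ∈ (excHomeo b j).source}) (fun w hw => ?_) (hu.eventually_source hz hj)
  exact (hu.differentiableAt hbJ hJ' hw.1 (proj_mem_source hw.2) i).differentiableWithinAt

theorem excDivisor_subset_source {p : BlowUp b} (hp : p ∈ excDivisor b) :
    ∃ j, p ∈ (excHomeo b j).source :=
  exists_excHomeo_source (by rw [show proj b p = b.center from hp]; exact center_mem_source)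

/-- At an interior point, either the disk lies in the exceptional divisor or it meets it in at most
this point. -/
theorem eventually_mem_or_notMem (hu : IsHolomorphicDisk J' S u) (hbJ : b.IsHolomorphic J)
    (hJ' : IsBlowUpComplex b J J') {z : ℂ} (hz : z ∈ Metric.ball (0 : ℂ) 1) :
    (∀ᶠ w in 𝓝 z, u w ∈ excDivisor b) ∨ ∀ᶠ w in 𝓝[≠] z, u w ∉ excDivisor b := by
  by_cases hE : u z ∈ excDivisor b
  · obtain ⟨j, hj⟩ := excDivisor_subset_source hE
    have hs := hu.eventually_source hz hj
    have hiff : ∀ w, u w ∈ (excHomeo b j).source →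
        (u w ∈ excDivisor b ↔ b.chart (proj b (u w)) j = 0) := fun w hw => by
      rw [mem_excDivisor_iff_of_source hw, excHomeo_apply_self]
    rcases (hu.analyticAt hbJ hJ' hz hj j).eventually_eq_zero_or_eventually_ne_zero with h | h
    · left
      filter_upwards [hs, h] with w hw h0
      exact (hiff w hw.2).2 h0
    · right
      filter_upwards [nhdsWithin_le_nhds hs, h] with w hw h0
      exact mt (hiff w hw.2).1 h0
  · right
    exact nhdsWithin_le_nhds ((hu.continuousAt hz)
      (isClosed_excDivisor.isOpen_compl.mem_nhds hE))

/-- A disk whose boundary avoids the exceptional divisor meets it in isolated points. -/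
theorem eventually_notMem_excDivisor (hu : IsHolomorphicDisk J' S u) (hbJ : b.IsHolomorphic J)
    (hJ' : IsBlowUpComplex b J J') (hS : ∀ p ∈ S, p ∉ excDivisor b) {z : ℂ}
    (hz : z ∈ Metric.ball (0 : ℂ) 1) : ∀ᶠ w in 𝓝[≠] z, u w ∉ excDivisor b := by
  refine (hu.eventually_mem_or_notMem hbJ hJ' hz).resolve_left fun hz0 => ?_
  -- By the dichotomy at interior points, the open set of points near which the disk lies in `E` is
  -- also closed in the open disk. If nonempty it is everything, and by continuity the boundary
  -- would lie in `E`.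
  let A : Set ℂ := {z | ∀ᶠ w in 𝓝 z, u w ∈ excDivisor b}
  have hA : IsOpen A := isOpen_setOfPred_eventually_nhds
  have hsub : Metric.ball (0 : ℂ) 1 ⊆ A := by
    refine (convex_ball (0 : ℂ) 1).isPreconnected.subset_of_closure_inter_subset hA ⟨z, hz, hz0⟩ ?_
    rintro x ⟨hxA, hx⟩
    refine (hu.eventually_mem_or_notMem hbJ hJ' hx).resolve_right fun hne => ?_
    by_cases hxA' : x ∈ A
    · have h1 : ∀ᶠ w in 𝓝[≠] x, u w ∈ excDivisor b := nhdsWithin_le_nhds hxA'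
      obtain ⟨w, hw1, hw2⟩ := (h1.and hne).exists
      exact hw2 hw1
    -- Points of `A` accumulate at `x` and differ from it because `x ∉ A`, whereas punctured
    -- neighbourhoods of `x` avoid `E`.
    · have h1 := (mem_closure_iff_frequently.1 hxA).and_eventually (eventually_nhdsWithin_iff.1 hne)
      obtain ⟨w, hwA, hw⟩ := h1.exists
      have h2 : u w ∈ excDivisor b := Filter.Eventually.self_of_nhds (p := fun w => u w ∈ excDivisor b) hwA
      exact hw (fun h => hxA' (h ▸ hwA)) h2
  have h1 : MapsTo u (Metric.ball (0 : ℂ) 1) (excDivisor b) := fun w hw => Filter.Eventually.self_of_nhds (p := fun w => u w ∈ excDivisor b) (hsub hw)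
  have h2 : closure (Metric.ball (0 : ℂ) 1) = disk := closure_ball 0 one_ne_zero
  have h3 : MapsTo u disk (excDivisor b) := by
    have := h1.closure_of_continuousOn (by rw [h2]; exact hu.smooth.continuousOn)
    rwa [h2, isClosed_excDivisor.closure_eq] at this
  exact hS _ (hu.boundary 1 (by simp)) (h3 (by simp))

theorem mem_ball_of_mem_excDivisor (hu : IsHolomorphicDisk J' S u)
    (hS : ∀ p ∈ S, p ∉ excDivisor b) {z : ℂ} (hz : z ∈ disk) (hzE : u z ∈ excDivisor b) :
    z ∈ Metric.ball (0 : ℂ) 1 := by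
  rcases lt_or_eq_of_le (mem_closedBall_zero_iff.1 hz) with h | h
  · exact mem_ball_zero_iff.2 h
  · exact absurd hzE (hS _ (hu.boundary z (mem_sphere_zero_iff_norm.2 h)))

/-- An infinite closed subset of the compact disk would accumulate at one of its points; that point
is interior, and intersections are isolated there. -/
theorem finite_preimage_excDivisor (hu : IsHolomorphicDisk J' S u) (hbJ : b.IsHolomorphic J)
    (hJ' : IsBlowUpComplex b J J') (hS : ∀ p ∈ S, p ∉ excDivisor b) :
    (disk ∩ u ⁻¹' excDivisor b).Finite := by
  by_contra hinf
  have hclosed : IsClosed (disk ∩ u ⁻¹' excDivisor b) :=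
    hu.smooth.continuousOn.preimage_isClosed_of_isClosed Metric.isClosed_closedBall
      isClosed_excDivisor
  have hK : IsCompact (disk ∩ u ⁻¹' excDivisor b) :=
    (isCompact_closedBall (0 : ℂ) 1).of_isClosed_subset hclosed inter_subset_left
  obtain ⟨x, hx, hacc⟩ := Set.Infinite.exists_accPt_of_subset_isCompact hinf hK Subset.rfl
  have h1 := hu.eventually_notMem_excDivisor hbJ hJ' hS
    (hu.mem_ball_of_mem_excDivisor hS hx.1 hx.2)
  obtain ⟨w, hw, hwE⟩ := ((accPt_iff_frequently_nhdsNE.1 hacc).and_eventually h1).exists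
  exact hwE hw.2

/-- The order of contact with the exceptional divisor at an isolated intersection point. -/
theorem exists_order (hu : IsHolomorphicDisk J' S u) (hbJ : b.IsHolomorphic J)
    (hJ' : IsBlowUpComplex b J J') (hS : ∀ p ∈ S, p ∉ excDivisor b) {z : ℂ}
    (hz : z ∈ Metric.ball (0 : ℂ) 1) (hzE : u z ∈ excDivisor b) :
    ∃ m : ℕ, ∀ j, u z ∈ (excHomeo b j).source → ∃ c : ℂ, c ≠ 0 ∧
      Tendsto (fun w => b.chart (proj b (u w)) j / (w - z) ^ m) (𝓝[≠] z) (𝓝 c) := by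
  have hne := hu.eventually_notMem_excDivisor hbJ hJ' hS hz
  obtain ⟨j, hj⟩ := excDivisor_subset_source hzE
  have hs := hu.eventually_source hz hj
  have han := hu.analyticAt hbJ hJ' hz hj j
  have hnz : ¬ ∀ᶠ w in 𝓝 z, b.chart (proj b (u w)) j = 0 := fun h0 => by
    obtain ⟨w, ⟨hw, hws⟩, hw0⟩ := ((hne.and (nhdsWithin_le_nhds hs)).and
      (nhdsWithin_le_nhds h0)).exists
    exact hw ((mem_excDivisor_iff_of_source hws.2).2 (by rw [excHomeo_apply_self, hw0]))
  obtain ⟨m, g, hg, hg0, hfg⟩ := han.exists_eventuallyEq_pow_smul_nonzero_iff.2 hnz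
  have hlim : Tendsto (fun w => b.chart (proj b (u w)) j / (w - z) ^ m) (𝓝[≠] z) (𝓝 (g z)) := by
    refine (hg.continuousAt.tendsto.mono_left nhdsWithin_le_nhds).congr' ?_
    filter_upwards [nhdsWithin_le_nhds hfg, self_mem_nhdsWithin] with w hw hwz
    rw [hw, smul_eq_mul, mul_div_cancel_left₀ _ (pow_ne_zero _ (sub_ne_zero.2 hwz))]
  -- The order does not depend on the chart: the local equations of `E` in the charts `k` and `j`
  -- have the ratio `fill j y k`, which is nonzero at a point lying in both charts.
  refine ⟨m, fun k hk => ⟨g z * fill j (excHomeo b j (u z)) k, mul_ne_zero hg0 ?_, ?_⟩⟩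
  · rw [mem_excHomeo_source] at hk hj
    rw [excHomeo_apply]
    cases h : u z with
    | off x hx => rw [h] at hzE; exact absurd hzE hx
    | exc l =>
      rw [h] at hk hj
      change fill j (excCoord j l.rep) k ≠ 0
      rw [fill_excCoord j hj]
      exact mul_ne_zero (inv_ne_zero hj) hk
  · have hfill : ContinuousAt (fun w => fill j (excHomeo b j (u w)) k) z :=
      ContinuousAt.comp (g := fun y : Cn n => fill j y k)
        (contDiff_fill_apply j k).continuous.continuousAt
        (ContinuousAt.comp (g := excHomeo b j) ((excHomeo b j).continuousAt hj)
          (hu.continuousAt hz))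
    refine (hlim.mul (hfill.tendsto.mono_left nhdsWithin_le_nhds)).congr' ?_
    filter_upwards [nhdsWithin_le_nhds hs] with w hw
    rw [← blowDown_excHomeo hw.2, blowDown_self, blowDown_apply]
    ring

/-- The local intersection index is the order of contact. -/
theorem hasLocalIndex_iff (hu : IsHolomorphicDisk J' S u) (hbJ : b.IsHolomorphic J)
    (hJ' : IsBlowUpComplex b J J') {z : ℂ} (hz : z ∈ Metric.ball (0 : ℂ) 1)
    (hzE : u z ∈ excDivisor b) {m : ℕ}
    (hm : ∀ j, u z ∈ (excHomeo b j).source → ∃ c : ℂ, c ≠ 0 ∧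
      Tendsto (fun w => b.chart (proj b (u w)) j / (w - z) ^ m) (𝓝[≠] z) (𝓝 c)) (k : ℤ) :
    HasLocalIndex b u z k ↔ k = m := by
  have key : ∀ j, u z ∈ (excHomeo b j).source → ∀ᶠ ε : ℝ in 𝓝[>] 0, HasWindingNumber
      (fun t => excChart b j (u (z + ε * Complex.exp (t * Complex.I))) j) m := by
    intro j hj
    obtain ⟨c, hc, hlim⟩ := hm j hj
    have hcont : ∀ᶠ w in 𝓝 z, ContinuousAt (fun w => b.chart (proj b (u w)) j) w := by
      filter_upwards [hu.eventually_source hz hj] with w hw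
      exact (hu.differentiableAt hbJ hJ' hw.1 (proj_mem_source hw.2) j).continuousAt
    filter_upwards [eventually_hasWindingNumber hc hcont hlim] with ε hε
    exact hε.congr fun t _ => excHomeo_apply_self j _
  constructor
  · rintro ⟨j, hj, h⟩
    obtain ⟨ε, h1, h2⟩ := (h.and (key j hj)).exists
    exact h1.unique h2
  · rintro rfl
    obtain ⟨j, hj⟩ := excDivisor_subset_source hzE
    exact ⟨j, hj, key j hj⟩

end IsHolomorphicDisk
end manifold
end LagBlowUp

namespace LagBlowUp

/-! ### Zeros of the determinant of the blow-down and the intersection number -/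

section manifold
variable {n : ℕ} {M : Type*} [TopologicalSpace M] [ChartedSpace (Cn n) M] [IsManifold (mdl n) ∞ M]
  [T2Space M] {b : BallEmbedding n M} {Ω : SymplecticForm n M} {J : AlmostComplex n M}
  {Ω' : SymplecticForm n (BlowUp b)} {J' : AlmostComplex n (BlowUp b)} {u : ℂ → BlowUp b}
  {Φ : ∀ z : ℂ, Cn n →L[ℝ] TangentSpace (mdl n) (BlowUp.proj b (u z))}
  {Ψ : ∀ z : ℂ, Cn n →L[ℝ] TangentSpace (mdl n) (u z)} {S : Set (BlowUp b)}

namespace BlowUp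

/-- The determinant of the derivative of the blow-up map vanishes to order `m (n - 1)` where the
disk meets the exceptional divisor to order `m`. -/
theorem tendsto_det_dprojCoord (hbJ : b.IsHolomorphic J) (hJ' : IsBlowUpComplex b J J')
    (hu : IsHolomorphicDisk J' S u)
    (hΦ : IsUnitaryTriv Ω J (fun z => proj b (u z)) disk Φ) (hΨ : IsUnitaryTriv Ω' J' u disk Ψ)
    {z : ℂ} (hz : z ∈ Metric.ball (0 : ℂ) 1) {j : Fin n} (hj : u z ∈ (excHomeo b j).source)
    {m : ℕ} {c : ℂ} (hc : c ≠ 0)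
    (hm : Tendsto (fun w => b.chart (proj b (u w)) j / (w - z) ^ m) (𝓝[≠] z) (𝓝 c)) :
    ∃ l : ℂ, l ≠ 0 ∧ Tendsto (fun w => (complexMatrix (dprojCoord Ω J u Φ Ψ w)).det /
      (w - z) ^ (m * (n - 1))) (𝓝[≠] z) (𝓝 l) := by
  have hs := hu.eventually_source hz hj
  let T : Set ℂ := {w | w ∈ disk ∧ u w ∈ (excHomeo b j).source}
  have hT : T ∈ 𝓝 z := by
    filter_upwards [hs] with w hw
    exact ⟨Metric.ball_subset_closedBall hw.1, hw.2⟩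
  have hTd : T ⊆ disk := fun w hw => hw.1
  have huT : ContinuousOn u T := hu.smooth.continuousOn.mono hTd
  let g : ℂ → ℂ := fun w => (chartMatrix Ω J (proj b (u w)) (Φ w) b.chart).det
  let h : ℂ → ℂ := fun w => (chartMatrix Ω' J' (u w) (Ψ w) (excHomeo b j)).det
  have hg : ContinuousAt g z :=
    (Continuous.matrix_det continuous_id).continuousAt.comp
      ((continuousOn_chartMatrix (hΦ.mono hTd) b.chart_mem
        (contMDiff_proj.continuous.comp_continuousOn huT)
        (fun w hw => proj_mem_source hw.2)).continuousAt hT)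
  have hh : ContinuousAt h z :=
    (Continuous.matrix_det continuous_id).continuousAt.comp
      ((continuousOn_chartMatrix (hΨ.mono hTd) (excHomeo_mem b j) huT
        (fun w hw => hw.2)).continuousAt hT)
  have hg0 : g z ≠ 0 := det_chartMatrix_ne_zero b.chart_mem (proj_mem_source hj)
    (hΦ.frame z (Metric.ball_subset_closedBall hz)) (hbJ.chartFrame_I_smul (proj_mem_source hj))
  -- The standard charts are holomorphic also at the points of `E`, so the determinant of their
  -- frame has no zeros and may be divided by.
  have hh0 : ∀ w ∈ T, h w ≠ 0 := fun w hw => det_chartMatrix_ne_zero (excHomeo_mem b j) hw.2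
    (hΨ.frame w hw.1) (fun v => (J_chartFrame hbJ hJ' hw.2 v).symm)
  refine ⟨g z / h z * c ^ (n - 1), mul_ne_zero (div_ne_zero hg0 (hh0 z (mem_of_mem_nhds hT)))
    (pow_ne_zero _ hc), ?_⟩
  have hlim := ((hg.div hh (hh0 z (mem_of_mem_nhds hT))).tendsto.mono_left
    (nhdsWithin_le_nhds (s := {z}ᶜ))).mul (hm.pow (n - 1))
  refine hlim.congr' ?_
  filter_upwards [nhdsWithin_le_nhds hT] with w hw
  have h1 := det_dprojCoord_mul hbJ hJ' hΦ hΨ hw.1 hw.2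
  rw [excHomeo_apply_self] at h1
  have h2 : (complexMatrix (dprojCoord Ω J u Φ Ψ w)).det =
      g w / h w * b.chart (proj b (u w)) j ^ (n - 1) := by
    rw [div_mul_eq_mul_div]
    exact eq_div_of_mul_eq (hh0 w hw) h1
  rw [h2, div_pow, pow_mul, Pi.div_apply, mul_div_assoc]

end BlowUp

namespace IsHolomorphicDisk
open BlowUp

/-- The intersection number is the number of intersections with multiplicities; the winding number
of the determinant of the derivative of the blow-up map along the boundary is `n - 1` times it. -/
theorem exists_intersectionNumber (hu : IsHolomorphicDisk J' S u) (hbJ : b.IsHolomorphic J)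
    (hJ' : IsBlowUpComplex b J J') (hS : ∀ p ∈ S, p ∉ excDivisor b)
    (hΦ : IsUnitaryTriv Ω J (fun z => proj b (u z)) disk Φ) (hΨ : IsUnitaryTriv Ω' J' u disk Ψ) :
    ∃ l : ℕ, (∀ k, HasIntersectionNumber b u k ↔ k = l) ∧ HasWindingNumber
      (fun t => (complexMatrix (dprojCoord Ω J u Φ Ψ (Complex.exp (t * Complex.I)))).det)
      ((l : ℤ) * (n - 1 : ℕ)) := by
  classical
  let s : Finset ℂ := (hu.finite_preimage_excDivisor hbJ hJ' hS).toFinset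
  have hs : ∀ z, z ∈ s ↔ z ∈ disk ∧ u z ∈ excDivisor b := fun z => by simp [s]
  have hsb : ∀ z ∈ s, z ∈ Metric.ball (0 : ℂ) 1 := fun z hz =>
    hu.mem_ball_of_mem_excDivisor hS ((hs z).1 hz).1 ((hs z).1 hz).2
  -- The order is chosen as a function on all of `ℂ`, with the dummy value `0` away from the
  -- intersection points.
  have hord : ∀ z, ∃ m : ℕ, z ∈ s → ∀ j, u z ∈ (excHomeo b j).source → ∃ c : ℂ, c ≠ 0 ∧
      Tendsto (fun w => b.chart (proj b (u w)) j / (w - z) ^ m) (𝓝[≠] z) (𝓝 c) := fun z => by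
    by_cases hz : z ∈ s
    · obtain ⟨m, hm⟩ := hu.exists_order hbJ hJ' hS (hsb z hz) ((hs z).1 hz).2
      exact ⟨m, fun _ => hm⟩
    · exact ⟨0, fun h => absurd h hz⟩
  choose m hm using hord
  have hloc : ∀ z ∈ s, ∀ k : ℤ, HasLocalIndex b u z k ↔ k = m z := fun z hz =>
    hu.hasLocalIndex_iff hbJ hJ' (hsb z hz) ((hs z).1 hz).2 (hm z hz)
  refine ⟨∑ z ∈ s, m z, fun k => ⟨?_, ?_⟩, ?_⟩
  · rintro ⟨s', k', hs', hk', rfl⟩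
    have : s' = s := by ext z; rw [hs', hs]
    subst this
    rw [Nat.cast_sum]
    exact Finset.sum_congr rfl fun z hz => (hloc z hz _).1 (hk' z hz).2
  · rintro rfl
    exact ⟨s, fun z => m z, hs, fun z hz => ⟨hsb z hz, (hloc z hz _).2 rfl⟩, by simp⟩
  -- The generalized argument principle, with multiplicity `m z * (n - 1)` at each intersection
  -- point.
  · have h1 := hasWindingNumber_of_zeros s (fun z => m z * (n - 1))
      (d := fun z => (complexMatrix (dprojCoord Ω J u Φ Ψ z)).det)
      ((Continuous.matrix_det continuous_id).comp_continuousOn (continuousOn_dprojCoord hΦ hΨ)) hsb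
      (fun z hz hzs => det_dprojCoord_ne_zero hJ' hΦ hΨ hz fun hE => hzs ((hs z).2 ⟨hz, hE⟩))
      (fun z hz => by
        obtain ⟨j, hj⟩ := excDivisor_subset_source ((hs z).1 hz).2
        obtain ⟨c, hc, hlim⟩ := hm z hz j hj
        exact tendsto_det_dprojCoord hbJ hJ' hu hΦ hΨ (hsb z hz) hj hc hlim)
    rw [Nat.cast_sum, Finset.sum_mul]
    simpa only [Nat.cast_mul] using h1

end IsHolomorphicDisk
end manifold
end LagBlowUp

end

/-! ### Assembly of the Maslov index formula -/

theorem propositionp {n : ℕ} (hn : 2 ≤ n) {M : Type*} [TopologicalSpace M] [T2Space M]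
    [ChartedSpace (LagBlowUp.Cn n) M] [IsManifold (LagBlowUp.mdl n) ∞ M]
    -- a symplectic manifold with a compatible almost complex structure
    (Ω : LagBlowUp.SymplecticForm n M) (J : LagBlowUp.AlmostComplex n M)
    (hJ : LagBlowUp.Compatible Ω J)
    -- a symplectic and holomorphic embedding of the ball of radius `r`
    (b : LagBlowUp.BallEmbedding n M) (hbΩ : b.IsSymplectic Ω) (hbJ : b.IsHolomorphic J)
    -- the symplectic blow-up of weight `ρ < r`
    (ρ δ : ℝ) (hρ : 0 < ρ) (hρr : ρ < b.r) (hδ : 0 < δ) (β : ℝ → ℝ)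
    (hβ : LagBlowUp.IsProfile b.r ρ δ β)
    (Ω' : LagBlowUp.SymplecticForm n (LagBlowUp.BlowUp b))
    (hΩ' : LagBlowUp.IsBlowUpForm b β Ω Ω')
    (J' : LagBlowUp.AlmostComplex n (LagBlowUp.BlowUp b))
    (hJ' : LagBlowUp.IsBlowUpComplex b J J')
    -- a Lagrangian submanifold away from the ball outside which the form is not changed
    (L : Set M) (hL : LagBlowUp.IsLagrangian Ω L)
    (hLb : Disjoint L (b.emb '' Metric.closedBall 0 (b.r - δ)))
    -- a holomorphic disk in the blow-up with boundary on the preimage of the Lagrangian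
    (u : ℂ → LagBlowUp.BlowUp b)
    (hu : LagBlowUp.IsHolomorphicDisk J' (LagBlowUp.BlowUp.proj b ⁻¹' L) u)
    (l : ℤ) (hl : LagBlowUp.intersectionNumber b u = l) :
    -- the three integers are well defined, and `u · E ≥ 0`
    (∃! k, LagBlowUp.HasIntersectionNumber b u k) ∧ 0 ≤ l ∧
    (∃! m, LagBlowUp.HasMaslovIndex Ω' (LagBlowUp.BlowUp.proj b ⁻¹' L) u m) ∧
    (∃! m, LagBlowUp.HasMaslovIndex Ω L (LagBlowUp.BlowUp.proj b ∘ u) m) ∧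
    -- the relation of the Maslov indices
    LagBlowUp.maslovIndex Ω' (LagBlowUp.BlowUp.proj b ⁻¹' L) u =
      LagBlowUp.maslovIndex Ω L (LagBlowUp.BlowUp.proj b ∘ u) - 2 * ((n : ℤ) - 1) * l := by
  have hδr := hβ.lt_radius hρ b.r_pos
  have hLc : ∀ x ∈ L, x ∉ b.emb '' Metric.closedBall 0 (b.r - δ) := fun x hx =>
    Set.disjoint_left.1 hLb hx
  have hbL : b.center ∉ L := fun h => hLc _ h (LagBlowUp.BlowUp.center_mem_emb_closedBall hδr)
  have hS : ∀ p ∈ LagBlowUp.BlowUp.proj b ⁻¹' L, p ∉ LagBlowUp.BlowUp.excDivisor b :=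
    fun p hp hpE => hbL ((show LagBlowUp.BlowUp.proj b p = b.center from hpE) ▸ hp)
  have hJ₁ := LagBlowUp.BlowUp.compatible hJ hbΩ hbJ hρ hδ hβ hΩ' hJ'
  have huc := hu.smooth.continuousOn
  obtain ⟨Φ, hΦ⟩ := LagBlowUp.exists_unitaryTriv_disk hJ
    (LagBlowUp.BlowUp.contMDiff_proj.continuous.comp_continuousOn huc)
  obtain ⟨Ψ, hΨ⟩ := LagBlowUp.exists_unitaryTriv_disk hJ₁ huc
  obtain ⟨k, hk, hw⟩ := hu.exists_intersectionNumber hbJ hJ' hS hΦ hΨ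
  -- `intersectionNumber` is a choice among the admissible values; the natural number `k` is the
  -- only one, which also yields `0 ≤ l`.
  have hlk : l = k := by
    rw [← hl]
    exact (hk _).1 (Classical.epsilon_spec ⟨(k : ℤ), (hk k).2 rfl⟩)
  obtain ⟨h1, h2, h3⟩ := LagBlowUp.BlowUp.maslovIndex_preimage hJ' hΦ hΨ hL hbL hu.boundary
    (fun p hp => LagBlowUp.BlowUp.form_eq_of_notMem hβ hδ hδr hΩ' (hLc _ hp)) huc hw
  -- The exponent `n - 1` came as a truncated natural subtraction; `2 ≤ n` turns it into the integer
  -- `n - 1`.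
  refine ⟨⟨k, (hk k).2 rfl, fun k' hk' => (hk k').1 hk'⟩, by omega, h1, h2, ?_⟩
  rw [h3, hlk, Nat.cast_sub (by omega)]
  push_cast
  ring
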